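/- \textbf{Conventions.} $\mathsf{Prof}$ is the monoidal bicategory whose objects are small categories, whose 1-cells $P : A \nrightarrow B$ are profunctors, i.e. functors $P : B^{\mathrm{op}} \times A \to \mathsf{Set}$, composed by $(Q \circ P)(c,a) = \int^{b} P(b,a) \times Q(c,b)$ with the hom-functors as identities, and whose 2-cells are natural transformations. Its tensor product is the product of categories (and $(P \otimes Q)((a',b'),(a,b)) = P(a',a) \times Q(b',b)$), its unit is the one-object category $\mathbb 1$, and its constraint 1-cells are the profunctors $F_\star(b,a) = \mathrm{Hom}(b,Fa)$ of the canonical functors $F$ between product categories. A \emph{pseudomonoid} on $A$ consists of 1-cells $\mu : A \otimes A \to A$, $\eta : \mathbb 1 \to A$ and invertible 2-cells $\alpha : \mu \circ (\mu \otimes 1) \cong \mu \circ (1 \otimes \mu)$, $\lambda : \mu \circ (\eta \otimes 1) \cong 1$, $\varrho : \mu \circ (1 \otimes \eta) \cong 1$ (up to the constraints of $\mathsf{Prof}$) that satisfy the pentagon and the triangle axioms. A \emph{biexact pairing} $X \dashv Y$ consists of 1-cells $\varepsilon : X \otimes Y \to \mathbb 1$ (the evaluation) and $\mathbb 1 \to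 Y \otimes X$ (the coevaluation) and invertible 2-cells between the two zig-zag composites and the identities of $X$ and $Y$. A pseudomonoid is \emph{Frobenius} if it is equipped with a 1-cell $\sigma : A \otimes A \to \mathbb 1$ that is the evaluation of a biexact pairing $A \dashv A$, and with an invertible 2-cell $\varphi : \sigma \circ (\mu \otimes 1) \cong \sigma \circ (1 \otimes \mu)$. It is \emph{$\dag$-Frobenius} if moreover $\mu$ and $\eta$ have right adjoints in $\mathsf{Prof}$. A \emph{$\star$-autonomous category} is a monoidal category $\mathcal D$ with an equivalence $D : \mathcal D \to \mathcal D^{\mathrm{op}}$ and bijections $\mathrm{Hom}(x \otimes y, Dz) \cong \mathrm{Hom}(x, D(y \otimes z))$ natural in $x,y,z$. \textbf{Theorem.} Every $\dag$-Frobenius pseudomonoid in $\mathsf{Prof}$ induces a $\star$-autonomous category. Precisely, let $A$ be a small category, let $(\mu,\eta,\alpha,\lambda,\varrho,\sigma,\varphi)$ be a $\dag$-Frobenius pseudomonoid on $A$, put $\mathcal C = A^{\mathrm{op}}$, and let $\iota : \mathcal C \to \widehat{\mathcal C}$ be the embedding into the idempotent (Cauchy) completion. Then $\widehat{\mathcal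 C}$ carries the structure of a $\star$-autonomous category $(\widehat{\mathcal C}, \otimes, I, D)$, for which there are isomorphisms of profunctors $$\mu(x; y,z) \cong \mathrm{Hom}(\iota y \otimes \iota z, \iota x), \qquad \eta(x) \cong \mathrm{Hom}(I, \iota x), \qquad \sigma(x,y) \cong \mathrm{Hom}(\iota x, D\,\iota y)$$ under which $\alpha, \lambda, \varrho$ are the 2-cells given by the associator and the left and right unitors of $\widehat{\mathcal C}$, and $\varphi$ is the 2-cell given by the bijections $\mathrm{Hom}(x \otimes y, Dz) \cong \mathrm{Hom}(x, D(y \otimes z))$. If $A$ is idempotent complete, then the same holds with $\mathcal C$ itself in place of $\widehat{\mathcal C}$ and the identity functor in place of $\iota$; in particular $\mu$ and $\eta$ are then representable by functors $\otimes : \mathcal C \times \mathcal C \to \mathcal C$ and $I : \mathbb 1 \to \mathcal C$. -/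

import Mathlib

open CategoryTheory Opposite

universe v u

/-- An object of the bicategory of profunctors: a small category. -/
structure Prof : Type (u + 1) where
  carrier : Type u
  [str : SmallCategory carrier]

namespace Prof

attribute [instance] Prof.str

section Coend

variable {B : Type u} [SmallCategory B]

/-- The bifunctor `(b, b') ↦ F b × G b'`. -/
@[simps]
def integrand (F : Bᵒᵖ ⥤ Type u) (G : B ⥤ Type u) : Bᵒᵖ ⥤ B ⥤ Type u where
  obj b :=
    { obj := fun b' => F.obj b × G.obj b'
      map := fun g => ↾(fun x => (x.1, G.map g x.2)) }
  map f := { app := fun b' => ↾(fun x => (F.map f x.1, x.2)) }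

/-- The coend `∫ᵇ F b × G b`. -/
def Tens (F : Bᵒᵖ ⥤ Type u) (G : B ⥤ Type u) : Type u :=
  Limits.Types.coend.{u} (integrand F G)

namespace Tens
variable {F F' : Bᵒᵖ ⥤ Type u} {G G' : B ⥤ Type u}

/-- The class of a pair `(x, y)` at the object `b`. -/
def mk (b : B) (x : F.obj (op b)) (y : G.obj b) : Tens F G := Quot.mk _ ⟨b, (x, y)⟩

lemma sound {b b' : B} (f : b ⟶ b') (x : F.obj (op b')) (y : G.obj b) :
    mk b (F.map f.op x) y = mk b' x (G.map f y) :=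
  Quot.sound (Limits.Types.coendRel.mk (F := integrand F G) f (x, y))

@[elab_as_elim]
lemma ind {motive : Tens F G → Prop} (h : ∀ b x y, motive (mk b x y)) (t : Tens F G) :
    motive t := by
  obtain ⟨b, x, y⟩ := t
  exact h b x y

/-- Maps out of the coend. -/
def lift {T : Sort*} (φ : ∀ b, F.obj (op b) → G.obj b → T)
    (h : ∀ {b b' : B} (f : b ⟶ b') (x : F.obj (op b')) (y : G.obj b),
      φ b (F.map f.op x) y = φ b' x (G.map f y)) : Tens F G → T :=
  Quot.lift (fun s => φ s.1 s.2.1 s.2.2) (by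
    rintro _ _ ⟨f, x⟩
    exact h f x.1 x.2)

@[simp]
lemma lift_mk {T : Sort*} (φ : ∀ b, F.obj (op b) → G.obj b → T) (h) (b x y) :
    lift (F := F) (G := G) φ h (mk b x y) = φ b x y := rfl

end Tens
end Coend

/-! ### Profunctors and their morphisms

`Profunctor A B` (written `A ⇸ B`) is a functor `A ⥤ Bᵒᵖ ⥤ Type`, that is, a functor
`Bᵒᵖ × A ⥤ Type`. -/

section Hom
variable {A B : Type u} [SmallCategory A] [SmallCategory B]

/-- The covariant action on the elements of a profunctor. -/
def lact (P : Profunctor.{u} A B) {a a' : A} (f : a ⟶ a') {b : B} (x : (P.obj a).obj (op b)) :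
    (P.obj a').obj (op b) := (P.map f).app (op b) x

/-- The contravariant action on the elements of a profunctor. -/
def ract (P : Profunctor.{u} A B) {a : A} {b b' : B} (g : b' ⟶ b) (x : (P.obj a).obj (op b)) :
    (P.obj a).obj (op b') := (P.obj a).map g.op x

@[simp] lemma lact_id (P : Profunctor.{u} A B) {a : A} {b : B} (x : (P.obj a).obj (op b)) :
    lact P (𝟙 a) x = x := by simp [lact]
@[simp] lemma ract_id (P : Profunctor.{u} A B) {a : A} {b : B} (x : (P.obj a).obj (op b)) :
    ract P (𝟙 b) x = x := by simp [ract]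
@[simp] lemma lact_comp (P : Profunctor.{u} A B) {a a' a'' : A} (f : a ⟶ a') (f' : a' ⟶ a'')
    {b : B} (x : (P.obj a).obj (op b)) : lact P (f ≫ f') x = lact P f' (lact P f x) := by
  simp [lact]
@[simp] lemma ract_comp (P : Profunctor.{u} A B) {a : A} {b b' b'' : B} (g : b' ⟶ b)
    (g' : b'' ⟶ b') (x : (P.obj a).obj (op b)) : ract P (g' ≫ g) x = ract P g' (ract P g x) := by
  simp [ract]
lemma lact_ract (P : Profunctor.{u} A B) {a a' : A} (f : a ⟶ a') {b b' : B} (g : b' ⟶ b)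
    (x : (P.obj a).obj (op b)) : lact P f (ract P g x) = ract P g (lact P f x) :=
  ConcreteCategory.congr_hom ((P.map f).naturality g.op) x

variable {P Q R : Profunctor.{u} A B}

/-- The component of a 2-cell, applied to an element. -/
def ev (φ : P ⟶ Q) {a : A} {b : B} (x : (P.obj a).obj (op b)) : (Q.obj a).obj (op b) :=
  (φ.app a).app (op b) x

lemma hom_ext {φ ψ : P ⟶ Q}
    (h : ∀ (a : A) (b : B) (x : (P.obj a).obj (op b)), ev φ x = ev ψ x) : φ = ψ := by
  ext a b x
  exact h a b.unop x

@[simp] lemma ev_id {a : A} {b : B} (x : (P.obj a).obj (op b)) : ev (𝟙 P) x = x := rfl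
@[simp] lemma ev_comp (φ : P ⟶ Q) (ψ : Q ⟶ R) {a : A} {b : B} (x : (P.obj a).obj (op b)) :
    ev (φ ≫ ψ) x = ev ψ (ev φ x) := rfl
lemma ev_lact (φ : P ⟶ Q) {a a' : A} (f : a ⟶ a') {b : B} (x : (P.obj a).obj (op b)) :
    ev φ (lact P f x) = lact Q f (ev φ x) :=
  ConcreteCategory.congr_hom (congr_app (φ.naturality f) (op b)) x
lemma ev_ract (φ : P ⟶ Q) {a : A} {b b' : B} (g : b' ⟶ b) (x : (P.obj a).obj (op b)) :
    ev φ (ract P g x) = ract Q g (ev φ x) :=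
  ConcreteCategory.congr_hom ((φ.app a).naturality g.op) x

/-- A 2-cell, from its action on elements. -/
def homMk (φ : ∀ (a : A) (b : B), (P.obj a).obj (op b) → (Q.obj a).obj (op b))
    (hl : ∀ {a a' : A} (f : a ⟶ a') {b : B} (x : (P.obj a).obj (op b)),
      φ a' b (lact P f x) = lact Q f (φ a b x))
    (hr : ∀ {a : A} {b b' : B} (g : b' ⟶ b) (x : (P.obj a).obj (op b)),
      φ a b' (ract P g x) = ract Q g (φ a b x)) : P ⟶ Q where
  app a :=
    { app := fun b => ↾(φ a b.unop)
      naturality := fun b b' g => by ext x; exact hr g.unop x }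
  naturality a a' f := by ext b x; exact hl f x

@[simp] lemma ev_homMk (φ : ∀ (a : A) (b : B), (P.obj a).obj (op b) → (Q.obj a).obj (op b))
    (hl hr) {a : A} {b : B} (x : (P.obj a).obj (op b)) :
    ev (homMk (P := P) (Q := Q) φ hl hr) x = φ a b x := rfl

/-- An invertible 2-cell, from a 2-cell and inverses of its components. -/
def isoMk (φ : P ⟶ Q) (ψ : ∀ (a : A) (b : B), (Q.obj a).obj (op b) → (P.obj a).obj (op b))
    (h₁ : ∀ (a : A) (b : B) (x : (P.obj a).obj (op b)), ψ a b (ev φ x) = x)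
    (h₂ : ∀ (a : A) (b : B) (x : (Q.obj a).obj (op b)), ev φ (ψ a b x) = x) : P ≅ Q where
  hom := φ
  inv := homMk ψ
    (fun {_ _} f {b} x => by
      conv_lhs => rw [← h₂ _ _ x, ← ev_lact, h₁])
    (fun g x => by
      conv_lhs => rw [← h₂ _ _ x, ← ev_ract, h₁])
  hom_inv_id := hom_ext fun a b x => h₁ a b x
  inv_hom_id := hom_ext fun a b x => h₂ a b x

@[simp] lemma isoMk_hom (φ : P ⟶ Q) (ψ h₁ h₂) : (isoMk φ ψ h₁ h₂).hom = φ := rfl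
@[simp] lemma ev_isoMk_inv (φ : P ⟶ Q)
    (ψ : ∀ (a : A) (b : B), (Q.obj a).obj (op b) → (P.obj a).obj (op b)) (h₁ h₂) {a : A} {b : B}
    (x : (Q.obj a).obj (op b)) : ev (isoMk φ ψ h₁ h₂).inv x = ψ a b x := rfl

end Hom

section Comp
variable {A B C D : Type u} [SmallCategory A] [SmallCategory B] [SmallCategory C] [SmallCategory D]

/-- The composite profunctor `(c, a) ↦ ∫ᵇ P(b, a) × Q(c, b)`. -/
def comp (P : Profunctor.{u} A B) (Q : Profunctor.{u} B C) : Profunctor.{u} A C where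
  obj a :=
    { obj := fun c => Tens (P.obj a) (Q.flip.obj c)
      map := fun {c c'} g => ↾(Tens.lift (fun b x y => Tens.mk b x ((Q.obj b).map g y))
        (fun f x y => by
          rw [Tens.sound]
          congr 1
          exact ConcreteCategory.congr_hom ((Q.map f).naturality g) y))
      map_id := fun c => by
        ext t; induction t using Tens.ind; simp
      map_comp := fun g g' => by
        ext t; induction t using Tens.ind; simp }
  map {a a'} f :=
    { app := fun c => ↾(Tens.lift (fun b x y => Tens.mk b ((P.map f).app (op b) x) y)
        (fun g x y => by
          rw [← Tens.sound]
          congr 1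
          exact (ConcreteCategory.congr_hom ((P.map f).naturality g.op) x)))
      naturality := fun c c' g => by
        ext t; induction t using Tens.ind; simp }
  map_id a := by
    ext c t; induction t using Tens.ind; simp
  map_comp f g := by
    ext c t; induction t using Tens.ind; simp

/-- The class of `(x, y)` in the composite. -/
def cmk {P : Profunctor.{u} A B} {Q : Profunctor.{u} B C} {a : A} {c : C} (b : B)
    (x : (P.obj a).obj (op b)) (y : (Q.obj b).obj (op c)) : ((comp P Q).obj a).obj (op c) :=
  Tens.mk b x y

variable {P P' : Profunctor.{u} A B} {Q Q' : Profunctor.{u} B C} {R : Profunctor.{u} C D}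

lemma cind {a : A} {c : C} {motive : ((comp P Q).obj a).obj (op c) → Prop}
    (h : ∀ b x y, motive (cmk b x y)) (t) : motive t := Tens.ind h t

lemma csound {a : A} {c : C} {b b' : B} (f : b ⟶ b') (x : (P.obj a).obj (op b'))
    (y : (Q.obj b).obj (op c)) :
    cmk (P := P) (Q := Q) b (ract P f x) y = cmk b' x (lact Q f y) :=
  Tens.sound (G := Q.flip.obj (op c)) f x y

/-- Maps out of the elements of a composite. -/
def clift {T : Sort*} {a : A} {c : C}
    (φ : ∀ b, (P.obj a).obj (op b) → (Q.obj b).obj (op c) → T)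
    (h : ∀ {b b' : B} (f : b ⟶ b') (x : (P.obj a).obj (op b')) (y : (Q.obj b).obj (op c)),
      φ b (ract P f x) y = φ b' x (lact Q f y)) : ((comp P Q).obj a).obj (op c) → T :=
  Tens.lift (G := Q.flip.obj (op c)) φ h

@[simp] lemma clift_cmk {T : Sort*} {a : A} {c : C}
    (φ : ∀ b, (P.obj a).obj (op b) → (Q.obj b).obj (op c) → T) (h) (b x y) :
    clift (P := P) (Q := Q) φ h (cmk b x y) = φ b x y := rfl

@[simp] lemma lact_cmk {a a' : A} (f : a ⟶ a') {c : C} (b : B)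
    (x : (P.obj a).obj (op b)) (y : (Q.obj b).obj (op c)) :
    lact (comp P Q) f (cmk b x y) = cmk b (lact P f x) y := rfl
@[simp] lemma ract_cmk {a : A} {c c' : C} (g : c' ⟶ c) (b : B)
    (x : (P.obj a).obj (op b)) (y : (Q.obj b).obj (op c)) :
    ract (comp P Q) g (cmk b x y) = cmk b x (ract Q g y) := rfl

/-- Horizontal composite of 2-cells. -/
def hcomp (φ : P ⟶ P') (ψ : Q ⟶ Q') : comp P Q ⟶ comp P' Q' :=
  homMk (fun a c => clift (fun b x y => cmk b (ev φ x) (ev ψ y))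
      (fun f x y => by rw [ev_ract, csound, ev_lact]))
    (fun {_ _} f {b} t => by
      induction t using cind with | h b x y => simp [ev_lact])
    (fun g t => by
      induction t using cind with | h b x y => simp [ev_ract])

@[simp] lemma ev_hcomp (φ : P ⟶ P') (ψ : Q ⟶ Q') {a : A} {c : C} (b : B)
    (x : (P.obj a).obj (op b)) (y : (Q.obj b).obj (op c)) :
    ev (hcomp φ ψ) (cmk b x y) = cmk b (ev φ x) (ev ψ y) := rfl

/-- Composition of profunctors is associative. -/
def compAssoc (P : Profunctor.{u} A B) (Q : Profunctor.{u} B C) (R : Profunctor.{u} C D) :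
    comp (comp P Q) R ≅ comp P (comp Q R) :=
  isoMk
    (homMk (fun a d => clift (fun c t z => clift (fun b x y => cmk b x (cmk c y z))
          (fun f x y => by rw [csound]; rfl) t)
        (fun g t z => by
          induction t using cind with
          | h b x y => simp [csound]))
      (fun {_ _} f {b} t => by
        induction t using cind with
        | h c t z => induction t using cind with | h b x y => rfl)
      (fun f t => by
        induction t using cind with
        | h c t z => induction t using cind with | h b x y => rfl))
    (fun a d => clift (fun b x t => clift (fun c y z => cmk c (cmk b x y) z)
        (fun f y z => by rw [← csound]; rfl) t)
      (fun g x t => by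
        induction t using cind with
        | h c y z => simp [csound]))
    (fun a d t => by
      induction t using cind with
      | h c t z => induction t using cind with | h b x y => rfl)
    (fun a d t => by
      induction t using cind with
      | h b x t => induction t using cind with | h c y z => rfl)

lemma ev_compAssoc_hom {a : A} {d : D} {b : B} {c : C} (x : (P.obj a).obj (op b))
    (y : (Q.obj b).obj (op c)) (z : (R.obj c).obj (op d)) :
    ev (compAssoc P Q R).hom (cmk c (cmk b x y) z) = cmk b x (cmk c y z) := rfl
lemma ev_compAssoc_inv {a : A} {d : D} {b : B} {c : C} (x : (P.obj a).obj (op b))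
    (y : (Q.obj b).obj (op c)) (z : (R.obj c).obj (op d)) :
    ev (compAssoc P Q R).inv (cmk b x (cmk c y z)) = cmk c (cmk b x y) z := rfl

lemma lact_id_eq {a a' : A} (f : a ⟶ a') {b : A} (x : b ⟶ a) :
    lact (Profunctor.id (C := A)) f x = x ≫ f := rfl
lemma ract_id_eq {a : A} {b b' : A} (f : b' ⟶ b) (x : b ⟶ a) :
    ract (Profunctor.id (C := A)) f x = f ≫ x := rfl

lemma cmk_hom_left {P : Profunctor.{u} A B} {a a' : A} {b : B} (f : a' ⟶ a)
    (x : (P.obj a').obj (op b)) :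
    cmk (P := Profunctor.id) (Q := P) (a := a) a' f x = cmk a (𝟙 a) (lact P f x) :=
  (congrArg (fun k => cmk (P := Profunctor.id) (Q := P) (a := a) a' k x)
    (Category.comp_id f).symm).trans (csound (P := Profunctor.id) (Q := P) f (𝟙 a) x)

lemma cmk_hom_right {P : Profunctor.{u} A B} {a : A} {b b' : B}
    (x : (P.obj a).obj (op b')) (f : b ⟶ b') :
    cmk (P := P) (Q := Profunctor.id) (c := b) b' x f = cmk b (ract P f x) (𝟙 b) :=
  (congrArg (fun k => cmk (P := P) (Q := Profunctor.id) (c := b) b' x k)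
    (Category.id_comp f).symm).trans (csound (P := P) (Q := Profunctor.id) f x (𝟙 b)).symm

/-- Left unit law of composition. -/
def compLeftUnitor (P : Profunctor.{u} A B) : comp (Profunctor.id (C := A)) P ≅ P :=
  isoMk
    (homMk (fun a b => clift (fun a' f x => lact P f x)
        (fun g f x => lact_comp P g f x))
      (fun {_ _} f {b} t => by
        induction t using cind with
        | h c g z => exact lact_comp P _ _ _)
      (fun f t => by
        induction t using cind with
        | h c g z => exact lact_ract P _ _ _))
    (fun a b x => cmk a (𝟙 a) x)
    (fun a d t => by
      induction t using cind with
      | h c g z =>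
        exact (cmk_hom_left g z).symm)
    (fun a d t => lact_id P t)

/-- Right unit law of composition. -/
def compRightUnitor (P : Profunctor.{u} A B) : comp P (Profunctor.id (C := B)) ≅ P :=
  isoMk
    (homMk (fun a b => clift (fun b' x f => ract P f x)
        (fun g x f => (ract_comp P g f x).symm))
      (fun {_ _} f {b} t => by
        induction t using cind with
        | h c z g => exact (lact_ract P _ _ _).symm)
      (fun f t => by
        induction t using cind with
        | h c z g => exact ract_comp P _ _ _))
    (fun a b x => cmk b x (𝟙 b))
    (fun a d t => by
      induction t using cind with
      | h c z g =>
        exact (cmk_hom_right z g).symm)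
    (fun a d t => ract_id P t)

end Comp

instance : CoeSort Prof.{u} (Type u) := ⟨Prof.carrier⟩

/-- The bicategory of small categories, profunctors (composed by coends, with the hom-profunctors
as identities) and natural transformations. -/
instance : Bicategory.{u, u + 1} Prof.{u} where
  Hom A B := Profunctor.{u} A B
  id A := Profunctor.id
  comp P Q := comp P Q
  homCategory A B := inferInstanceAs (Category (A ⥤ Bᵒᵖ ⥤ Type u))
  whiskerLeft P _ _ ψ := hcomp (𝟙 P) ψ
  whiskerRight φ Q := hcomp φ (𝟙 Q)
  associator P Q R := compAssoc P Q R
  leftUnitor P := compLeftUnitor P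
  rightUnitor P := compRightUnitor P
  whiskerLeft_id P Q := hom_ext fun a c t => by
    induction t using cind with | h b x y => rfl
  whiskerLeft_comp P Q R S φ ψ := hom_ext fun a c t => by
    induction t using cind with | h b x y => rfl
  id_whiskerLeft {_ _ P Q} φ := hom_ext fun a c t => by
    induction t using cind with
    | h b x y =>
      exact (cmk_hom_left (P := Q) x (ev φ y)).trans
          (congrArg (cmk (P := Profunctor.id) (Q := Q) (a := a) a (𝟙 a)) (ev_lact φ x y).symm)
  comp_whiskerLeft P Q R R' φ := hom_ext fun a c t => by
    induction t using cind with | h b t y => induction t using cind with | h b x z => rfl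
  id_whiskerRight P Q := hom_ext fun a c t => by
    induction t using cind with | h b x y => rfl
  comp_whiskerRight φ ψ Q := hom_ext fun a c t => by
    induction t using cind with | h b x y => rfl
  whiskerRight_id {_ _ P Q} φ := hom_ext fun a c t => by
    induction t using cind with
    | h b x y =>
      exact (cmk_hom_right _ y).trans
        (congrArg (fun z => cmk (P := Q) (Q := Profunctor.id) (c := c) c z (𝟙 c))
          (ev_ract φ y x).symm)
  whiskerRight_comp φ Q R := hom_ext fun a c t => by
    induction t using cind with | h b x t => induction t using cind with | h b y z => rfl
  whisker_assoc P Q Q' φ R := hom_ext fun a c t => by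
    induction t using cind with | h b t y => induction t using cind with | h b x z => rfl
  whisker_exchange φ ψ := hom_ext fun a c t => by
    induction t using cind with | h b x y => rfl
  pentagon P Q R S := hom_ext fun a c t => by
    induction t using cind with
    | h b t y =>
      induction t using cind with
      | h b t y => induction t using cind with | h b x z => rfl
  triangle P Q := hom_ext fun a c t => by
    induction t using cind with
    | h b t y => induction t using cind with | h b' x z => exact (csound z x y).symm

section Tensor
variable {A A' A'' B B' B'' C C' : Type u} [SmallCategory A] [SmallCategory A'] [SmallCategory A'']
  [SmallCategory B] [SmallCategory B'] [SmallCategory B''] [SmallCategory C] [SmallCategory C']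

/-- The tensor product `((a, b), (a', b')) ↦ P(a, a') × Q(b, b')` of two profunctors. -/
def tensor (P : Profunctor.{u} A A') (Q : Profunctor.{u} B B') :
    Profunctor.{u} (A × B) (A' × B') where
  obj x :=
    { obj := fun y => (P.obj x.1).obj (op y.unop.1) × (Q.obj x.2).obj (op y.unop.2)
      map := fun g => ↾(fun t => ((P.obj x.1).map g.unop.1.op t.1, (Q.obj x.2).map g.unop.2.op t.2))
      map_id := fun y => by
        ext t
        · exact ract_id P t.1
        · exact ract_id Q t.2
      map_comp := fun g g' => by
        ext t
        · exact ract_comp P g.unop.1 g'.unop.1 t.1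
        · exact ract_comp Q g.unop.2 g'.unop.2 t.2 }
  map f :=
    { app := fun y => ↾(fun t => ((P.map f.1).app (op y.unop.1) t.1,
        (Q.map f.2).app (op y.unop.2) t.2))
      naturality := fun y y' g => by
        ext t
        · exact lact_ract P f.1 g.unop.1 t.1
        · exact lact_ract Q f.2 g.unop.2 t.2 }
  map_id x := by
    ext y t
    · exact lact_id P t.1
    · exact lact_id Q t.2
  map_comp f f' := by
    ext y t
    · exact lact_comp P f.1 f'.1 t.1
    · exact lact_comp Q f.2 f'.2 t.2

/-- The tensor product of two 2-cells. -/
def tensorMap {P P' : Profunctor.{u} A A'} {Q Q' : Profunctor.{u} B B'} (φ : P ⟶ P')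
    (ψ : Q ⟶ Q') : tensor P Q ⟶ tensor P' Q' :=
  homMk (fun _ _ t => (ev φ t.1, ev ψ t.2))
    (fun {_ _} f {_} t => congrArg₂ Prod.mk (ev_lact φ f.1 t.1) (ev_lact ψ f.2 t.2))
    (fun g t => congrArg₂ Prod.mk (ev_ract φ g.1 t.1) (ev_ract ψ g.2 t.2))

/-- The tensor product of profunctors preserves identities. -/
def tensorIdIso :
    Profunctor.id (C := A × B) ≅ tensor (Profunctor.id (C := A)) (Profunctor.id (C := B)) :=
  isoMk (homMk (fun _ _ t => (t.1, t.2)) (fun _ _ _ => rfl) (fun _ _ => rfl))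
    (fun _ _ t => (t.1, t.2)) (fun _ _ _ => rfl) (fun _ _ _ => rfl)

/-- The tensor product of profunctors preserves composition. -/
def tensorCompIso (P : Profunctor.{u} A A') (P' : Profunctor.{u} A' A'') (Q : Profunctor.{u} B B')
    (Q' : Profunctor.{u} B' B'') :
    comp (tensor P Q) (tensor P' Q') ≅ tensor (comp P P') (comp Q Q') :=
  isoMk
    (homMk
      (fun a c => clift (fun b x y => (cmk b.1 x.1 y.1, cmk b.2 x.2 y.2))
        (fun f x y => Prod.ext (csound f.1 x.1 y.1) (csound f.2 x.2 y.2)))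
      (fun {_ _} f {_} t => by
        induction t using cind with | h b x y => rfl)
      (fun g t => by
        induction t using cind with | h b x y => rfl))
    (fun a c t => clift (fun b x y => clift (fun b' x' y' => cmk (b, b') (x, x') (y, y'))
          (fun {b' b''} f x' y' => by
            have h := csound (P := tensor P Q) (Q := tensor P' Q') (a := a) (c := c) (b := (b, b'))
              (b' := (b, b'')) ((𝟙 b, f) : (b, b') ⟶ (b, b'')) (x, x') (y, y')
            exact ((congrArg (fun z => cmk (P := tensor P Q) (Q := tensor P' Q') (a := a) (c := c)
              (b, b') (z, ract Q f x') (y, y')) (ract_id P x).symm).trans h).trans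
              (congrArg (fun z => cmk (P := tensor P Q) (Q := tensor P' Q') (a := a) (c := c)
              (b, b'') (x, x') (z, lact Q' f y')) (lact_id P' y))) t.2)
        (fun {b b'} f x y => by
          obtain ⟨t, t'⟩ := t
          induction t' using cind with
          | h b'' x' y' =>
            have h := csound (P := tensor P Q) (Q := tensor P' Q') (a := a) (c := c) (b := (b, b''))
              (b' := (b', b'')) ((f, 𝟙 b'') : (b, b'') ⟶ (b', b'')) (x, x') (y, y')
            exact ((congrArg (fun z => cmk (P := tensor P Q) (Q := tensor P' Q') (a := a) (c := c)
              (b, b'') (ract P f x, z) (y, y')) (ract_id Q x').symm).trans h).trans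
              (congrArg (fun z => cmk (P := tensor P Q) (Q := tensor P' Q') (a := a) (c := c)
              (b', b'') (x, x') (lact P' f y, z)) (lact_id Q' y'))) t.1)
    (fun a c t => by
      induction t using cind with | h b x y => rfl)
    (fun a c t => by
      obtain ⟨t, t'⟩ := t
      induction t using cind with
      | h b x y => induction t' using cind with | h b' x' y' => rfl)


end Tensor

section Companion

variable {A A' B B' C C' : Type u} [SmallCategory A] [SmallCategory A'] [SmallCategory B]
  [SmallCategory B'] [SmallCategory C] [SmallCategory C']

/-- `F_⋆ ≫ P` is the restriction of `P` along `F`. -/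
def companionLeftIso (F : A ⥤ B) (P : Profunctor.{u} B C) : comp F.toProfunctor P ≅ F ⋙ P :=
  isoMk
    (homMk
      (fun a c => clift (fun b f x => lact P f x) (fun g f x => lact_comp P g f x))
      (fun {_ _} f {_} t => by
        induction t using cind with | h b g x => exact lact_comp P g (F.map f) x)
      (fun g t => by
        induction t using cind with | h b f x => exact lact_ract P f g x))
    (fun a c x => cmk (P := F.toProfunctor) (a := a) (F.obj a) (𝟙 (F.obj a)) x)
    (fun a c t => by
      induction t using cind with
      | h b f x =>
        exact (csound (P := F.toProfunctor) (Q := P) (a := a) f (𝟙 (F.obj a)) x).symm.trans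
          (congrArg (fun k => cmk (P := F.toProfunctor) (Q := P) (a := a) b k x)
            (Category.comp_id _)))
    (fun a c x => lact_id P x)

/-- If `G' ⊣ G`, then `P ≫ G_⋆` is the restriction of `P` along `G'`. -/
def companionRightIso (P : Profunctor.{u} A B) {G : B ⥤ C} {G' : C ⥤ B} (adj : G' ⊣ G) :
    comp P G.toProfunctor ≅ P.whiskerLeft₂ (𝟭 A) G' :=
  isoMk
    (homMk
      (fun a c => clift (fun b x g => ract P ((adj.homEquiv c b).symm g) x)
        (fun {b b'} f x g => by
          exact (ract_comp P f ((adj.homEquiv c b).symm g) x).symm.trans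
            (congrArg (fun k => ract P k x) (adj.homEquiv_naturality_right_symm g f).symm)))
      (fun {_ _} f {_} t => by
        induction t using cind with
        | h b x g => exact (lact_ract P f _ x).symm)
      (fun {_ _ _} h t => by
        induction t using cind with
        | h b x g =>
          exact (congrArg (fun k => ract P k x) (adj.homEquiv_naturality_left_symm h g)).trans
            (ract_comp P _ (G'.map h) x)))
    (fun a c x => cmk (P := P) (Q := G.toProfunctor) (a := a) (c := c) (G'.obj c) x
      (adj.unit.app c))
    (fun a c t => by
      induction t using cind with
      | h b x g =>
        exact (csound (P := P) (Q := G.toProfunctor) ((adj.homEquiv c b).symm g) x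
          (adj.unit.app c)).trans (congrArg (cmk (P := P) (Q := G.toProfunctor) b x)
            ((adj.homEquiv_unit (f := (adj.homEquiv c b).symm g)).symm.trans
              ((adj.homEquiv c b).apply_symm_apply g))))
    (fun a c x => by
      exact (congrArg (fun k => ract P k x)
        (((adj.homEquiv c (G'.obj c)).symm_apply_eq).2 (adj.homEquiv_id c).symm)).trans
          (ract_id P x))

/-- `F ↦ F_⋆` preserves composition. -/
def companionCompIso (F : A ⥤ B) (G : B ⥤ C) :
    comp F.toProfunctor G.toProfunctor ≅ (F ⋙ G).toProfunctor :=
  companionLeftIso F G.toProfunctor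

/-- `F_⋆ ⊗ G_⋆ ≅ (F × G)_⋆`. -/
def companionTensorIso (F : A ⥤ A') (G : B ⥤ B') :
    tensor F.toProfunctor G.toProfunctor ≅ (F.prod G).toProfunctor :=
  isoMk (homMk (fun _ _ t => (t.1, t.2)) (fun _ _ _ => rfl) (fun _ _ => rfl))
    (fun _ _ t => (t.1, t.2)) (fun _ _ _ => rfl) (fun _ _ _ => rfl)

/-- Naturality of the associator `((a, b), c) ↦ (a, (b, c))` with respect to profunctors. -/
def assocNatIso (P : Profunctor.{u} A A') (Q : Profunctor.{u} B B') (R : Profunctor.{u} C C') :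
    comp (tensor (tensor P Q) R) (prod.associator A' B' C').toProfunctor ≅
      comp (prod.associator A B C).toProfunctor (tensor P (tensor Q R)) :=
  companionRightIso (tensor (tensor P Q) R) (prod.associativity A' B' C').symm.toAdjunction ≪≫
    isoMk
      (Q := prod.associator A B C ⋙ tensor P (tensor Q R))
      (homMk (fun _ _ t => (t.1.1, (t.1.2, t.2))) (fun _ _ _ => rfl) (fun _ _ => rfl))
      (fun _ _ t => ((t.1, t.2.1), t.2.2)) (fun _ _ _ => rfl) (fun _ _ _ => rfl) ≪≫
    (companionLeftIso (prod.associator A B C) (tensor P (tensor Q R))).symm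

end Companion

/-! ### The monoidal structure of the bicategory of profunctors

On objects the tensor product is the product of categories and the unit is the one-object category.
The constraint 1-cells are the companions of the canonical functors between product categories. -/

section Monoidal

open Bicategory

/-- The tensor product of objects. -/
abbrev tensorObj (A B : Prof.{u}) : Prof.{u} := ⟨A × B⟩

/-- The unit object: the one-object category. -/
abbrev unitObj : Prof.{u} := ⟨Discrete PUnit.{u + 1}⟩

/-- The companion `F_⋆` of a functor, `F_⋆(b, a) = Hom(b, F a)`. -/
def companion {A B : Prof.{u}} (F : A ⥤ B) : A ⟶ B := F.toProfunctor

/-- The tensor product of 1-cells. -/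
def tensorHom {A A' B B' : Prof.{u}} (P : A ⟶ A') (Q : B ⟶ B') :
    tensorObj A B ⟶ tensorObj A' B' := tensor P Q

infixr:75 " ⊠ₚ " => tensorHom

variable {A A' A'' B B' B'' C C' : Prof.{u}}

/-- The tensor product of 2-cells. -/
def tensorHom₂ {P P' : A ⟶ A'} {Q Q' : B ⟶ B'} (φ : P ⟶ P') (ψ : Q ⟶ Q') :
    P ⊠ₚ Q ⟶ P' ⊠ₚ Q' := tensorMap φ ψ

/-- The tensor product of invertible 2-cells. -/
def tensorHom₂Iso {P P' : A ⟶ A'} {Q Q' : B ⟶ B'} (φ : P ≅ P') (ψ : Q ≅ Q') :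
    P ⊠ₚ Q ≅ P' ⊠ₚ Q' where
  hom := tensorHom₂ φ.hom ψ.hom
  inv := tensorHom₂ φ.inv ψ.inv
  hom_inv_id := hom_ext fun _ _ t => congrArg₂ Prod.mk
    (congrArg (fun k => ev k t.1) φ.hom_inv_id) (congrArg (fun k => ev k t.2) ψ.hom_inv_id)
  inv_hom_id := hom_ext fun _ _ t => congrArg₂ Prod.mk
    (congrArg (fun k => ev k t.1) φ.inv_hom_id) (congrArg (fun k => ev k t.2) ψ.inv_hom_id)

/-- `(P ⊠ Q) ≫ (P' ⊠ Q') ≅ (P ≫ P') ⊠ (Q ≫ Q')`. -/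
def tensorComp (P : A ⟶ A') (P' : A' ⟶ A'') (Q : B ⟶ B') (Q' : B' ⟶ B'') :
    (P ⊠ₚ Q) ≫ (P' ⊠ₚ Q') ≅ (P ≫ P') ⊠ₚ (Q ≫ Q') := tensorCompIso P P' Q Q'

/-- `1 ≅ 1 ⊠ 1`. -/
def tensorId (A B : Prof.{u}) : 𝟙 (tensorObj A B) ≅ 𝟙 A ⊠ₚ 𝟙 B := tensorIdIso

/-- `(P ≫ Q) ⊠ 1 ≅ (P ⊠ 1) ≫ (Q ⊠ 1)`. -/
def compTensorId (P : A ⟶ A') (P' : A' ⟶ A'') (B : Prof.{u}) :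
    (P ≫ P') ⊠ₚ 𝟙 B ≅ (P ⊠ₚ 𝟙 B) ≫ (P' ⊠ₚ 𝟙 B) :=
  tensorHom₂Iso (Iso.refl _) (λ_ (𝟙 B)).symm ≪≫ (tensorComp P P' (𝟙 B) (𝟙 B)).symm

/-- `1 ⊠ (Q ≫ Q') ≅ (1 ⊠ Q) ≫ (1 ⊠ Q')`. -/
def idTensorComp (A : Prof.{u}) (Q : B ⟶ B') (Q' : B' ⟶ B'') :
    𝟙 A ⊠ₚ (Q ≫ Q') ≅ (𝟙 A ⊠ₚ Q) ≫ (𝟙 A ⊠ₚ Q') :=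
  tensorHom₂Iso (λ_ (𝟙 A)).symm (Iso.refl _) ≪≫ (tensorComp (𝟙 A) (𝟙 A) Q Q').symm

/-- The interchange 2-cell `(P ⊠ 1) ≫ (1 ⊠ Q) ≅ (1 ⊠ Q) ≫ (P ⊠ 1)`. -/
def interchange (P : A ⟶ A') (Q : B ⟶ B') :
    (P ⊠ₚ 𝟙 B) ≫ (𝟙 A' ⊠ₚ Q) ≅ (𝟙 A ⊠ₚ Q) ≫ (P ⊠ₚ 𝟙 B') :=
  tensorComp P (𝟙 A') (𝟙 B) Q ≪≫ tensorHom₂Iso (ρ_ P ≪≫ (λ_ P).symm) (λ_ Q ≪≫ (ρ_ Q).symm) ≪≫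
    (tensorComp (𝟙 A) P Q (𝟙 B')).symm

/-- The associator 1-cell. -/
def assocHom (A B C : Prof.{u}) :
    tensorObj (tensorObj A B) C ⟶ tensorObj A (tensorObj B C) :=
  companion (prod.associator A B C)

/-- The inverse associator 1-cell. -/
def assocInv (A B C : Prof.{u}) :
    tensorObj A (tensorObj B C) ⟶ tensorObj (tensorObj A B) C :=
  companion (prod.inverseAssociator A B C)

/-- The left unitor 1-cell. -/
def leftUnitHom (A : Prof.{u}) : tensorObj unitObj A ⟶ A :=
  companion (CategoryTheory.Prod.snd (Discrete PUnit.{u + 1}) A)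

/-- The inverse left unitor 1-cell. -/
def leftUnitInv (A : Prof.{u}) : A ⟶ tensorObj unitObj A :=
  companion (CategoryTheory.Prod.sectR (⟨PUnit.unit⟩ : Discrete PUnit.{u + 1}) A)

/-- The right unitor 1-cell. -/
def rightUnitHom (A : Prof.{u}) : tensorObj A unitObj ⟶ A :=
  companion (CategoryTheory.Prod.fst A (Discrete PUnit.{u + 1}))

/-- The inverse right unitor 1-cell. -/
def rightUnitInv (A : Prof.{u}) : A ⟶ tensorObj A unitObj :=
  companion (CategoryTheory.Prod.sectL A (⟨PUnit.unit⟩ : Discrete PUnit.{u + 1}))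

/-- Naturality 2-cell of the associator. -/
def assocNat (P : A ⟶ A') (Q : B ⟶ B') (R : C ⟶ C') :
    ((P ⊠ₚ Q) ⊠ₚ R) ≫ assocHom A' B' C' ≅ assocHom A B C ≫ (P ⊠ₚ (Q ⊠ₚ R)) :=
  assocNatIso P Q R

/-- `F_⋆ ≫ G_⋆ ≅ (F ⋙ G)_⋆`. -/
def companionComp {A B C : Prof.{u}} (F : A ⥤ B) (G : B ⥤ C) :
    companion F ≫ companion G ≅ companion (F ⋙ G) := companionCompIso F G

/-- `F_⋆ ⊠ 1 ≅ (F × 1)_⋆`. -/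
def companionTensorId {A A' : Prof.{u}} (F : A ⥤ A') (B : Prof.{u}) :
    companion F ⊠ₚ 𝟙 B ≅ companion (A := tensorObj A B) (B := tensorObj A' B) (F.prod (𝟭 B)) :=
  companionTensorIso F (𝟭 B)

/-- `1 ⊠ G_⋆ ≅ (1 × G)_⋆`. -/
def idTensorCompanion {B B' : Prof.{u}} (A : Prof.{u}) (G : B ⥤ B') :
    𝟙 A ⊠ₚ companion G ≅ companion (A := tensorObj A B) (B := tensorObj A B') ((𝟭 A).prod G) :=
  companionTensorIso (𝟭 A) G

/-- A natural isomorphism of functors induces an isomorphism of companions. -/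
def companionIso {A B : Prof.{u}} {F G : A ⥤ B} (e : F ≅ G) : companion F ≅ companion G :=
  isoMk (P := F.toProfunctor) (Q := G.toProfunctor)
    (homMk (fun a b f => ((show b ⟶ F.obj a from f) ≫ e.hom.app a : b ⟶ G.obj a))
      (fun {_ _} f {b} g => by
        exact (Category.assoc (show b ⟶ _ from g) _ _).trans
          ((congrArg (fun k => (show b ⟶ _ from g) ≫ k) (e.hom.naturality f)).trans
            (Category.assoc (show b ⟶ _ from g) _ _).symm))
      (fun _ _ => Category.assoc _ _ _))
    (fun a b f => ((show b ⟶ G.obj a from f) ≫ e.inv.app a : b ⟶ F.obj a))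
    (fun a b f => ((Category.assoc _ _ _).trans
      (congrArg (fun k => (show b ⟶ F.obj a from f) ≫ k) (e.hom_inv_id_app a))).trans
        (Category.comp_id _))
    (fun a b f => ((Category.assoc _ _ _).trans
      (congrArg (fun k => (show b ⟶ G.obj a from f) ≫ k) (e.inv_hom_id_app a))).trans
        (Category.comp_id _))

/-- The pentagon of the associator functors of product categories commutes. -/
def pentagonFunctorIso (A B C D : Prof.{u}) :
    (prod.associator A B C).prod (𝟭 D) ⋙ prod.associator A (B × C) D ⋙
      (𝟭 A).prod (prod.associator B C D) ≅
    prod.associator (A × B) C D ⋙ prod.associator A B (C × D) :=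
  NatIso.ofComponents (fun x => Iso.refl (x.1.1.1, (x.1.1.2, (x.1.2, x.2))))
    (fun _ => (Category.comp_id _).trans (Category.id_comp _).symm)

/-- The triangle of the constraint functors of product categories commutes. -/
def triangleFunctorIso (A B : Prof.{u}) :
    prod.associator A (Discrete PUnit.{u + 1}) B ⋙
      (𝟭 A).prod (CategoryTheory.Prod.snd (Discrete PUnit.{u + 1}) B) ≅
    (CategoryTheory.Prod.fst A (Discrete PUnit.{u + 1})).prod (𝟭 B) :=
  NatIso.ofComponents (fun x => Iso.refl (x.1.1, x.2))
    (fun _ => (Category.comp_id _).trans (Category.id_comp _).symm)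

/-- Two sides of the pentagon of associators, as the companion of a functor. -/
def pentagonLeft (A B C D : Prof.{u}) :
    assocHom A (tensorObj B C) D ≫ (𝟙 A ⊠ₚ assocHom B C D) ≅
      companion (A := tensorObj (tensorObj A (tensorObj B C)) D)
        (B := tensorObj A (tensorObj B (tensorObj C D)))
        (prod.associator A (B × C) D ⋙ (𝟭 A).prod (prod.associator B C D)) :=
  whiskerLeftIso (assocHom A (tensorObj B C) D)
      (idTensorCompanion (B := tensorObj (tensorObj B C) D) (B' := tensorObj B (tensorObj C D)) A
        (prod.associator B C D)) ≪≫
    companionComp (A := tensorObj (tensorObj A (tensorObj B C)) D)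
        (B := tensorObj A (tensorObj (tensorObj B C) D))
        (C := tensorObj A (tensorObj B (tensorObj C D)))
        (prod.associator A (B × C) D) ((𝟭 A).prod (prod.associator B C D))

/-- Three sides of the pentagon of associators, as the companion of a functor. -/
def pentagonLeft' (A B C D : Prof.{u}) :
    (assocHom A B C ⊠ₚ 𝟙 D) ≫ assocHom A (tensorObj B C) D ≫ (𝟙 A ⊠ₚ assocHom B C D) ≅
      companion (A := tensorObj (tensorObj (tensorObj A B) C) D)
        (B := tensorObj A (tensorObj B (tensorObj C D)))
        ((prod.associator A B C).prod (𝟭 D) ⋙ prod.associator A (B × C) D ⋙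
          (𝟭 A).prod (prod.associator B C D)) :=
  whiskerLeftIso (assocHom A B C ⊠ₚ 𝟙 D) (pentagonLeft A B C D) ≪≫
  whiskerRightIso (companionTensorId (A := tensorObj (tensorObj A B) C)
      (A' := tensorObj A (tensorObj B C)) (prod.associator A B C) D) _ ≪≫
    companionComp (A := tensorObj (tensorObj (tensorObj A B) C) D)
      (B := tensorObj (tensorObj A (tensorObj B C)) D)
      (C := tensorObj A (tensorObj B (tensorObj C D)))
      ((prod.associator A B C).prod (𝟭 D))
      (prod.associator A (B × C) D ⋙ (𝟭 A).prod (prod.associator B C D))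

/-- The other two sides of the pentagon of associators, as the companion of a functor. -/
def pentagonRight (A B C D : Prof.{u}) :
    assocHom (tensorObj A B) C D ≫ assocHom A B (tensorObj C D) ≅
      companion (A := tensorObj (tensorObj (tensorObj A B) C) D)
        (B := tensorObj A (tensorObj B (tensorObj C D)))
        (prod.associator (A × B) C D ⋙ prod.associator A B (C × D)) :=
  companionComp (A := tensorObj (tensorObj (tensorObj A B) C) D)
      (B := tensorObj (tensorObj A B) (tensorObj C D))
      (C := tensorObj A (tensorObj B (tensorObj C D)))
      (prod.associator (A × B) C D) (prod.associator A B (C × D))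

/-- The pentagonator, an invertible 2-cell filling the pentagon of associator 1-cells. -/
def pentagonator (A B C D : Prof.{u}) :
    (assocHom A B C ⊠ₚ 𝟙 D) ≫ assocHom A (tensorObj B C) D ≫ (𝟙 A ⊠ₚ assocHom B C D) ≅
      assocHom (tensorObj A B) C D ≫ assocHom A B (tensorObj C D) :=
  pentagonLeft' A B C D ≪≫
    companionIso (A := tensorObj (tensorObj (tensorObj A B) C) D)
      (B := tensorObj A (tensorObj B (tensorObj C D))) (pentagonFunctorIso A B C D) ≪≫
    (pentagonRight A B C D).symm

/-- The invertible 2-cell filling the triangle of an associator and the unitors. -/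
def triangulator (A B : Prof.{u}) :
    assocHom A unitObj B ≫ (𝟙 A ⊠ₚ leftUnitHom B) ≅ rightUnitHom A ⊠ₚ 𝟙 B :=
  whiskerLeftIso _ (idTensorCompanion (B := tensorObj unitObj B) A
      (CategoryTheory.Prod.snd (Discrete PUnit.{u + 1}) B)) ≪≫
    companionComp (A := tensorObj (tensorObj A unitObj) B)
      (B := tensorObj A (tensorObj unitObj B)) (C := tensorObj A B)
      (prod.associator A (Discrete PUnit.{u + 1}) B)
      ((𝟭 A).prod (CategoryTheory.Prod.snd (Discrete PUnit.{u + 1}) B)) ≪≫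
    companionIso (A := tensorObj (tensorObj A unitObj) B) (B := tensorObj A B)
      (triangleFunctorIso A B) ≪≫
    (companionTensorId (A := tensorObj A unitObj) (A' := A)
      (CategoryTheory.Prod.fst A (Discrete PUnit.{u + 1})) B).symm

end Monoidal

open Bicategory

/-- One leg of the pentagon axiom of a pseudomonoid: associativity is applied to the first three
factors, then to the first, the product of the middle two and the last, then to the last three.
The composition `⊗≫` inserts associators and unitors of the bicategory. -/
def pentagonTop {A : Prof.{u}} (mul : tensorObj A A ⟶ A)
    (assoc : (mul ⊠ₚ 𝟙 A) ≫ mul ≅ assocHom A A A ≫ (𝟙 A ⊠ₚ mul) ≫ mul) :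
    ((mul ⊠ₚ 𝟙 A) ⊠ₚ 𝟙 A) ≫ (mul ⊠ₚ 𝟙 A) ≫ mul ⟶
      (assocHom (tensorObj A A) A A ≫ assocHom A A (tensorObj A A)) ≫
        (𝟙 A ⊠ₚ (𝟙 A ⊠ₚ mul)) ≫ (𝟙 A ⊠ₚ mul) ≫ mul :=
  𝟙 (((mul ⊠ₚ 𝟙 A) ⊠ₚ 𝟙 A) ≫ (mul ⊠ₚ 𝟙 A) ≫ mul) ⊗≫
    (compTensorId (mul ⊠ₚ 𝟙 A) mul A).inv ▷ mul ⊗≫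
    tensorHom₂ assoc.hom (𝟙 (𝟙 A)) ▷ mul ⊗≫
    (compTensorId (assocHom A A A) ((𝟙 A ⊠ₚ mul) ≫ mul) A).hom ▷ mul ⊗≫
    (assocHom A A A ⊠ₚ 𝟙 A) ◁ (compTensorId (𝟙 A ⊠ₚ mul) mul A).hom ▷ mul ⊗≫
    (assocHom A A A ⊠ₚ 𝟙 A) ◁ ((𝟙 A ⊠ₚ mul) ⊠ₚ 𝟙 A) ◁ assoc.hom ⊗≫
    (assocHom A A A ⊠ₚ 𝟙 A) ◁ (assocNat (𝟙 A) mul (𝟙 A)).hom ▷ ((𝟙 A ⊠ₚ mul) ≫ mul) ⊗≫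
    ((assocHom A A A ⊠ₚ 𝟙 A) ≫ assocHom A (tensorObj A A) A) ◁
      (idTensorComp A (mul ⊠ₚ 𝟙 A) mul).inv ▷ mul ⊗≫
    ((assocHom A A A ⊠ₚ 𝟙 A) ≫ assocHom A (tensorObj A A) A) ◁
      tensorHom₂ (𝟙 (𝟙 A)) assoc.hom ▷ mul ⊗≫
    ((assocHom A A A ⊠ₚ 𝟙 A) ≫ assocHom A (tensorObj A A) A) ◁
      (idTensorComp A (assocHom A A A) ((𝟙 A ⊠ₚ mul) ≫ mul)).hom ▷ mul ⊗≫
    ((assocHom A A A ⊠ₚ 𝟙 A) ≫ assocHom A (tensorObj A A) A ≫ (𝟙 A ⊠ₚ assocHom A A A)) ◁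
      (idTensorComp A (𝟙 A ⊠ₚ mul) mul).hom ▷ mul ⊗≫
    (pentagonator A A A A).hom ▷ ((𝟙 A ⊠ₚ (𝟙 A ⊠ₚ mul)) ≫ (𝟙 A ⊠ₚ mul) ≫ mul)

/-- The other leg of the pentagon axiom of a pseudomonoid: associativity is applied twice, with an
interchange of the two outer multiplications in between. -/
def pentagonBottom {A : Prof.{u}} (mul : tensorObj A A ⟶ A)
    (assoc : (mul ⊠ₚ 𝟙 A) ≫ mul ≅ assocHom A A A ≫ (𝟙 A ⊠ₚ mul) ≫ mul) :
    ((mul ⊠ₚ 𝟙 A) ⊠ₚ 𝟙 A) ≫ (mul ⊠ₚ 𝟙 A) ≫ mul ⟶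
      (assocHom (tensorObj A A) A A ≫ assocHom A A (tensorObj A A)) ≫
        (𝟙 A ⊠ₚ (𝟙 A ⊠ₚ mul)) ≫ (𝟙 A ⊠ₚ mul) ≫ mul :=
  ((mul ⊠ₚ 𝟙 A) ⊠ₚ 𝟙 A) ◁ assoc.hom ⊗≫
    (assocNat mul (𝟙 A) (𝟙 A)).hom ▷ ((𝟙 A ⊠ₚ mul) ≫ mul) ⊗≫
    assocHom (tensorObj A A) A A ◁
      tensorHom₂ (𝟙 mul) (tensorId A A).inv ▷ ((𝟙 A ⊠ₚ mul) ≫ mul) ⊗≫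
    assocHom (tensorObj A A) A A ◁ (interchange mul mul).hom ▷ mul ⊗≫
    assocHom (tensorObj A A) A A ◁ (𝟙 (tensorObj A A) ⊠ₚ mul) ◁ assoc.hom ⊗≫
    assocHom (tensorObj A A) A A ◁
      tensorHom₂ (tensorId A A).hom (𝟙 mul) ▷ (assocHom A A A ≫ (𝟙 A ⊠ₚ mul) ≫ mul) ⊗≫
    assocHom (tensorObj A A) A A ◁
      (assocNat (𝟙 A) (𝟙 A) mul).hom ▷ ((𝟙 A ⊠ₚ mul) ≫ mul) ⊗≫
    𝟙 ((assocHom (tensorObj A A) A A ≫ assocHom A A (tensorObj A A)) ≫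
      (𝟙 A ⊠ₚ (𝟙 A ⊠ₚ mul)) ≫ (𝟙 A ⊠ₚ mul) ≫ mul)

/-- A pseudomonoid structure on an object of the monoidal bicategory of profunctors:
multiplication, unit, and invertible associativity and unit 2-cells, subject to the pentagon and the
triangle axioms. -/
structure Pseudomonoid (A : Prof.{u}) where
  /-- Multiplication. -/
  mul : tensorObj A A ⟶ A
  /-- Unit. -/
  one : unitObj ⟶ A
  assoc : (mul ⊠ₚ 𝟙 A) ≫ mul ≅ assocHom A A A ≫ (𝟙 A ⊠ₚ mul) ≫ mul
  leftUnit : (one ⊠ₚ 𝟙 A) ≫ mul ≅ leftUnitHom A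
  rightUnit : (𝟙 A ⊠ₚ one) ≫ mul ≅ rightUnitHom A
  pentagon : pentagonTop mul assoc = pentagonBottom mul assoc
  triangle :
    𝟙 (((𝟙 A ⊠ₚ one) ⊠ₚ 𝟙 A) ≫ (mul ⊠ₚ 𝟙 A) ≫ mul) ⊗≫
      ((𝟙 A ⊠ₚ one) ⊠ₚ 𝟙 A) ◁ assoc.hom ⊗≫
      (assocNat (𝟙 A) one (𝟙 A)).hom ▷ ((𝟙 A ⊠ₚ mul) ≫ mul) ⊗≫
      assocHom A unitObj A ◁ (idTensorComp A (one ⊠ₚ 𝟙 A) mul).inv ▷ mul ⊗≫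
      assocHom A unitObj A ◁ tensorHom₂ (𝟙 (𝟙 A)) leftUnit.hom ▷ mul ⊗≫
      (triangulator A A).hom ▷ mul =
    𝟙 (((𝟙 A ⊠ₚ one) ⊠ₚ 𝟙 A) ≫ (mul ⊠ₚ 𝟙 A) ≫ mul) ⊗≫
      (compTensorId (𝟙 A ⊠ₚ one) mul A).inv ▷ mul ⊗≫
      tensorHom₂ rightUnit.hom (𝟙 (𝟙 A)) ▷ mul

/-- A biexact pairing `X ⊣ Y` with the given evaluation `X ⊗ Y ⟶ 1`: a coevaluation `1 ⟶ Y ⊗ X`,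
such that the two zig-zag composites are isomorphic to identities, by chosen invertible 2-cells. -/
structure BiexactPairing (X Y : Prof.{u}) (eval : tensorObj X Y ⟶ unitObj) where
  coeval : unitObj ⟶ tensorObj Y X
  zigzagLeft : rightUnitInv X ≫ (𝟙 X ⊠ₚ coeval) ≫ assocInv X Y X ≫ (eval ⊠ₚ 𝟙 X) ≫
    leftUnitHom X ≅ 𝟙 X
  zigzagRight : 𝟙 Y ≅ leftUnitInv Y ≫ (coeval ⊠ₚ 𝟙 Y) ≫ assocHom Y X Y ≫ (𝟙 Y ⊠ₚ eval) ≫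
    rightUnitHom Y

/-- A Frobenius pseudomonoid: a pseudomonoid with a form `σ : A ⊗ A ⟶ 1` that is the evaluation of
a biexact pairing `A ⊣ A`, and an invertible 2-cell `σ ∘ (μ ⊗ 1) ≅ σ ∘ (1 ⊗ μ)`. -/
structure FrobeniusPseudomonoid (A : Prof.{u}) extends Pseudomonoid A where
  form : tensorObj A A ⟶ unitObj
  pairing : BiexactPairing A A form
  invariance : (mul ⊠ₚ 𝟙 A) ≫ form ≅ assocHom A A A ≫ (𝟙 A ⊠ₚ mul) ≫ form

/-- A †-Frobenius pseudomonoid: a Frobenius pseudomonoid whose multiplication and unit have right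
adjoints in the bicategory of profunctors. -/
structure DaggerFrobeniusPseudomonoid (A : Prof.{u}) extends FrobeniusPseudomonoid A where
  mul_isLeftAdjoint : IsLeftAdjoint mul
  one_isLeftAdjoint : IsLeftAdjoint one

/-! ### Elements of profunctors

Between composites of 1-cells in the bicategory, a 2-cell is determined by what it does to elements;
the following names write such elements down. -/

/-- The elements of a profunctor `P : A ⇸ B`, at `a : A` and `b : B`; covariant in `a` and
contravariant in `b`. -/
abbrev El {A B : Prof.{u}} (P : A ⟶ B) (a : A) (b : B) : Type u :=
  (Functor.obj (C := A) (D := Bᵒᵖ ⥤ Type u) P a).obj (op b)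

/-- A pair of elements, as an element of the tensor product. -/
def pairEl {A A' B B' : Prof.{u}} {P : A ⟶ A'} {Q : B ⟶ B'} {a : A} {a' : A'} {b : B} {b' : B'}
    (x : El P a a') (y : El Q b b') : El (P ⊠ₚ Q) (a, b) (a', b') := (x, y)

/-- A morphism, as an element of the identity profunctor. -/
def homEl {A : Prof.{u}} {a b : A} (f : b ⟶ a) : El (𝟙 A) a b := f

/-- An element of a companion. -/
def companionEl {A B : Prof.{u}} (F : A ⥤ B) {a : A} {b : B} (f : b ⟶ F.obj a) :
    El (companion F) a b := f

/-- The morphism that an element of a companion is. -/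
def companionElHom {A B : Prof.{u}} (F : A ⥤ B) {a : A} {b : B} (t : El (companion F) a b) :
    b ⟶ F.obj a := t

/-- The class of `(x, y)` in a composite. -/
def compEl {A B C : Prof.{u}} {P : A ⟶ B} {Q : B ⟶ C} {a : A} {c : C} (b : B)
    (x : El P a b) (y : El Q b c) : El (P ≫ Q) a c := cmk b x y

/-- The identity of `(a, (b, c))`, as an element of the associator 1-cell. -/
def assocEl {A B C : Prof.{u}} (a : A) (b : B) (c : C) :
    El (assocHom A B C) ((a, b), c) (a, (b, c)) :=
  companionEl (A := tensorObj (tensorObj A B) C) (B := tensorObj A (tensorObj B C))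
    (prod.associator A B C) (𝟙 (a, (b, c)))

/-- The morphism that an element of the left unitor 1-cell is. -/
def leftUnitElHom {A : Prof.{u}} {b a : A} (t : El (leftUnitHom A) (⟨PUnit.unit⟩, b) a) : a ⟶ b :=
  companionElHom (A := tensorObj unitObj A) (CategoryTheory.Prod.snd (Discrete PUnit.{u + 1}) A) t

/-- The morphism that an element of the right unitor 1-cell is. -/
def rightUnitElHom {A : Prof.{u}} {b a : A} (t : El (rightUnitHom A) (b, ⟨PUnit.unit⟩) a) :
    a ⟶ b :=
  companionElHom (A := tensorObj A unitObj) (CategoryTheory.Prod.fst A (Discrete PUnit.{u + 1})) t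

/-- A 2-cell applied to an element. -/
def evEl {A B : Prof.{u}} {P Q : A ⟶ B} (φ : P ⟶ Q) {a : A} {b : B} (x : El P a b) : El Q a b :=
  ev φ x

end Prof

open MonoidalCategory

/-- The structure that makes a monoidal category ⋆-autonomous: an equivalence `D : C ≌ Cᵒᵖ` and
bijections `Hom(x ⊗ y, D z) ≃ Hom(x, D (y ⊗ z))`, natural in `x`, `y` and `z`. -/
structure StarAutonomous (C : Type u) [Category.{v} C] [MonoidalCategory C] where
  /-- The duality. -/
  D : C ≌ Cᵒᵖ
  formEquiv (x y z : C) : (x ⊗ y ⟶ (D.functor.obj z).unop) ≃ (x ⟶ (D.functor.obj (y ⊗ z)).unop)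
  formEquiv_naturality {x x' y y' z z' : C} (f : x' ⟶ x) (g : y' ⟶ y) (h : z' ⟶ z)
    (t : x ⊗ y ⟶ (D.functor.obj z).unop) :
    formEquiv x' y' z' ((f ⊗ₘ g) ≫ t ≫ (D.functor.map h).unop) =
      f ≫ formEquiv x y z t ≫ (D.functor.map (g ⊗ₘ h)).unop

namespace Prof

section Representation

variable {A : Prof.{u}} {C : Type u} [SmallCategory C]

/-- The profunctor `(a, x) ↦ Hom_C(G x, ι a)`. -/
def corep {X : Prof.{u}} (ι : (A : Type u)ᵒᵖ ⥤ C) (G : X ⥤ Cᵒᵖ) : X ⟶ A :=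
  G ⋙ coyoneda ⋙ (Functor.whiskeringLeft (A : Type u)ᵒᵖ C (Type u)).obj ι

/-- For a functor `ι : Aᵒᵖ ⥤ C` into a monoidal category, the profunctor
`((y, z), x) ↦ Hom_C(ι y ⊗ ι z, ι x)`. -/
def tensorRep [MonoidalCategory C] (ι : (A : Type u)ᵒᵖ ⥤ C) : tensorObj A A ⟶ A :=
  corep (X := tensorObj A A) ι
    { obj := fun y => op (ι.obj (op y.1) ⊗ ι.obj (op y.2))
      map := fun f => (ι.map f.1.op ⊗ₘ ι.map f.2.op).op
      map_id := fun y => congrArg Quiver.Hom.op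
        ((congrArg₂ (fun f g => f ⊗ₘ g) (ι.map_id (op y.1)) (ι.map_id (op y.2))).trans
          (MonoidalCategory.id_tensorHom_id _ _))
      map_comp := fun f g => congrArg Quiver.Hom.op
        ((congrArg₂ (fun f g => f ⊗ₘ g) (ι.map_comp g.1.op f.1.op)
          (ι.map_comp g.2.op f.2.op)).trans
            (MonoidalCategory.tensorHom_comp_tensorHom _ _ _ _).symm) }

/-- For a functor `ι : Aᵒᵖ ⥤ C` into a monoidal category, the profunctor `x ↦ Hom_C(1, ι x)`. -/
def unitRep [MonoidalCategory C] (ι : (A : Type u)ᵒᵖ ⥤ C) : unitObj ⟶ A :=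
  corep (X := unitObj) ι ((Functor.const _).obj (op (𝟙_ C)))

/-- For a functor `ι : Aᵒᵖ ⥤ C` and a duality `D` of `C`, the profunctor
`(x, y) ↦ Hom_C(ι x, D (ι y))`. -/
def formRep (ι : (A : Type u)ᵒᵖ ⥤ C) (D : C ≌ Cᵒᵖ) : tensorObj A A ⟶ unitObj :=
  Profunctor.ofCore
    { obj := fun x _ => ι.obj (op x.1) ⟶ (D.functor.obj (ι.obj (op x.2))).unop
      map := fun f _ => ↾(fun t => ι.map f.1.op ≫ t ≫ (D.functor.map (ι.map f.2.op)).unop)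
      map_id := fun _ _ => by ext t; simp
      map_comp := fun _ _ _ _ => by ext t; simp }

/-- The morphism `ι y ⊗ ι z ⟶ ι x` that represents an element of `μ`. -/
def mulHom [MonoidalCategory C] {ι : (A : Type u)ᵒᵖ ⥤ C} {μ : tensorObj A A ⟶ A}
    (e : μ ≅ tensorRep ι) {y z x : A} (m : El μ (y, z) x) :
    ι.obj (op y) ⊗ ι.obj (op z) ⟶ ι.obj (op x) := evEl e.hom m

/-- The morphism `1 ⟶ ι x` that represents an element of `η`. -/
def oneHom [MonoidalCategory C] {ι : (A : Type u)ᵒᵖ ⥤ C} {η : unitObj ⟶ A}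
    (e : η ≅ unitRep ι) {x : A} (m : El η ⟨PUnit.unit⟩ x) : 𝟙_ C ⟶ ι.obj (op x) := evEl e.hom m

/-- The morphism `ι x ⟶ D (ι y)` that represents an element of `σ`. -/
def formHom {ι : (A : Type u)ᵒᵖ ⥤ C} {D : C ≌ Cᵒᵖ} {σ : tensorObj A A ⟶ unitObj}
    (e : σ ≅ formRep ι D) {x y : A} (s : El σ (x, y) ⟨PUnit.unit⟩) :
    ι.obj (op x) ⟶ (D.functor.obj (ι.obj (op y))).unop := evEl e.hom s

end Representation

/-- A ⋆-autonomous structure on `C` that is induced by a †-Frobenius pseudomonoid `F` on `A` along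
`ι : Aᵒᵖ ⥤ C`. The multiplication, unit and form of `F` are represented by the tensor product, the
unit object and the duality of `C`, that is,
`μ(x; y, z) ≅ Hom(ι y ⊗ ι z, ι x)`, `η(x) ≅ Hom(1, ι x)` and `σ(x, y) ≅ Hom(ι x, D (ι y))`,
and under these isomorphisms the structural 2-cells of `F` are those given by the associator and
unitors of `C` and by the bijection `Hom(x ⊗ y, D z) ≃ Hom(x, D (y ⊗ z))`. The compatibilities say
this elementwise: for example, if the associativity 2-cell of `F` takes the class of `(m, n)` to the
class of `(m', n')`, then the morphisms `(b ⊗ c) ⊗ d ⟶ a` and `b ⊗ (c ⊗ d) ⟶ a` represented by the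
two classes correspond to each other under the associator of `C`. -/
structure InducedStarAutonomous {A : Prof.{u}} (F : DaggerFrobeniusPseudomonoid A)
    {C : Type u} [SmallCategory C] (ι : (A : Type u)ᵒᵖ ⥤ C) where
  monoidal : MonoidalCategory C
  star : StarAutonomous C
  mulIso : F.mul ≅ tensorRep ι
  oneIso : F.one ≅ unitRep ι
  formIso : F.form ≅ formRep ι star.D
  assoc_compat {b c d a x y x' y' : A}
    (m : El F.mul (b, c) x) (h : y ⟶ d) (n : El F.mul (x, y) a)
    (h' : x' ⟶ b) (m' : El F.mul (c, d) y') (n' : El F.mul (x', y') a) :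
    evEl F.assoc.hom (compEl (x, y) (pairEl m (homEl h)) n) =
      compEl (P := assocHom A A A) (Q := (𝟙 A ⊠ₚ F.mul) ≫ F.mul) (b, (c, d)) (assocEl _ _ _)
        (compEl (P := 𝟙 A ⊠ₚ F.mul) (Q := F.mul) (x', y') (pairEl (homEl h') m') n') →
    (mulHom mulIso m ⊗ₘ ι.map h.op) ≫ mulHom mulIso n =
      (α_ (ι.obj (op b)) (ι.obj (op c)) (ι.obj (op d))).hom ≫
        (ι.map h'.op ⊗ₘ mulHom mulIso m') ≫ mulHom mulIso n'
  leftUnit_compat {b a x y : A}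
    (e : El F.one ⟨PUnit.unit⟩ x) (h : y ⟶ b) (n : El F.mul (x, y) a) :
    (oneHom oneIso e ⊗ₘ ι.map h.op) ≫ mulHom mulIso n =
      (λ_ (ι.obj (op b))).hom ≫
        ι.map (leftUnitElHom
          (evEl F.leftUnit.hom (compEl (x, y) (pairEl e (homEl h)) n))).op
  rightUnit_compat {b a x y : A}
    (h : x ⟶ b) (e : El F.one ⟨PUnit.unit⟩ y) (n : El F.mul (x, y) a) :
    (ι.map h.op ⊗ₘ oneHom oneIso e) ≫ mulHom mulIso n =
      (ρ_ (ι.obj (op b))).hom ≫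
        ι.map (rightUnitElHom
          (evEl F.rightUnit.hom (compEl (x, y) (pairEl (homEl h) e) n))).op
  form_compat {a b c x y x' y' : A}
    (m : El F.mul (a, b) x) (h : y ⟶ c) (s : El F.form (x, y) ⟨PUnit.unit⟩)
    (h' : x' ⟶ a) (m' : El F.mul (b, c) y') (s' : El F.form (x', y') ⟨PUnit.unit⟩) :
    evEl F.invariance.hom (compEl (x, y) (pairEl m (homEl h)) s) =
      compEl (P := assocHom A A A) (Q := (𝟙 A ⊠ₚ F.mul) ≫ F.form) (a, (b, c)) (assocEl _ _ _)
        (compEl (P := 𝟙 A ⊠ₚ F.mul) (Q := F.form) (x', y') (pairEl (homEl h') m') s') →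
    star.formEquiv (ι.obj (op a)) (ι.obj (op b)) (ι.obj (op c))
        (mulHom mulIso m ≫ formHom formIso s ≫ (star.D.functor.map (ι.map h.op)).unop) =
      ι.map h'.op ≫ formHom formIso s' ≫ (star.D.functor.map (mulHom mulIso m')).unop

end Prof

/-! A 1-cell `X ⟶ A` is a functor from `X` to presheaves on `A`. The argument works for any
idempotent complete `C` and any fully faithful `ι : Aᵒᵖ ⥤ C` such that every object of `C` is a
retract of some `ι a` (`IsRetractDense`); the Karoubi envelope is one case, and the identity is
another when `A` is idempotent complete. Then `X ↦ Hom(X, ι -)` (`nerve`) embeds `C` fully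
faithfully into `(Psh A)ᵒᵖ`, and `X ↦ Hom(ι -, X)` (`conerve`) embeds it into copresheaves. Their
essential images are the retracts of representables and of corepresentables, so a structure on all
presheaves descends to `C` as soon as it respects such retracts.

Tensor product. A pseudomonoid makes presheaves monoidal under Day convolution `∫ M y × N z × μ(x;
y, z)`, and the convolution of the representables at `y` and `z` is `μ(-; y, z)`. A 1-cell with a
right adjoint takes values in retracts of representables (`exists_retract_of_isLeftAdjoint`): the
unit of the adjunction at an identity is the class of a single pair, and the triangle identity for
that pair is a retraction. Hence convolution and its unit restrict to `C`
(`IsRetractDense.exists_monoidal`), and they represent `μ` and `η` by the Yoneda lemma.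

Duality. The zig-zag 2-cells contract the coevaluation with `σ`, along either variable, to the
hom-functor (`Contraction`). So `M ↦ ∫ M y × σ(-, y)` is an equivalence from presheaves to
copresheaves (`Contraction.equivalence`). It sends representables to retracts of corepresentables,
and its inverse does the converse. The two zig-zags are not assumed compatible, so the evident
candidates for these retractions compose only to an isomorphism, which suffices. The restriction to
`C` is a duality `D` (`IsRetractDense.exists_duality`), and the co-Yoneda lemma identifies `Hom(X, D
Y)` with the convolution along `σ` of the presheaves of `X` and `Y` (`convHomEquiv`).

Invariance of the form is associativity of convolution with `σ` in place of the outer `μ`; this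
gives the bijections `Hom(X ⊗ Y, D Z) ≃ Hom(X, D (Y ⊗ Z))`. For this reason associativity is
developed for an arbitrary outer 1-cell `Q` and 2-cell `θ`. Coherence and compatibility are checked
on elements: `AssocRel` records a value of `θ`, and `exists_assocRel` supplies one whose
hom-components are identities. -/

namespace Prof

open Bicategory

/-- Presheaves on an object of the bicategory of profunctors. -/
abbrev Psh (A : Prof.{u}) := (A : Type u)ᵒᵖ ⥤ Type u

/-- The object of the unit category. -/
abbrev pt : (unitObj.{u} : Type u) := ⟨PUnit.unit⟩

/-! ### Evaluation of 2-cells on elements -/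

/-- The adjunction of this equivalence has identity units. The formula is needed because `assocNat`
is built from `companionRightIso`, which restricts elements along this bijection. -/
lemma prodAssociativity_homEquiv_symm {A B C : Type u} [SmallCategory A] [SmallCategory B]
    [SmallCategory C] {a a' : A} {b b' : B} {c c' : C} (g : (a, (b, c)) ⟶ (a', (b', c'))) :
    ((prod.associativity A B C).symm.toAdjunction.homEquiv (a, (b, c)) ((a', b'), c')).symm g =
      ((g.1, g.2.1), g.2.2) :=
  (Equiv.symm_apply_eq _).2 (by
    refine ((prod.associativity A B C).symm.toAdjunction.homEquiv_unit ..).symm ▸ ?_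
    refine Prod.ext ?_ (Prod.ext ?_ ?_) <;> exact (Category.id_comp _).symm)

section Calculus
variable {A A' A'' B B' B'' C C' D : Prof.{u}}

@[simp] lemma evEl_id {P : A ⟶ B} {a : A} {b : B} (x : El P a b) : evEl (𝟙 P) x = x := rfl

@[simp] lemma evEl_comp {P Q R : A ⟶ B} (φ : P ⟶ Q) (ψ : Q ⟶ R) {a : A} {b : B} (x : El P a b) :
    evEl (φ ≫ ψ) x = evEl ψ (evEl φ x) := rfl

@[simp] lemma evEl_hom_inv {P Q : A ⟶ B} (φ : P ≅ Q) {a : A} {b : B} (x : El Q a b) :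
    evEl φ.hom (evEl φ.inv x) = x := by
  rw [← evEl_comp, φ.inv_hom_id, evEl_id]

@[simp] lemma evEl_inv_hom {P Q : A ⟶ B} (φ : P ≅ Q) {a : A} {b : B} (x : El P a b) :
    evEl φ.inv (evEl φ.hom x) = x := by
  rw [← evEl_comp, φ.hom_inv_id, evEl_id]

@[simp] lemma evEl_whiskerLeft (P : A ⟶ B) {Q Q' : B ⟶ C} (ψ : Q ⟶ Q') {a : A} {c : C} (b : B)
    (x : El P a b) (y : El Q b c) : evEl (P ◁ ψ) (compEl b x y) = compEl b x (evEl ψ y) := rfl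

@[simp] lemma evEl_whiskerRight {P P' : A ⟶ B} (φ : P ⟶ P') (Q : B ⟶ C) {a : A} {c : C} (b : B)
    (x : El P a b) (y : El Q b c) : evEl (φ ▷ Q) (compEl b x y) = compEl b (evEl φ x) y := rfl

@[simp] lemma evEl_associator_hom (P : A ⟶ B) (Q : B ⟶ C) (R : C ⟶ D) {a : A} {b : B} {c : C}
    {d : D} (x : El P a b) (y : El Q b c) (z : El R c d) :
    evEl (Bicategory.associator P Q R).hom (compEl c (compEl b x y) z) = compEl b x (compEl c y z)
        := rfl

@[simp] lemma evEl_associator_inv (P : A ⟶ B) (Q : B ⟶ C) (R : C ⟶ D) {a : A} {b : B} {c : C}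
    {d : D} (x : El P a b) (y : El Q b c) (z : El R c d) :
    evEl (Bicategory.associator P Q R).inv (compEl b x (compEl c y z)) = compEl c (compEl b x y) z
        := rfl

@[simp] lemma evEl_leftUnitor_hom (P : A ⟶ B) {a a' : A} {b : B} (f : a' ⟶ a) (x : El P a' b) :
    evEl (Bicategory.leftUnitor P).hom (compEl (P := 𝟙 A) a' (homEl f) x) = lact P f x := rfl

@[simp] lemma evEl_leftUnitor_inv (P : A ⟶ B) {a : A} {b : B} (x : El P a b) :
    evEl (Bicategory.leftUnitor P).inv x = compEl (P := 𝟙 A) a (homEl (𝟙 a)) x := rfl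

@[simp] lemma evEl_rightUnitor_hom (P : A ⟶ B) {a : A} {b b' : B} (f : b ⟶ b') (x : El P a b') :
    evEl (Bicategory.rightUnitor P).hom (compEl (Q := 𝟙 B) b' x (homEl f)) = ract P f x := rfl

@[simp] lemma evEl_rightUnitor_inv (P : A ⟶ B) {a : A} {b : B} (x : El P a b) :
    evEl (Bicategory.rightUnitor P).inv x = compEl (Q := 𝟙 B) b x (homEl (𝟙 b)) := rfl

@[simp] lemma evEl_tensorHom₂ {P P' : A ⟶ A'} {Q Q' : B ⟶ B'} (φ : P ⟶ P') (ψ : Q ⟶ Q')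
    {a : A} {a' : A'} {b : B} {b' : B'} (x : El P a a') (y : El Q b b') :
    evEl (tensorHom₂ φ ψ) (pairEl x y) = pairEl (evEl φ x) (evEl ψ y) := rfl

@[simp] lemma tensorHom₂Iso_hom {P P' : A ⟶ A'} {Q Q' : B ⟶ B'} (φ : P ≅ P') (ψ : Q ≅ Q') :
    (tensorHom₂Iso φ ψ).hom = tensorHom₂ φ.hom ψ.hom := rfl

@[simp] lemma evEl_tensorComp_hom (P : A ⟶ A') (P' : A' ⟶ A'') (Q : B ⟶ B') (Q' : B' ⟶ B'')
    {a : A} {a' : A'} {a'' : A''} {b : B} {b' : B'} {b'' : B''} (x : El P a a') (y : El Q b b')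
    (x' : El P' a' a'') (y' : El Q' b' b'') :
    evEl (tensorComp P P' Q Q').hom (compEl (a', b') (pairEl x y) (pairEl x' y')) =
      pairEl (compEl a' x x') (compEl b' y y') := rfl

@[simp] lemma evEl_tensorComp_inv (P : A ⟶ A') (P' : A' ⟶ A'') (Q : B ⟶ B') (Q' : B' ⟶ B'')
    {a : A} {a' : A'} {a'' : A''} {b : B} {b' : B'} {b'' : B''} (x : El P a a') (y : El Q b b')
    (x' : El P' a' a'') (y' : El Q' b' b'') :
    evEl (tensorComp P P' Q Q').inv (pairEl (compEl a' x x') (compEl b' y y')) =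
      compEl (a', b') (pairEl x y) (pairEl x' y') := rfl

@[simp] lemma evEl_tensorId_hom {a a' : A} {b b' : B} (f : a' ⟶ a) (g : b' ⟶ b) :
    evEl (tensorId A B).hom (homEl (A := tensorObj A B) (a := (a, b)) (b := (a', b')) (f, g)) =
      pairEl (homEl f) (homEl g) := rfl

@[simp] lemma evEl_tensorId_inv {a a' : A} {b b' : B} (f : a' ⟶ a) (g : b' ⟶ b) :
    evEl (tensorId A B).inv (pairEl (homEl f) (homEl g)) =
      homEl (A := tensorObj A B) (a := (a, b)) (b := (a', b')) (f, g) := rfl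

@[simp] lemma lact_one (P : A ⟶ B) {a : A} {b : B} (x : El P a b) : lact P (𝟙 a) x = x :=
  lact_id P x

@[simp] lemma ract_one (P : A ⟶ B) {a : A} {b : B} (x : El P a b) : ract P (𝟙 b) x = x :=
  ract_id P x

lemma compEl_sound {P : A ⟶ B} {Q : B ⟶ C} {a : A} {c : C} {b b' : B} (f : b ⟶ b')
    (x : El P a b') (y : El Q b c) : compEl b (ract P f x) y = compEl b' x (lact Q f y) :=
  csound f x y

-- Not definitional, unlike the rules above: the value carries restrictions of `x`, `y`, `z` along a
-- transposed identity, which `prodAssociativity_homEquiv_symm` shows to be an identity.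
@[simp] lemma evEl_assocNat_hom (P : A ⟶ A') (Q : B ⟶ B') (R : C ⟶ C') {a : A} {b : B} {c : C}
    {a' : A'} {b' : B'} {c' : C'} (x : El P a a') (y : El Q b b') (z : El R c c') :
    evEl (assocNat P Q R).hom
      (compEl (Q := assocHom A' B' C') ((a', b'), c') (pairEl (pairEl x y) z) (assocEl a' b' c')) =
    compEl (P := assocHom A B C) (a, (b, c)) (assocEl a b c) (pairEl x (pairEl y z)) := by
  have h := prodAssociativity_homEquiv_symm (𝟙 (a', (b', c')) : (a', (b', c')) ⟶ (a', (b', c')))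
  refine (congrArg (fun k : ((a', b'), c') ⟶ ((a', b'), c') => compEl (P := assocHom A B C)
    (Q := P ⊠ₚ (Q ⊠ₚ R)) (a, (b, c)) (assocEl a b c)
    (pairEl (ract P k.1.1 x) (pairEl (ract Q k.1.2 y) (ract R k.2 z)))) h).trans ?_
  simp

/-- The restriction of a 1-cell along the associator functor. -/
def assocRestr {X Y Z : Prof.{u}} (P : tensorObj X (tensorObj Y Z) ⟶ B) :
    tensorObj (tensorObj X Y) Z ⟶ B :=
  prod.associator X Y Z ⋙ P

/-- Composition with the associator 1-cell is restriction along the associator functor. -/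
def assocRestrIso {X Y Z : Prof.{u}} (P : tensorObj X (tensorObj Y Z) ⟶ B) :
    assocHom X Y Z ≫ P ≅ assocRestr P :=
  companionLeftIso (prod.associator X Y Z) P

/-- Used to strip an associator 1-cell from the front of both sides of an equation. -/
lemma evEl_assocRestrIso_hom {X Y Z : Prof.{u}} (P : tensorObj X (tensorObj Y Z) ⟶ B) {x : X}
    {y : Y} {z : Z} {b : B} (p : El P (x, (y, z)) b) :
    evEl (assocRestrIso P).hom (compEl (P := assocHom X Y Z) (x, (y, z)) (assocEl x y z) p) = p :=
  lact_id P p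

end Calculus

/-- The component of an invertible 2-cell. -/
def isoAt {A B : Prof.{u}} {P Q : A ⟶ B} (e : P ≅ Q) (a : A) :
    Functor.obj (C := A) (D := Psh B) P a ≅ Functor.obj (C := A) (D := Psh B) Q a where
  hom := NatTrans.app (C := A) (D := Psh B) e.hom a
  inv := NatTrans.app (C := A) (D := Psh B) e.inv a
  hom_inv_id := congrArg (fun k => NatTrans.app (C := A) (D := Psh B) k a) e.hom_inv_id
  inv_hom_id := congrArg (fun k => NatTrans.app (C := A) (D := Psh B) k a) e.inv_hom_id

/-- A presheaf, as a 1-cell from the unit object. -/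
def ofPsh {A : Prof.{u}} (M : Psh A) : unitObj ⟶ A := (Functor.const _).obj M

/-- A map of presheaves, as a 2-cell. -/
def ofPshMap {A : Prof.{u}} {M N : Psh A} (φ : M ⟶ N) : ofPsh M ⟶ ofPsh N :=
  (Functor.const (unitObj.{u} : Type u)).map φ

/-! ### Convolution of presheaves along a 1-cell. -/

variable {A B : Prof.{u}}

/-- The convolution `x ↦ ∫^(y, z) M y × N z × Q(x; y, z)` of two presheaves along `Q`. -/
def conv (Q : tensorObj A A ⟶ B) (M N : Psh A) : Psh B :=
  Functor.obj (C := tensorObj unitObj unitObj) (D := Psh B) ((ofPsh M ⊠ₚ ofPsh N) ≫ Q) (pt, pt)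

/-- The class of a triple in a convolution. -/
def cv {Q : tensorObj A A ⟶ B} {M N : Psh A} {y z : A} {x : B} (m : M.obj (op y))
    (n : N.obj (op z)) (q : El Q (y, z) x) : (conv Q M N).obj (op x) :=
  cmk (P := ofPsh M ⊠ₚ ofPsh N) (Q := Q) (y, z) (m, n) q

/-- Functoriality of the convolution. -/
def convMap (Q : tensorObj A A ⟶ B) {M M' N N' : Psh A} (φ : M ⟶ M') (ψ : N ⟶ N') :
    conv Q M N ⟶ conv Q M' N' :=
  NatTrans.app (C := tensorObj unitObj unitObj) (D := Psh B)
    (tensorHom₂ (ofPshMap φ) (ofPshMap ψ) ▷ Q) (pt, pt)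

section
variable {Q : tensorObj A A ⟶ B} {M M' M'' N N' N'' : Psh A}

@[elab_as_elim]
lemma cv_ind {x : B} {motive : (conv Q M N).obj (op x) → Prop}
    (h : ∀ (y z : A) (m : M.obj (op y)) (n : N.obj (op z)) (q : El Q (y, z) x),
      motive (cv m n q)) (t) : motive t :=
  cind (P := ofPsh M ⊠ₚ ofPsh N) (Q := Q) (fun b s q => h b.1 b.2 s.1 s.2 q) t

lemma cv_sound {x : B} {y y' z z' : A} (f : y ⟶ y') (g : z ⟶ z') (m : M.obj (op y'))
    (n : N.obj (op z')) (q : El Q (y, z) x) :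
    cv (Q := Q) (M.map f.op m) (N.map g.op n) q = cv m n (lact Q (a := (y, z)) (a' := (y', z'))
        (f, g) q) :=
  csound (P := ofPsh M ⊠ₚ ofPsh N) (Q := Q) (b := (y, z)) (b' := (y', z')) (f, g) (m, n) q

lemma convMap_cv (φ : M ⟶ M') (ψ : N ⟶ N') {x : B} {y z : A} (m : M.obj (op y))
    (n : N.obj (op z)) (q : El Q (y, z) x) :
    (convMap Q φ ψ).app (op x) (cv m n q) = cv (φ.app _ m) (ψ.app _ n) q := rfl

lemma conv_hom_ext {K : Psh B} {φ ψ : conv Q M N ⟶ K}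
    (h : ∀ (x : B) (y z : A) (m : M.obj (op y)) (n : N.obj (op z)) (q : El Q (y, z) x),
      φ.app (op x) (cv m n q) = ψ.app (op x) (cv m n q)) : φ = ψ := by
  ext x t
  induction t using cv_ind (x := x.unop) with | h y z m n q => exact h _ _ _ _ _ _

lemma convMap_id : convMap Q (𝟙 M) (𝟙 N) = 𝟙 (conv Q M N) := conv_hom_ext fun _ _ _ _ _ _ => rfl

lemma convMap_comp (φ : M ⟶ M') (φ' : M' ⟶ M'') (ψ : N ⟶ N') (ψ' : N' ⟶ N'') :
    convMap Q (φ ≫ φ') (ψ ≫ ψ') = convMap Q φ ψ ≫ convMap Q φ' ψ' :=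
  conv_hom_ext fun _ _ _ _ _ _ => rfl

end

/-! ### Associativity of convolution, for an arbitrary outer 1-cell. -/

section Assoc

variable (μ : tensorObj A A ⟶ A) (Q : tensorObj A A ⟶ B)

/-- The structural part of the associativity of convolution before the associativity 2-cell. -/
def convAssocPre {X Y Z : Prof.{u}} (M : X ⟶ A) (N : Y ⟶ A) (K : Z ⟶ A) :
    (((M ⊠ₚ N) ≫ μ) ⊠ₚ K) ≫ Q ≅ ((M ⊠ₚ N) ⊠ₚ K) ≫ (μ ⊠ₚ 𝟙 A) ≫ Q :=
  Bicategory.whiskerRightIso (tensorHom₂Iso (Iso.refl _) (Bicategory.rightUnitor K).symm ≪≫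
    (tensorComp (M ⊠ₚ N) μ K (𝟙 A)).symm) Q ≪≫ Bicategory.associator _ _ _

/-- The structural part of the associativity of convolution after the associativity 2-cell. -/
def convAssocPost {X Y Z : Prof.{u}} (M : X ⟶ A) (N : Y ⟶ A) (K : Z ⟶ A) :
    ((M ⊠ₚ N) ⊠ₚ K) ≫ assocHom A A A ≫ (𝟙 A ⊠ₚ μ) ≫ Q ≅
      assocRestr ((M ⊠ₚ ((N ⊠ₚ K) ≫ μ)) ≫ Q) :=
  (Bicategory.associator _ _ _).symm ≪≫
    Bicategory.whiskerRightIso (assocNat M N K) ((𝟙 A ⊠ₚ μ) ≫ Q) ≪≫ Bicategory.associator _ _ _ ≪≫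
    Bicategory.whiskerLeftIso (assocHom X Y Z) ((Bicategory.associator _ _ _).symm ≪≫
      Bicategory.whiskerRightIso (tensorComp M (𝟙 A) (N ⊠ₚ K) μ ≪≫ tensorHom₂Iso
          (Bicategory.rightUnitor M) (Iso.refl _)) Q) ≪≫
    assocRestrIso ((M ⊠ₚ ((N ⊠ₚ K) ≫ μ)) ≫ Q)

/-- The 2-cell underlying the associativity of convolution. -/
def convAssocCell (θ : (μ ⊠ₚ 𝟙 A) ≫ Q ≅ assocHom A A A ≫ (𝟙 A ⊠ₚ μ) ≫ Q)
    {X Y Z : Prof.{u}} (M : X ⟶ A) (N : Y ⟶ A) (K : Z ⟶ A) :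
    (((M ⊠ₚ N) ≫ μ) ⊠ₚ K) ≫ Q ≅ assocRestr ((M ⊠ₚ ((N ⊠ₚ K) ≫ μ)) ≫ Q) :=
  convAssocPre μ Q M N K ≪≫ Bicategory.whiskerLeftIso ((M ⊠ₚ N) ⊠ₚ K) θ ≪≫ convAssocPost μ Q M N K

/-- Associativity of convolution. -/
def convAssoc (θ : (μ ⊠ₚ 𝟙 A) ≫ Q ≅ assocHom A A A ≫ (𝟙 A ⊠ₚ μ) ≫ Q) (M N K : Psh A) :
    conv Q (conv μ M N) K ≅ conv Q M (conv μ N K) :=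
  isoAt (convAssocCell μ Q θ (ofPsh M) (ofPsh N) (ofPsh K)) ((pt, pt), pt)

variable {μ Q}

/-- The value of an associativity 2-cell on a pair of elements. -/
def AssocRel (θ : (μ ⊠ₚ 𝟙 A) ≫ Q ≅ assocHom A A A ≫ (𝟙 A ⊠ₚ μ) ≫ Q)
    {b c d x y x' y' : A} {a : B} (m : El μ (b, c) x) (h : y ⟶ d) (n : El Q (x, y) a)
    (h' : x' ⟶ b) (m' : El μ (c, d) y') (n' : El Q (x', y') a) : Prop :=
  evEl θ.hom (compEl (x, y) (pairEl m (homEl h)) n) =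
      compEl (P := assocHom A A A) (Q := (𝟙 A ⊠ₚ μ) ≫ Q) (b, (c, d)) (assocEl _ _ _)
        (compEl (P := 𝟙 A ⊠ₚ μ) (Q := Q) (x', y') (pairEl (homEl h') m') n')

variable {θ : (μ ⊠ₚ 𝟙 A) ≫ Q ≅ assocHom A A A ≫ (𝟙 A ⊠ₚ μ) ≫ Q}

/-- The coend relation for `h` in the last variable: `h` acting on the third presheaf may be carried
by the identity factor of `μ ⊠ₚ 𝟙 A` instead. -/
lemma compEl_triple_sound {X Y Z : Prof.{u}} {M : X ⟶ A} {N : Y ⟶ A} {K : Z ⟶ A} {x₀ : X} {y₀ : Y}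
    {z₀ : Z} {b c d x y : A} {a : B} (p : El μ (b, c) x)
    (h : y ⟶ d) (q : El Q (x, y) a) (m : El M x₀ b) (n : El N y₀ c) (k : El K z₀ d) :
    compEl (P := (M ⊠ₚ N) ⊠ₚ K) (Q := (μ ⊠ₚ 𝟙 A) ≫ Q) ((b, c), y) (pairEl (pairEl m n) (ract K h k))
        (compEl (P := μ ⊠ₚ 𝟙 A) (Q := Q) (a := ((b, c), y)) (x, y) (pairEl p (homEl (𝟙 y))) q) =
      compEl (P := (M ⊠ₚ N) ⊠ₚ K) (Q := (μ ⊠ₚ 𝟙 A) ≫ Q) ((b, c), d) (pairEl (pairEl m n) k)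
        (compEl (P := μ ⊠ₚ 𝟙 A) (Q := Q) (x, y) (pairEl p (homEl h)) q) := by
  have h₁ := compEl_sound (P := (M ⊠ₚ N) ⊠ₚ K) (Q := (μ ⊠ₚ 𝟙 A) ≫ Q)
    (b := ((b, c), y)) (b' := ((b, c), d)) ((𝟙 b, 𝟙 c), h) (pairEl (pairEl m n) k)
    (compEl (P := μ ⊠ₚ 𝟙 A) (Q := Q) (x, y) (pairEl p (homEl (𝟙 y))) q)
  have h₂ : ract ((M ⊠ₚ N) ⊠ₚ K) (b' := ((b, c), y)) (b := ((b, c), d)) ((𝟙 b, 𝟙 c), h)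
      (pairEl (pairEl m n) k) = pairEl (pairEl m n) (ract K h k) :=
    congrArg (fun t => pairEl t (ract K h k))
      (congrArg₂ (fun s t => pairEl s t) (ract_id M m) (ract_id N n))
  have h₃ : lact (μ ⊠ₚ 𝟙 A) (a := ((b, c), y)) (a' := ((b, c), d)) (b := (x, y))
      ((𝟙 b, 𝟙 c), h) (pairEl p (homEl (𝟙 y))) = pairEl p (homEl h) :=
    congrArg₂ (fun s t => pairEl s t) (lact_id μ p) (Category.id_comp h)
  rw [h₂] at h₁
  exact h₁.trans (congrArg (fun t => compEl (P := (M ⊠ₚ N) ⊠ₚ K) (Q := (μ ⊠ₚ 𝟙 A) ≫ Q) ((b, c), d)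
    (pairEl (pairEl m n) k) (compEl (P := μ ⊠ₚ 𝟙 A) (Q := Q) (x, y) t q)) h₃)

lemma evEl_convAssocCell_hom {X Y Z : Prof.{u}} {M : X ⟶ A} {N : Y ⟶ A} {K : Z ⟶ A} {x₀ : X}
    {y₀ : Y} {z₀ : Z} {b c d x y x' y' : A} {a : B} {p : El μ (b, c) x}
    {h : y ⟶ d} {q : El Q (x, y) a} {h' : x' ⟶ b} {p' : El μ (c, d) y'} {q' : El Q (x', y') a}
    (H : AssocRel θ p h q h' p' q') (m : El M x₀ b) (n : El N y₀ c) (k : El K z₀ d) :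
    evEl (convAssocCell μ Q θ M N K).hom
      (compEl (x, y) (pairEl (compEl (b, c) (pairEl m n) p) (ract K h k)) q) =
    compEl (P := M ⊠ₚ ((N ⊠ₚ K) ≫ μ)) (Q := Q) (x', y')
      (pairEl (ract M h' m) (compEl (c, d) (pairEl n k) p')) q' := by
  simp only [convAssocCell, convAssocPre, Iso.trans_hom, Iso.symm_hom,
      Bicategory.whiskerRightIso_hom,
    Bicategory.whiskerLeftIso_hom, evEl_comp, evEl_whiskerRight, tensorHom₂Iso_hom,
    evEl_tensorHom₂, Iso.refl_hom, evEl_id, evEl_rightUnitor_inv, evEl_tensorComp_inv,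
    evEl_associator_hom]
  -- The right unitor has inserted an identity beside `p`; sliding `h` onto it produces exactly the
  -- element whose image under `θ` is given by `H`.
  rw [compEl_triple_sound, evEl_whiskerLeft, H]
  simp only [convAssocPost, Iso.trans_hom, Iso.symm_hom, Bicategory.whiskerRightIso_hom,
    Bicategory.whiskerLeftIso_hom, evEl_comp, evEl_whiskerRight, evEl_associator_inv]
  rw [evEl_assocNat_hom]
  simp only [evEl_comp, evEl_whiskerRight, evEl_whiskerLeft, tensorHom₂Iso_hom,
    evEl_associator_hom, evEl_associator_inv]
  rw [evEl_tensorComp_hom, evEl_tensorHom₂, evEl_rightUnitor_hom, evEl_assocRestrIso_hom]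
  rfl

lemma convAssoc_hom_cv {M N K : Psh A} {b c d x y x' y' : A} {a : B} {p : El μ (b, c) x}
    {h : y ⟶ d} {q : El Q (x, y) a} {h' : x' ⟶ b} {p' : El μ (c, d) y'} {q' : El Q (x', y') a}
    (H : AssocRel θ p h q h' p' q')
    (m : M.obj (op b)) (n : N.obj (op c)) (k : K.obj (op d)) :
    (convAssoc μ Q θ M N K).hom.app (op a) (cv (cv m n p) (K.map h.op k) q) =
      cv (M.map h'.op m) (cv n k p') q' :=
  evEl_convAssocCell_hom (M := ofPsh M) (N := ofPsh N) (K := ofPsh K) (x₀ := pt) (y₀ := pt)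
    (z₀ := pt) H m n k

end Assoc
end Prof

/-! ### Normal forms for the associativity 2-cell, and naturality. -/

namespace Prof

open Bicategory

section
variable {A B : Prof.{u}} {μ : tensorObj A A ⟶ A} {Q : tensorObj A A ⟶ B}

/-- Every class in the target has such a representative: the associator component and the
hom-component are absorbed into the remaining factors by the coend relation. -/
lemma exists_assocRel (θ : (μ ⊠ₚ 𝟙 A) ≫ Q ≅ assocHom A A A ≫ (𝟙 A ⊠ₚ μ) ≫ Q) {b c d x : A} {a : B}
    (m : El μ (b, c) x) (n : El Q (x, d) a) :
    ∃ (y' : A) (m' : El μ (c, d) y') (n' : El Q (b, y') a),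
      AssocRel θ m (𝟙 d) n (𝟙 b) m' n' := by
  unfold AssocRel
  generalize evEl θ.hom (compEl (x, d) (pairEl m (homEl (𝟙 d))) n) = t
  induction t using cind with
  | h w f s =>
    -- The companion component `f` acts on `s`, leaving the identity of `(b, (c, d))`.
    have hs : ∃ s' : El ((𝟙 A ⊠ₚ μ) ≫ Q) (b, (c, d)) a, cmk w f s =
        compEl (P := assocHom A A A) (Q := (𝟙 A ⊠ₚ μ) ≫ Q) (b, (c, d)) (assocEl b c d) s' := by
      refine ⟨lact ((𝟙 A ⊠ₚ μ) ≫ Q) (a := w) (a' := (b, (c, d))) f s, ?_⟩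
      rw [← compEl_sound (P := assocHom A A A) (b := w) (b' := (b, (c, d))) f (assocEl b c d) s]
      refine congrArg (fun k => compEl (P := assocHom A A A) (Q := (𝟙 A ⊠ₚ μ) ≫ Q) w k s) ?_
      exact (Category.comp_id (X := w) (Y := (b, (c, d))) f).symm
    obtain ⟨s', hs⟩ := hs
    rw [hs]
    induction s' using cind with
    | h v g r =>
      obtain ⟨h', m'⟩ := g
      -- The hom-component `h'` is pushed into the outer factor, leaving `𝟙 b`.
      refine ⟨v.2, m', lact Q (a := v) (a' := (b, v.2)) (h', 𝟙 v.2) r, ?_⟩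
      rw [← compEl_sound (P := 𝟙 A ⊠ₚ μ) (b := v) (b' := (b, v.2)) (h', 𝟙 v.2)
        (pairEl (homEl (𝟙 b)) m') r]
      refine congrArg (fun k => compEl (P := assocHom A A A) (Q := (𝟙 A ⊠ₚ μ) ≫ Q) (b, (c, d))
        (assocEl b c d) (compEl (P := 𝟙 A ⊠ₚ μ) v k r)) ?_
      exact Prod.ext (Category.comp_id (X := v.1) (Y := b) h').symm (ract_id μ m').symm

lemma convAssoc_hom_cv_one {θ : (μ ⊠ₚ 𝟙 A) ≫ Q ≅ assocHom A A A ≫ (𝟙 A ⊠ₚ μ) ≫ Q}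
    {M N K : Psh A} {b c d x y' : A} {a : B} {p : El μ (b, c) x} {q : El Q (x, d) a}
    {p' : El μ (c, d) y'} {q' : El Q (b, y') a} (H : AssocRel θ p (𝟙 d) q (𝟙 b) p' q')
    (m : M.obj (op b)) (n : N.obj (op c)) (k : K.obj (op d)) :
    (convAssoc μ Q θ M N K).hom.app (op a) (cv (cv m n p) k q) = cv m (cv n k p') q' := by
  simpa using convAssoc_hom_cv H m n k

lemma conv_hom_ext₃ {M N K : Psh A} {L : Psh B} {φ ψ : conv Q (conv μ M N) K ⟶ L}
    (h : ∀ {b c d x : A} {a : B} (m : M.obj (op b)) (n : N.obj (op c)) (k : K.obj (op d))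
      (p : El μ (b, c) x) (q : El Q (x, d) a),
      φ.app (op a) (cv (cv m n p) k q) = ψ.app (op a) (cv (cv m n p) k q)) : φ = ψ :=
  conv_hom_ext fun a x d t k q => by
    induction t using cv_ind with | h b c m n p => exact h m n k p q

/-- On generators the associator changes only the pair `(p, q)`, by a rule independent of the
presheaves, whereas natural maps change only the presheaf elements. -/
lemma convAssoc_naturality (θ : (μ ⊠ₚ 𝟙 A) ≫ Q ≅ assocHom A A A ≫ (𝟙 A ⊠ₚ μ) ≫ Q)
    {M M' N N' K K' : Psh A} (φ : M ⟶ M') (ψ : N ⟶ N') (χ : K ⟶ K') :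
    convMap Q (convMap μ φ ψ) χ ≫ (convAssoc μ Q θ M' N' K').hom =
      (convAssoc μ Q θ M N K).hom ≫ convMap Q φ (convMap μ ψ χ) :=
  conv_hom_ext₃ fun {b c d x a} m n k p q => by
    obtain ⟨y', p', q', H⟩ := exists_assocRel θ p q
    refine (convAssoc_hom_cv_one H (φ.app _ m) (ψ.app _ n) (χ.app _ k)).trans ?_
    exact (congrArg ((convMap Q φ (convMap μ ψ χ)).app (op a))
      (convAssoc_hom_cv_one H m n k)).symm

end

/-! ### Unit laws of convolution. -/

section Unit

variable {A : Prof.{u}}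

lemma unit_hom_eq {x y : (unitObj.{u} : Type u)} (f g : x ⟶ y) : f = g := Subsingleton.elim _ _

/-- The morphism between two objects of the unit category. -/
def unitHom (x y : (unitObj.{u} : Type u)) : x ⟶ y := eqToHom (Subsingleton.elim _ _)

/-- The inclusion `a ↦ (⋆, a)` is left adjoint to the projection. -/
def sectRAdj (A : Prof.{u}) : CategoryTheory.Prod.sectR pt.{u} (A : Type u) ⊣
    CategoryTheory.Prod.snd (Discrete PUnit.{u + 1}) (A : Type u) :=
  Adjunction.mkOfHomEquiv
    { homEquiv := fun _ _ =>
        { toFun := fun f => f.2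
          invFun := fun g => (unitHom _ _, g)
          left_inv := fun _ => Prod.ext (unit_hom_eq _ _) rfl
          right_inv := fun _ => rfl }
      homEquiv_naturality_left_symm := fun _ _ => Prod.ext (unit_hom_eq _ _) rfl
      homEquiv_naturality_right := fun _ _ => rfl }

/-- The inclusion `a ↦ (a, ⋆)` is left adjoint to the projection. -/
def sectLAdj (A : Prof.{u}) : CategoryTheory.Prod.sectL (A : Type u) pt.{u} ⊣
    CategoryTheory.Prod.fst (A : Type u) (Discrete PUnit.{u + 1}) :=
  Adjunction.mkOfHomEquiv
    { homEquiv := fun _ _ =>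
        { toFun := fun f => f.1
          invFun := fun g => (g, unitHom _ _)
          left_inv := fun _ => Prod.ext rfl (unit_hom_eq _ _)
          right_inv := fun _ => rfl }
      homEquiv_naturality_left_symm := fun _ _ => Prod.ext rfl (unit_hom_eq _ _)
      homEquiv_naturality_right := fun _ _ => rfl }

/-- The 1-cell `(⋆, ⋆) ↦ M ⋆`. -/
def unitRestr (M : unitObj ⟶ A) : tensorObj unitObj unitObj ⟶ A :=
  CategoryTheory.Prod.snd (Discrete PUnit.{u + 1}) (Discrete PUnit.{u + 1}) ⋙ M

/-- Naturality of the left unitor 1-cell, for 1-cells out of the unit object. -/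
def leftUnitRestrIso (M : unitObj ⟶ A) :
    (𝟙 unitObj ⊠ₚ M) ≫ leftUnitHom A ≅ unitRestr M :=
  companionRightIso (tensor Profunctor.id M) (sectRAdj A) ≪≫
    isoMk (Q := unitRestr M) (homMk (fun _ _ t => t.2) (fun _ _ _ => rfl) (fun _ _ => rfl))
      (fun _ _ t => (unitHom _ _, t)) (fun _ _ _ => Prod.ext (unit_hom_eq _ _) rfl)
      (fun _ _ _ => rfl)

/-- Naturality of the right unitor 1-cell, for 1-cells out of the unit object. -/
def rightUnitRestrIso (M : unitObj ⟶ A) :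
    (M ⊠ₚ 𝟙 unitObj) ≫ rightUnitHom A ≅ unitRestr M :=
  companionRightIso (tensor M Profunctor.id) (sectLAdj A) ≪≫
    isoMk (Q := unitRestr M) (homMk (fun _ _ t => lact M (unitHom _ _) t.1)
        (fun {_ _} f {_} x => by
          change lact M _ (lact M f.1 x.1) = lact M f.2 (lact M _ x.1)
          rw [← lact_comp, ← lact_comp]
          exact congrArg (fun k => lact M k x.1) (unit_hom_eq _ _))
        (fun _ _ => lact_ract M _ _ _))
      (fun _ _ t => (lact M (unitHom _ _) t, unitHom _ _))
      (fun _ _ t => Prod.ext ((lact_comp M _ _ _).symm.trans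
        ((congrArg (fun k => lact M k t.1) (unit_hom_eq _ _)).trans (lact_id M t.1)))
          (unit_hom_eq _ _))
      (fun _ _ t => (lact_comp M _ _ _).symm.trans
        ((congrArg (fun k => lact M k t) (unit_hom_eq _ _)).trans (lact_id M t)))

lemma evEl_leftUnitRestrIso (M : unitObj ⟶ A) {y a : A} (m : El M pt y)
    (t : El (leftUnitHom A) (pt, y) a) :
    evEl (leftUnitRestrIso M).hom (compEl (a := (pt, pt)) (pt, y) (pairEl (homEl (𝟙 pt)) m) t) =
      ract M (leftUnitElHom t) m :=
  congrArg (fun k => ract M k m) (Category.comp_id (leftUnitElHom t))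

lemma evEl_rightUnitRestrIso (M : unitObj ⟶ A) {y a : A} (m : El M pt y)
    (t : El (rightUnitHom A) (y, pt) a) :
    evEl (rightUnitRestrIso M).hom (compEl (a := (pt, pt)) (y, pt) (pairEl m (homEl (𝟙 pt))) t) =
      ract M (rightUnitElHom t) m :=
  (congrArg₂ (fun k l => lact M k (ract M l m)) (unit_hom_eq (unitHom pt pt) (𝟙 pt))
    (Category.comp_id (rightUnitElHom t))).trans (lact_id M _)

variable {μ : tensorObj A A ⟶ A} {η : unitObj ⟶ A}

/-- The unit 1-cell, as a presheaf. -/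
def unitPsh (η : unitObj ⟶ A) : Psh A := Functor.obj (C := unitObj) (D := Psh A) η pt

/-- The 2-cell underlying the left unit law of convolution. -/
def convLeftUnitCell (l : (η ⊠ₚ 𝟙 A) ≫ μ ≅ leftUnitHom A) (M : unitObj ⟶ A) :
    (η ⊠ₚ M) ≫ μ ≅ unitRestr M :=
  Bicategory.whiskerRightIso (tensorHom₂Iso (Bicategory.leftUnitor η).symm
      (Bicategory.rightUnitor M).symm ≪≫ (tensorComp (𝟙 _) η M (𝟙 A)).symm) μ ≪≫
    Bicategory.associator _ _ _ ≪≫ Bicategory.whiskerLeftIso (𝟙 unitObj ⊠ₚ M) l ≪≫ leftUnitRestrIso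
        M

/-- The 2-cell underlying the right unit law of convolution. -/
def convRightUnitCell (r : (𝟙 A ⊠ₚ η) ≫ μ ≅ rightUnitHom A) (M : unitObj ⟶ A) :
    (M ⊠ₚ η) ≫ μ ≅ unitRestr M :=
  Bicategory.whiskerRightIso (tensorHom₂Iso (Bicategory.rightUnitor M).symm
      (Bicategory.leftUnitor η).symm ≪≫ (tensorComp M (𝟙 A) (𝟙 _) η).symm) μ ≪≫
    Bicategory.associator _ _ _ ≪≫ Bicategory.whiskerLeftIso (M ⊠ₚ 𝟙 unitObj) r ≪≫
        rightUnitRestrIso M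

/-- The left unit law of convolution. -/
def convLeftUnit (l : (η ⊠ₚ 𝟙 A) ≫ μ ≅ leftUnitHom A) (M : Psh A) : conv μ (unitPsh η) M ≅ M :=
  isoAt (convLeftUnitCell l (ofPsh M)) (pt, pt)

/-- The right unit law of convolution. -/
def convRightUnit (r : (𝟙 A ⊠ₚ η) ≫ μ ≅ rightUnitHom A) (M : Psh A) : conv μ M (unitPsh η) ≅ M :=
  isoAt (convRightUnitCell r (ofPsh M)) (pt, pt)

/-- An element of the unit presheaf. -/
def unitEl {x : A} (e : El η pt x) : (unitPsh η).obj (op x) := e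

lemma evEl_convLeftUnitCell (l : (η ⊠ₚ 𝟙 A) ≫ μ ≅ leftUnitHom A) (M : unitObj ⟶ A) {x y a : A}
    (e : El η pt x) (m : El M pt y) (p : El μ (x, y) a) :
    evEl (convLeftUnitCell l M).hom (compEl (x, y) (pairEl e m) p) =
      ract M (leftUnitElHom (evEl l.hom (compEl (x, y) (pairEl e (homEl (𝟙 y))) p))) m := by
  simp only [convLeftUnitCell, Iso.trans_hom, Iso.symm_hom, Bicategory.whiskerRightIso_hom,
    Bicategory.whiskerLeftIso_hom, evEl_comp, evEl_whiskerRight, tensorHom₂Iso_hom, evEl_tensorHom₂,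
    evEl_leftUnitor_inv, evEl_rightUnitor_inv]
  rw [evEl_tensorComp_inv, evEl_associator_hom, evEl_whiskerLeft, evEl_leftUnitRestrIso]

lemma evEl_convRightUnitCell (r : (𝟙 A ⊠ₚ η) ≫ μ ≅ rightUnitHom A) (M : unitObj ⟶ A) {x y a : A}
    (e : El η pt y) (m : El M pt x) (p : El μ (x, y) a) :
    evEl (convRightUnitCell r M).hom (compEl (x, y) (pairEl m e) p) =
      ract M (rightUnitElHom (evEl r.hom (compEl (x, y) (pairEl (homEl (𝟙 x)) e) p))) m := by
  simp only [convRightUnitCell, Iso.trans_hom, Iso.symm_hom, Bicategory.whiskerRightIso_hom,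
    Bicategory.whiskerLeftIso_hom, evEl_comp, evEl_whiskerRight, tensorHom₂Iso_hom, evEl_tensorHom₂,
    evEl_leftUnitor_inv, evEl_rightUnitor_inv]
  rw [evEl_tensorComp_inv, evEl_associator_hom, evEl_whiskerLeft, evEl_rightUnitRestrIso]

lemma convLeftUnit_hom_cv (l : (η ⊠ₚ 𝟙 A) ≫ μ ≅ leftUnitHom A) {M : Psh A} {x y a : A}
    (e : El η pt x) (m : M.obj (op y)) (p : El μ (x, y) a) :
    (convLeftUnit l M).hom.app (op a) (cv (unitEl e) m p) =
      M.map (leftUnitElHom (evEl l.hom (compEl (x, y) (pairEl e (homEl (𝟙 y))) p))).op m :=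
  evEl_convLeftUnitCell l (ofPsh M) e m p

lemma convRightUnit_hom_cv (r : (𝟙 A ⊠ₚ η) ≫ μ ≅ rightUnitHom A) {M : Psh A} {x y a : A}
    (e : El η pt y) (m : M.obj (op x)) (p : El μ (x, y) a) :
    (convRightUnit r M).hom.app (op a) (cv m (unitEl e) p) =
      M.map (rightUnitElHom (evEl r.hom (compEl (x, y) (pairEl (homEl (𝟙 x)) e) p))).op m :=
  evEl_convRightUnitCell r (ofPsh M) e m p

end Unit
end Prof

/-! ### The pentagon and triangle axioms on elements. -/

namespace Prof

open Bicategory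

section
variable {A A' A'' B B' B'' C D : Prof.{u}}

lemma evEl_compTensorId_hom (P : A ⟶ A') (P' : A' ⟶ A'') {a : A} {a' : A'} {a'' : A''} {b b' : B}
    (x : El P a a') (x' : El P' a' a'') (f : b' ⟶ b) :
    evEl (compTensorId P P' B).hom (pairEl (compEl a' x x') (homEl f)) =
      compEl (a', b) (pairEl x (homEl (𝟙 b))) (pairEl x' (homEl f)) := rfl

lemma evEl_compTensorId_inv (P : A ⟶ A') (P' : A' ⟶ A'') {a : A} {a' : A'} {a'' : A''}
    {b b' : B} (x : El P a a') (x' : El P' a' a'') (f : b' ⟶ b) :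
    evEl (compTensorId P P' B).inv (compEl (a', b') (pairEl x (homEl f))
        (pairEl x' (homEl (𝟙 b')))) =
      pairEl (compEl a' x x') (homEl f) :=
  congrArg (fun k => pairEl (Q := 𝟙 B) (compEl a' x x') (homEl k)) (Category.id_comp f)

lemma evEl_idTensorComp_hom (Q : B ⟶ B') (Q' : B' ⟶ B'') {b : B} {b' : B'} {b'' : B''} {a a' : A}
    (x : El Q b b') (x' : El Q' b' b'') (f : a' ⟶ a) :
    evEl (idTensorComp A Q Q').hom (pairEl (homEl f) (compEl b' x x')) =
      compEl (a, b') (pairEl (homEl (𝟙 a)) x) (pairEl (homEl f) x') := rfl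

lemma evEl_idTensorComp_inv (Q : B ⟶ B') (Q' : B' ⟶ B'') {b : B} {b' : B'} {b'' : B''}
    {a a' : A} (x : El Q b b') (x' : El Q' b' b'') (f : a' ⟶ a) :
    evEl (idTensorComp A Q Q').inv
      (compEl (a', b') (pairEl (homEl f) x) (pairEl (homEl (𝟙 a')) x')) =
      pairEl (homEl f) (compEl b' x x') :=
  congrArg (fun k => pairEl (P := 𝟙 A) (homEl k) (compEl b' x x')) (Category.id_comp f)

lemma evEl_interchange_hom (P : A ⟶ A') (Q : B ⟶ B') {a : A} {a' a'' : A'} {b b₁ : B} {b' : B'}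
    (x : El P a a') (f : b₁ ⟶ b) (g : a'' ⟶ a') (y : El Q b₁ b') :
    evEl (interchange P Q).hom (compEl (a', b₁) (pairEl x (homEl f)) (pairEl (homEl g) y)) =
      compEl (a, b') (pairEl (homEl (𝟙 a)) (lact Q f y)) (pairEl (ract P g x) (homEl (𝟙 b'))) := rfl

lemma lact_one_pair (P : tensorObj A B ⟶ C) {a : A} {b : B} {c : C} (x : El P (a, b) c) :
    lact P (a := (a, b)) (a' := (a, b)) (𝟙 a, 𝟙 b) x = x := lact_id P x

lemma evEl_tensorId_hom_one (a : A) (b : B) :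
    evEl (tensorId A B).hom (homEl (A := tensorObj A B) (𝟙 (a, b))) =
      pairEl (homEl (𝟙 a)) (homEl (𝟙 b)) := rfl

/-- All 1-cells involved are companions of rebracketing functors, so every component is a composite
of identities. -/
lemma evEl_pentagonator_hom (a : A) (b : B) (c : C) (d : D) :
    evEl (pentagonator A B C D).hom
      (compEl (P := assocHom A B C ⊠ₚ 𝟙 D) ((a, (b, c)), d) (pairEl (assocEl a b c) (homEl (𝟙 d)))
        (compEl (P := assocHom A (tensorObj B C) D) (a, ((b, c), d))
          (assocEl (B := tensorObj B C) a (b, c) d)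
          (pairEl (homEl (𝟙 a)) (assocEl b c d)))) =
    compEl (P := assocHom (tensorObj A B) C D) ((a, b), (c, d))
      (assocEl (A := tensorObj A B) (a, b) c d) (assocEl (C := tensorObj C D) a b (c, d)) := by
  -- The pentagonator ends with the inverse of `pentagonRight`. With the other side written as a
  -- value of that inverse, the claim becomes an equality in a single companion, that is, of
  -- morphisms in a fourfold product.
  rw [← evEl_inv_hom (pentagonRight A B C D) (compEl _ _ _)]
  refine congrArg (evEl (pentagonRight A B C D).inv) ?_
  refine Prod.ext ?_ (Prod.ext ?_ (Prod.ext ?_ ?_))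
  · change (((𝟙 a ≫ 𝟙 a) ≫ 𝟙 a)) ≫ 𝟙 a = 𝟙 a ≫ 𝟙 a
    simp
  · change (((𝟙 b ≫ 𝟙 b) ≫ 𝟙 b)) ≫ 𝟙 b = 𝟙 b ≫ 𝟙 b
    simp
  · change (((𝟙 c ≫ 𝟙 c) ≫ 𝟙 c)) ≫ 𝟙 c = 𝟙 c ≫ 𝟙 c
    simp
  · change (((𝟙 d ≫ 𝟙 d) ≫ 𝟙 d)) ≫ 𝟙 d = 𝟙 d ≫ 𝟙 d
    simp

lemma evEl_triangulator_hom (a : A) (b b' : B) (t : El (leftUnitHom B) (pt, b) b') :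
    evEl (triangulator A B).hom
      (compEl (P := assocHom A unitObj B) (a, (pt, b)) (assocEl (B := unitObj) a pt b)
        (pairEl (homEl (𝟙 a)) t)) =
    pairEl (companionEl (A := tensorObj A unitObj)
      (CategoryTheory.Prod.fst A (Discrete PUnit.{u + 1})) (a := (a, pt)) (𝟙 a))
        (homEl (leftUnitElHom t)) := by
  refine Prod.ext ?_ ?_
  · change (𝟙 a ≫ 𝟙 a) ≫ 𝟙 a = 𝟙 a
    simp
  · change (leftUnitElHom t ≫ 𝟙 b) ≫ 𝟙 b = leftUnitElHom t
    simp

end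

section
variable {A : Prof.{u}} {μ : tensorObj A A ⟶ A} {η : unitObj ⟶ A}
  {θ : (μ ⊠ₚ 𝟙 A) ≫ μ ≅ assocHom A A A ≫ (𝟙 A ⊠ₚ μ) ≫ μ}

/-- The three relations are the three uses of associativity on this leg, in order. Their identity
components are what lets the inverses of `compTensorId` and `idTensorComp` be evaluated. -/
lemma evEl_pentagonTop {b c d e x y a x₁ y₂ y₃ : A} {p : El μ (b, c) x} {q : El μ (x, d) y}
    {r : El μ (y, e) a} {p₁ : El μ (c, d) x₁} {q₁ : El μ (b, x₁) y} {q₂ : El μ (x₁, e) y₂}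
    {r₂ : El μ (b, y₂) a} {p₃ : El μ (d, e) y₃} {q₃ : El μ (c, y₃) y₂}
    (H₁ : AssocRel θ p (𝟙 d) q (𝟙 b) p₁ q₁) (H₂ : AssocRel θ q₁ (𝟙 e) r (𝟙 b) q₂ r₂)
    (H₃ : AssocRel θ p₁ (𝟙 e) q₂ (𝟙 c) p₃ q₃) :
    evEl (pentagonTop μ θ) (compEl (a := (((b, c), d), e)) ((x, d), e)
      (pairEl (pairEl p (homEl (𝟙 d))) (homEl (𝟙 e)))
      (compEl (y, e) (pairEl q (homEl (𝟙 e))) r)) =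
    compEl (P := assocHom (tensorObj A A) A A ≫ assocHom A A (tensorObj A A)) (b, (c, (d, e)))
      (compEl (P := assocHom (tensorObj A A) A A) ((b, c), (d, e))
      (assocEl (A := tensorObj A A) (b, c) d e) (assocEl (C := tensorObj A A) b c (d, e)))
      (compEl (b, (c, y₃)) (pairEl (homEl (𝟙 b)) (pairEl (homEl (𝟙 c)) p₃))
        (compEl (b, y₂) (pairEl (homEl (𝟙 b)) q₃) r₂)) := by
  simp only [pentagonTop, bicategoricalComp, BicategoricalCoherence.iso, Iso.trans_hom,
    Iso.refl_hom, Bicategory.whiskerRightIso_hom, Bicategory.whiskerLeftIso_hom, evEl_comp,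
        Iso.symm_hom,
    Bicategory.id_whiskerRight, Category.id_comp, evEl_id]
  -- The element is carried through the composite one 2-cell at a time.
  repeat first
    | rw [evEl_whiskerLeft] | rw [evEl_whiskerRight] | rw [evEl_associator_hom]
    | rw [evEl_associator_inv] | rw [evEl_comp] | rw [evEl_id] | rw [evEl_tensorHom₂]
    | rw [evEl_assocNat_hom] | rw [H₁] | rw [H₂] | rw [H₃] | rw [evEl_compTensorId_hom]
    | rw [evEl_compTensorId_inv] | rw [evEl_idTensorComp_hom] | rw [evEl_idTensorComp_inv]
    | rw [evEl_pentagonator_hom]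

/-- The two relations are the two uses of associativity on this leg; the interchange between them
acts on identity components only. -/
lemma evEl_pentagonBottom {b c d e x y a x₄ x₅ : A} {p : El μ (b, c) x} {q : El μ (x, d) y}
    {r : El μ (y, e) a} {q₄ : El μ (d, e) x₄} {r₄ : El μ (x, x₄) a} {p₅ : El μ (c, x₄) x₅}
    {r₅ : El μ (b, x₅) a}
    (H₄ : AssocRel θ q (𝟙 e) r (𝟙 x) q₄ r₄) (H₅ : AssocRel θ p (𝟙 x₄) r₄ (𝟙 b) p₅ r₅) :
    evEl (pentagonBottom μ θ) (compEl (a := (((b, c), d), e)) ((x, d), e)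
      (pairEl (pairEl p (homEl (𝟙 d))) (homEl (𝟙 e)))
      (compEl (y, e) (pairEl q (homEl (𝟙 e))) r)) =
    compEl (P := assocHom (tensorObj A A) A A ≫ assocHom A A (tensorObj A A)) (b, (c, (d, e)))
      (compEl (P := assocHom (tensorObj A A) A A) ((b, c), (d, e))
      (assocEl (A := tensorObj A A) (b, c) d e) (assocEl (C := tensorObj A A) b c (d, e)))
      (compEl (b, (c, x₄)) (pairEl (homEl (𝟙 b)) (pairEl (homEl (𝟙 c)) q₄))
        (compEl (b, x₅) (pairEl (homEl (𝟙 b)) p₅) r₅)) := by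
  simp only [pentagonBottom, bicategoricalComp, BicategoricalCoherence.iso, Iso.trans_hom,
    Iso.refl_hom, Bicategory.whiskerRightIso_hom, Bicategory.whiskerLeftIso_hom, evEl_comp,
        Iso.symm_hom,
    Bicategory.id_whiskerRight, Category.id_comp, evEl_id]
  repeat first
    | rw [evEl_whiskerLeft] | rw [evEl_whiskerRight] | rw [evEl_associator_hom]
    | rw [evEl_associator_inv] | rw [evEl_comp] | rw [evEl_id] | rw [evEl_tensorHom₂]
    | rw [evEl_assocNat_hom] | rw [H₄] | rw [evEl_tensorId_hom] | rw [evEl_tensorId_inv]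
    | rw [evEl_interchange_hom] | rw [evEl_tensorId_hom_one] | rw [lact_one_pair]
    | rw [ract_one] | rw [H₅]

/-- The pentagon law on elements. -/
lemma pentagon_rel (hθ : pentagonTop μ θ = pentagonBottom μ θ) {b c d e x y a x₁ y₂ y₃ x₄ x₅ : A}
    {p : El μ (b, c) x} {q : El μ (x, d) y}
    {r : El μ (y, e) a} {p₁ : El μ (c, d) x₁} {q₁ : El μ (b, x₁) y} {q₂ : El μ (x₁, e) y₂}
    {r₂ : El μ (b, y₂) a} {p₃ : El μ (d, e) y₃} {q₃ : El μ (c, y₃) y₂}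
    {q₄ : El μ (d, e) x₄} {r₄ : El μ (x, x₄) a} {p₅ : El μ (c, x₄) x₅} {r₅ : El μ (b, x₅) a}
    (H₁ : AssocRel θ p (𝟙 d) q (𝟙 b) p₁ q₁) (H₂ : AssocRel θ q₁ (𝟙 e) r (𝟙 b) q₂ r₂)
    (H₃ : AssocRel θ p₁ (𝟙 e) q₂ (𝟙 c) p₃ q₃)
    (H₄ : AssocRel θ q (𝟙 e) r (𝟙 x) q₄ r₄) (H₅ : AssocRel θ p (𝟙 x₄) r₄ (𝟙 b) p₅ r₅) :
    compEl (P := 𝟙 A ⊠ₚ (𝟙 A ⊠ₚ μ)) (Q := (𝟙 A ⊠ₚ μ) ≫ μ) (b, (c, y₃))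
      (pairEl (homEl (𝟙 b)) (pairEl (homEl (𝟙 c)) p₃))
        (compEl (P := 𝟙 A ⊠ₚ μ) (Q := μ) (b, y₂) (pairEl (homEl (𝟙 b)) q₃) r₂) =
    compEl (b, (c, x₄)) (pairEl (homEl (𝟙 b)) (pairEl (homEl (𝟙 c)) q₄))
        (compEl (b, x₅) (pairEl (homEl (𝟙 b)) p₅) r₅) := by
  have h := (evEl_pentagonTop H₁ H₂ H₃).symm.trans ((congrArg (fun k => evEl k _) hθ).trans
    (evEl_pentagonBottom H₄ H₅))
  -- Both sides start with the same two associator 1-cells at identities. Restriction along the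
  -- associator functors removes them one after the other.
  have h' := congrArg (evEl ((Bicategory.associator (assocHom (tensorObj A A) A A)
      (assocHom A A (tensorObj A A))
    ((𝟙 A ⊠ₚ (𝟙 A ⊠ₚ μ)) ≫ (𝟙 A ⊠ₚ μ) ≫ μ)).hom ≫ (assocRestrIso _).hom)) h
  rw [evEl_comp, evEl_comp, evEl_associator_hom, evEl_associator_hom, evEl_assocRestrIso_hom,
    evEl_assocRestrIso_hom] at h'
  have h'' := congrArg (evEl (assocRestrIso _).hom) h'
  exact (evEl_assocRestrIso_hom _ _).symm.trans (h''.trans (evEl_assocRestrIso_hom _ _))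

/-- `(P ⊠ W) ≫ (1 ⊠ R) ≅ P ⊠ (W ≫ R)`. -/
def tensorWhiskerComp {X Y Z Z' : Prof.{u}} (P : X ⟶ A) (W : Y ⟶ Z) (R : Z ⟶ Z') :
    (P ⊠ₚ W) ≫ (𝟙 A ⊠ₚ R) ≅ P ⊠ₚ (W ≫ R) :=
  tensorComp P (𝟙 A) W R ≪≫ tensorHom₂Iso (Bicategory.rightUnitor P) (Iso.refl _)

lemma evEl_tensorWhiskerComp_hom {X Y Z Z' : Prof.{u}} (P : X ⟶ A) (W : Y ⟶ Z) (R : Z ⟶ Z') {x : X}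
    {a : A} {y : Y} {z : Z} {z' : Z'} (p : El P x a) (w : El W y z) (r : El R z z') :
    evEl (tensorWhiskerComp P W R).hom (compEl (a, z) (pairEl p w) (pairEl (homEl (𝟙 a)) r)) =
      pairEl p (compEl z w r) :=
  congrArg (fun k => pairEl k (compEl z w r)) (ract_id P p)

/-- The iterated convolution of four presheaves, as a composite. -/
def convQuadCell (μ : tensorObj A A ⟶ A) {X Y Z W : Prof.{u}} (M : X ⟶ A) (N : Y ⟶ A) (K : Z ⟶ A)
    (L : W ⟶ A) :
    (M ⊠ₚ (N ⊠ₚ (K ⊠ₚ L))) ≫ (𝟙 A ⊠ₚ (𝟙 A ⊠ₚ μ)) ≫ (𝟙 A ⊠ₚ μ) ≫ μ ≅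
      (M ⊠ₚ ((N ⊠ₚ ((K ⊠ₚ L) ≫ μ)) ≫ μ)) ≫ μ :=
  (Bicategory.associator _ _ _).symm ≪≫ Bicategory.whiskerRightIso
      (tensorWhiskerComp M (N ⊠ₚ (K ⊠ₚ L)) (𝟙 A ⊠ₚ μ)) _ ≪≫
    (Bicategory.associator _ _ _).symm ≪≫ Bicategory.whiskerRightIso (tensorWhiskerComp M _ μ ≪≫
      tensorHom₂Iso (Iso.refl M) (Bicategory.whiskerRightIso (tensorWhiskerComp N (K ⊠ₚ L) μ) μ)) μ

lemma evEl_convQuadCell_hom (μ : tensorObj A A ⟶ A) {X Y Z W : Prof.{u}} (M : X ⟶ A) (N : Y ⟶ A)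
    (K : Z ⟶ A) (L : W ⟶ A) {x₀ : X} {y₀ : Y} {z₀ : Z} {w₀ : W} {b c d e s t a : A}
    (m : El M x₀ b) (n : El N y₀ c) (k : El K z₀ d) (l : El L w₀ e) (p : El μ (d, e) s)
    (q : El μ (c, s) t) (r : El μ (b, t) a) :
    evEl (convQuadCell μ M N K L).hom (compEl (b, (c, (d, e)))
      (pairEl m (pairEl n (pairEl k l)))
      (compEl (P := 𝟙 A ⊠ₚ (𝟙 A ⊠ₚ μ)) (Q := (𝟙 A ⊠ₚ μ) ≫ μ) (b, (c, s))
      (pairEl (homEl (𝟙 b)) (pairEl (homEl (𝟙 c)) p))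
        (compEl (P := 𝟙 A ⊠ₚ μ) (Q := μ) (b, t) (pairEl (homEl (𝟙 b)) q) r))) =
    compEl (b, t) (pairEl m (compEl (c, s) (pairEl n (compEl (d, e) (pairEl k l) p)) q)) r := by
  simp only [convQuadCell, Iso.trans_hom, Iso.symm_hom, Bicategory.whiskerRightIso_hom, evEl_comp,
    tensorHom₂Iso_hom, Iso.refl_hom]
  repeat first
    | rw [evEl_whiskerRight] | rw [evEl_comp] | rw [evEl_associator_inv]
    | rw [evEl_tensorWhiskerComp_hom] | rw [evEl_tensorHom₂] | rw [evEl_id]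

/-- Each leg sends a generator to an iterated class with the same presheaf elements `m`, `n`, `k`,
`l`, so only the triples of multiplication elements have to be compared, and `pentagon_rel` does
that. -/
lemma conv_pentagon (hθ : pentagonTop μ θ = pentagonBottom μ θ) (M N K L : Psh A) :
    convMap μ (convAssoc μ μ θ M N K).hom (𝟙 L) ≫ (convAssoc μ μ θ M (conv μ N K) L).hom ≫
        convMap μ (𝟙 M) (convAssoc μ μ θ N K L).hom =
      (convAssoc μ μ θ (conv μ M N) K L).hom ≫ (convAssoc μ μ θ M N (conv μ K L)).hom :=
  conv_hom_ext₃ fun {x d e y a} t k l q r => by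
    induction t using cv_ind with
    | h b c m n p =>
      obtain ⟨x₁, p₁, q₁, H₁⟩ := exists_assocRel θ p q
      obtain ⟨y₂, q₂, r₂, H₂⟩ := exists_assocRel θ q₁ r
      obtain ⟨y₃, p₃, q₃, H₃⟩ := exists_assocRel θ p₁ q₂
      obtain ⟨x₄, q₄, r₄, H₄⟩ := exists_assocRel θ q r
      obtain ⟨x₅, p₅, r₅, H₅⟩ := exists_assocRel θ p r₄
      have h₁ : (convMap μ (convAssoc μ μ θ M N K).hom (𝟙 L) ≫
          (convAssoc μ μ θ M (conv μ N K) L).hom ≫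
            convMap μ (𝟙 M) (convAssoc μ μ θ N K L).hom).app (op a)
              (cv (cv (cv m n p) k q) l r) = cv m (cv n (cv k l p₃) q₃) r₂ := by
        refine (congrArg (fun w => (convMap μ (𝟙 M) (convAssoc μ μ θ N K L).hom).app (op a)
          ((convAssoc μ μ θ M (conv μ N K) L).hom.app (op a) (cv w l r)))
            (convAssoc_hom_cv_one H₁ m n k)).trans ?_
        refine (congrArg (fun w => (convMap μ (𝟙 M) (convAssoc μ μ θ N K L).hom).app (op a) w)
          (convAssoc_hom_cv_one H₂ m (cv n k p₁) l)).trans ?_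
        exact congrArg (fun w => cv m w r₂) (convAssoc_hom_cv_one H₃ n k l)
      have h₂ : ((convAssoc μ μ θ (conv μ M N) K L).hom ≫
          (convAssoc μ μ θ M N (conv μ K L)).hom).app (op a)
              (cv (cv (cv m n p) k q) l r) = cv m (cv n (cv k l q₄) p₅) r₅ := by
        refine (congrArg (fun w => (convAssoc μ μ θ M N (conv μ K L)).hom.app (op a) w)
          (convAssoc_hom_cv_one H₄ (cv m n p) k l)).trans ?_
        exact convAssoc_hom_cv_one H₅ m n (cv k l q₄)
      refine h₁.trans (Eq.trans ?_ h₂.symm)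
      -- `pentagon_rel` is an equality of classes in a composite of multiplications; `convQuadCell`
      -- turns it into one of iterated convolutions by inserting the four presheaf elements.
      have h := congrArg (fun w => evEl (convQuadCell μ (ofPsh M) (ofPsh N) (ofPsh K) (ofPsh L)).hom
        (compEl (P := ofPsh M ⊠ₚ (ofPsh N ⊠ₚ (ofPsh K ⊠ₚ ofPsh L))) (a := (pt, (pt, (pt, pt))))
          (Q := (𝟙 A ⊠ₚ (𝟙 A ⊠ₚ μ)) ≫ (𝟙 A ⊠ₚ μ) ≫ μ) (c := a) (b, (c, (d, e)))
          (pairEl (P := ofPsh M) (a := pt) m (pairEl (P := ofPsh N) (a := pt) n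
            (pairEl (P := ofPsh K) (Q := ofPsh L) (a := pt) (b := pt) k l))) w))
          (pentagon_rel hθ H₁ H₂ H₃ H₄ H₅)
      exact (evEl_convQuadCell_hom μ (ofPsh M) (ofPsh N) (ofPsh K) (ofPsh L) (x₀ := pt) (y₀ := pt)
        (z₀ := pt) (w₀ := pt) m n k l p₃ q₃ r₂).symm.trans (h.trans
        (evEl_convQuadCell_hom μ (ofPsh M) (ofPsh N) (ofPsh K) (ofPsh L) (x₀ := pt) (y₀ := pt)
        (z₀ := pt) (w₀ := pt) m n k l q₄ p₅ r₅))

/-- The triangle law on elements. -/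
lemma triangle_rel (F : Pseudomonoid A) {b z d x a y₁ : A} (e : El F.one pt z)
    (p : El F.mul (b, z) x) (q : El F.mul (x, d) a)
   {p₁ : El F.mul (z, d) y₁} {q₁ : El F.mul (b, y₁) a}
    (H : AssocRel F.assoc p (𝟙 d) q (𝟙 b) p₁ q₁) :
   lact F.mul (a := (b, y₁)) (a' := (b, d)) (𝟙 b, leftUnitElHom (b := d) (a := y₁)
       (evEl F.leftUnit.hom (compEl (z, d) (pairEl e (homEl (𝟙 d))) p₁))) q₁ =
    lact F.mul (a := (x, d)) (a' := (b, d)) (rightUnitElHom (b := b) (a := x)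
        (evEl F.rightUnit.hom (compEl (b, z) (pairEl (homEl (𝟙 b)) e) p)), 𝟙 d) q := by
  have h := congrArg (fun k => evEl k (compEl (P := (𝟙 A ⊠ₚ F.one) ⊠ₚ 𝟙 A)
      (Q := (F.mul ⊠ₚ 𝟙 A) ≫ F.mul) (c := a) (a := ((b, pt), d)) ((b, z), d)
      (pairEl (pairEl (homEl (𝟙 b)) e) (homEl (𝟙 d)))
      (compEl (x, d) (pairEl p (homEl (𝟙 d))) q))) F.triangle
  simp only [bicategoricalComp, BicategoricalCoherence.iso, Iso.trans_hom,
    Iso.refl_hom, Bicategory.whiskerRightIso_hom, Bicategory.whiskerLeftIso_hom, evEl_comp,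
        Iso.symm_hom,
    Bicategory.id_whiskerRight, Category.id_comp] at h
  repeat first
    | rw [evEl_whiskerLeft] at h | rw [evEl_whiskerRight] at h | rw [evEl_associator_hom] at h
    | rw [evEl_associator_inv] at h | rw [evEl_comp] at h | rw [evEl_id] at h
    | rw [evEl_tensorHom₂] at h
    | rw [evEl_assocNat_hom] at h | rw [H] at h | rw [evEl_compTensorId_hom] at h
    | rw [evEl_compTensorId_inv] at h | rw [evEl_idTensorComp_hom] at h
    | rw [evEl_idTensorComp_inv] at h
    | rw [evEl_triangulator_hom] at h
  -- The two sides now start with elements of the companion of the projection. Composition with a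
  -- companion is restriction, so these elements become the actions in the claim.
  exact congrArg (evEl ((companionTensorId (A := tensorObj A unitObj)
    (CategoryTheory.Prod.fst A (Discrete PUnit.{u + 1})) A).hom ▷ F.mul ≫
    (show companion (A := tensorObj (tensorObj A unitObj) A) (B := tensorObj A A) _ ≫ F.mul ⟶
      ((CategoryTheory.Prod.fst A (Discrete PUnit.{u + 1})).prod (𝟭 A) ⋙ F.mul : Profunctor _ _)
          from
      (companionLeftIso ((CategoryTheory.Prod.fst A (Discrete PUnit.{u + 1})).prod (𝟭 A))
        F.mul).hom))) h

end
end Prof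

/-! ### Day convolution as a monoidal structure. -/

namespace Prof

open Bicategory

/-- Presheaves on a pseudomonoid, with convolution as the tensor product. -/
def Conv {A : Prof.{u}} (_ : Pseudomonoid A) : Type (u + 1) := Psh A

namespace Conv

variable {A : Prof.{u}} (F : Pseudomonoid A)

instance : Category.{u} (Conv F) := inferInstanceAs (Category (Psh A))

/-- The unit 2-cells turn the unit element into morphisms acting on `n` and on `m`. `cv_sound` moves
both actions onto the multiplication element, where `triangle_rel` compares them. -/
lemma convAssoc_triangle (M N : Psh A) :
    (convAssoc F.mul F.mul F.assoc M (unitPsh F.one) N).hom ≫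
        convMap F.mul (𝟙 M) (convLeftUnit F.leftUnit N).hom =
      convMap F.mul (convRightUnit F.rightUnit M).hom (𝟙 N) :=
  conv_hom_ext₃ fun {b z d x a} m e n p q => by
    obtain ⟨y₁, p₁, q₁, H⟩ := exists_assocRel F.assoc p q
    refine (congrArg (fun w => (convMap F.mul (𝟙 M) (convLeftUnit F.leftUnit N).hom).app (op a) w)
      (convAssoc_hom_cv_one H m e n)).trans ?_
    refine (congrArg (fun w => cv m w q₁) (convLeftUnit_hom_cv F.leftUnit e n p₁)).trans ?_
    refine Eq.trans ?_ (congrArg (fun w => cv w n q)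
      (convRightUnit_hom_cv F.rightUnit e m p)).symm
    have h₁ := cv_sound (Q := F.mul) (M := M) (N := N) (𝟙 b) (leftUnitElHom (b := d) (a := y₁)
      (evEl F.leftUnit.hom (compEl (z, d) (pairEl e (homEl (𝟙 d))) p₁))) m n q₁
    have h₂ := cv_sound (Q := F.mul) (M := M) (N := N) (rightUnitElHom (b := b) (a := x)
      (evEl F.rightUnit.hom (compEl (b, z) (pairEl (homEl (𝟙 b)) e) p))) (𝟙 d) m n q
    rw [op_id, Functor.map_id_apply] at h₁ h₂
    exact h₁.trans ((congrArg (fun w => cv m n w) (triangle_rel F e p q H)).trans h₂.symm)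

lemma convLeftUnit_naturality {M N : Psh A} (φ : M ⟶ N) :
    convMap F.mul (𝟙 _) φ ≫ (convLeftUnit F.leftUnit N).hom =
      (convLeftUnit F.leftUnit M).hom ≫ φ :=
  conv_hom_ext fun a x y e m p => by
    refine (convLeftUnit_hom_cv F.leftUnit e (φ.app _ m) p).trans ?_
    refine Eq.trans ?_ (congrArg (φ.app (op a)) (convLeftUnit_hom_cv F.leftUnit e m p)).symm
    exact (ConcreteCategory.congr_hom (φ.naturality _) m).symm

lemma convRightUnit_naturality {M N : Psh A} (φ : M ⟶ N) :
    convMap F.mul φ (𝟙 _) ≫ (convRightUnit F.rightUnit N).hom =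
      (convRightUnit F.rightUnit M).hom ≫ φ :=
  conv_hom_ext fun a x y m e p => by
    refine (convRightUnit_hom_cv F.rightUnit e (φ.app _ m) p).trans ?_
    refine Eq.trans ?_ (congrArg (φ.app (op a)) (convRightUnit_hom_cv F.rightUnit e m p)).symm
    exact (ConcreteCategory.congr_hom (φ.naturality _) m).symm

instance : MonoidalCategoryStruct (Conv F) where
  tensorObj M N := conv F.mul M N
  whiskerLeft M _ _ ψ := convMap F.mul (𝟙 M) ψ
  whiskerRight φ N := convMap F.mul φ (𝟙 N)
  tensorHom φ ψ := convMap F.mul φ ψ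
  tensorUnit := unitPsh F.one
  associator M N K := convAssoc F.mul F.mul F.assoc M N K
  leftUnitor M := convLeftUnit F.leftUnit M
  rightUnitor M := convRightUnit F.rightUnit M

/-- The Day convolution monoidal structure on the presheaves on a pseudomonoid. -/
instance : MonoidalCategory (Conv F) :=
  MonoidalCategory.ofTensorHom
    (id_tensorHom_id := fun _ _ => convMap_id)
    (tensorHom_comp_tensorHom := fun _ _ _ _ => (convMap_comp _ _ _ _).symm)
    (id_tensorHom := fun _ _ _ _ => rfl)
    (tensorHom_id := fun _ _ => rfl)
    (associator_naturality := fun φ ψ χ => convAssoc_naturality F.assoc φ ψ χ)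
    (leftUnitor_naturality := fun φ => convLeftUnit_naturality F φ)
    (rightUnitor_naturality := fun φ => convRightUnit_naturality F φ)
    (pentagon := fun M N K L => conv_pentagon F.pentagon M N K L)
    (triangle := fun M N => convAssoc_triangle F M N)

end Conv
end Prof

/-! ### Splitting retracts and transporting tensor products along a fully faithful functor. -/

section General

open MonoidalCategory

universe v₁ v₂ u₁ u₂

variable {C : Type u₁} [Category.{v₁} C] {D : Type u₂} [Category.{v₂} D]

/-- A retract of an object in the image of a fully faithful functor out of an idempotent complete
category is in the essential image. -/
lemma CategoryTheory.Functor.essImage_of_retract (F : C ⥤ D) [F.Full] [F.Faithful]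
    [IsIdempotentComplete C] {X : C} {Y : D} (r : Retract Y (F.obj X)) : F.essImage Y := by
  -- The idempotent of `F.obj X` with image `Y` is the image of an idempotent of `X`, since `F` is
  -- fully faithful. If `Z` splits the latter, then `F.obj Z` and `Y` split the same idempotent.
  obtain ⟨Z, i, p, hip, hpi⟩ := IsIdempotentComplete.idempotents_split X
    (F.preimage (r.r ≫ r.i)) (F.map_injective (by simp))
  refine ⟨Z, ⟨⟨F.map i ≫ r.r, r.i ≫ F.map p, ?_, ?_⟩⟩⟩
  · have h : r.r ≫ r.i = F.map p ≫ F.map i := by rw [← F.map_comp, hpi, F.map_preimage]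
    rw [Category.assoc, reassoc_of% h, ← F.map_comp, ← F.map_comp, hip, ← F.map_comp]
    simp [hip]
  · have h : F.map p ≫ F.map i = r.r ≫ r.i := by rw [← F.map_comp, hpi, F.map_preimage]
    rw [Category.assoc, reassoc_of% h]
    simp

namespace CategoryTheory.Monoidal

variable [MonoidalCategory D] (F : C ⥤ D) [F.Full] [F.Faithful]

/-- The monoidal structure on `C` for which a fully faithful functor `F : C ⥤ D` is monoidal, given
the tensor product and the unit on objects. -/
@[reducible]
noncomputable def fullyFaithfulStruct (T : C → C → C) (I : C) (m : ∀ X Y, F.obj X ⊗ F.obj Y ≅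
    F.obj (T X Y))
    (e : 𝟙_ D ≅ F.obj I) : MonoidalCategoryStruct C where
  tensorObj := T
  whiskerLeft X _ _ f := F.preimage ((m _ _).inv ≫ (F.obj X ◁ F.map f) ≫ (m _ _).hom)
  whiskerRight f Y := F.preimage ((m _ _).inv ≫ (F.map f ▷ F.obj Y) ≫ (m _ _).hom)
  tensorHom f g := F.preimage ((m _ _).inv ≫ (F.map f ⊗ₘ F.map g) ≫ (m _ _).hom)
  tensorUnit := I
  associator X Y Z := F.preimageIso (((m _ _).symm ≪≫ ((m _ _).symm ⊗ᵢ .refl _))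
        ≪≫ α_ (F.obj X) (F.obj Y) (F.obj Z)
        ≪≫ ((.refl _ ⊗ᵢ m _ _) ≪≫ m _ _))
  leftUnitor X := F.preimageIso (((m _ _).symm ≪≫ (e.symm ⊗ᵢ .refl _)) ≪≫ λ_ (F.obj X))
  rightUnitor X := F.preimageIso (((m _ _).symm ≪≫ (.refl _ ⊗ᵢ e.symm)) ≪≫ ρ_ (F.obj X))

/-- The functor `F` is compatible with `fullyFaithfulStruct`. -/
noncomputable def fullyFaithfulData (T : C → C → C) (I : C) (m : ∀ X Y, F.obj X ⊗ F.obj Y ≅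
    F.obj (T X Y))
    (e : 𝟙_ D ≅ F.obj I) :
    letI := fullyFaithfulStruct F T I m e
    InducingFunctorData F :=
  letI := fullyFaithfulStruct F T I m e
  { μIso := m
    whiskerLeft_eq := fun _ _ _ _ => F.map_preimage _
    whiskerRight_eq := fun _ _ => F.map_preimage _
    tensorHom_eq := fun _ _ => F.map_preimage _
    εIso := e
    associator_eq := fun _ _ _ => F.map_preimage _
    leftUnitor_eq := fun _ => F.map_preimage _
    rightUnitor_eq := fun _ => F.map_preimage _ }

end CategoryTheory.Monoidal

end General

/-! ### Restricted Yoneda embeddings. -/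

namespace Prof

variable {A : Prof.{u}} {C : Type u} [SmallCategory C] (ι : (A : Type u)ᵒᵖ ⥤ C)

/-- The functor sending `X` to the presheaf `a ↦ Hom(X, ι a)`. -/
def nerve : C ⥤ (Psh A)ᵒᵖ :=
  (coyoneda ⋙ (Functor.whiskeringLeft (A : Type u)ᵒᵖ C (Type u)).obj ι).rightOp

/-- The functor sending `X` to the copresheaf `a ↦ Hom(ι a, X)`. -/
def conerve : C ⥤ ((A : Type u) ⥤ Type u) :=
  yoneda ⋙ (Functor.whiskeringLeft (A : Type u) Cᵒᵖ (Type u)).obj ι.rightOp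

/-- `ι` is the inclusion of a full subcategory and every object is a retract of one in its image. -/
structure IsRetractDense : Prop where
  full : ι.Full
  faithful : ι.Faithful
  exists_retract (X : C) : ∃ a : A, Nonempty (Retract X (ι.obj (op a)))

variable {ι}

/-- A Yoneda argument with the section `r.i : Y ⟶ ι a` as universal element: any `g : Y ⟶ ι b`
equals `r.i ≫ (r.r ≫ g)`, and `r.r ≫ g` comes from `A` because `ι` is full. So a natural map is
determined by its value at `r.i`. -/
lemma IsRetractDense.nerve_full (h : IsRetractDense ι) : (nerve ι).Full where
  map_surjective {X Y} φ := by
    obtain ⟨a, ⟨r⟩⟩ := h.exists_retract Y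
    have := h.full
    let f : X ⟶ ι.obj (op a) := φ.unop.app (op a) r.i
    refine ⟨f ≫ r.r, Quiver.Hom.unop_inj ?_⟩
    ext b (g : Y ⟶ ι.obj b)
    change (f ≫ r.r) ≫ g = φ.unop.app b g
    have h₁ := ConcreteCategory.congr_hom (φ.unop.naturality (ι.preimage (r.r ≫ g))) r.i
    have h₂ : φ.unop.app b (r.i ≫ ι.map (ι.preimage (r.r ≫ g))) =
      f ≫ ι.map (ι.preimage (r.r ≫ g)) := h₁
    rw [ι.map_preimage, r.retract_assoc] at h₂
    rw [Category.assoc]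
    exact h₂.symm

lemma IsRetractDense.nerve_faithful (h : IsRetractDense ι) : (nerve ι).Faithful where
  map_injective {X Y} f g e := by
    obtain ⟨a, ⟨r⟩⟩ := h.exists_retract Y
    have h₁ : f ≫ r.i = g ≫ r.i :=
      congrArg (fun k : (nerve ι).obj X ⟶ (nerve ι).obj Y => k.unop.app (op a) r.i) e
    rw [← cancel_mono r.i, h₁]

lemma IsRetractDense.conerve_full (h : IsRetractDense ι) : (conerve ι).Full where
  map_surjective {X Y} φ := by
    obtain ⟨a, ⟨r⟩⟩ := h.exists_retract X
    have := h.full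
    let f : ι.obj (op a) ⟶ Y := φ.app a r.r
    refine ⟨r.i ≫ f, ?_⟩
    ext b (g : ι.obj (op b) ⟶ X)
    change g ≫ r.i ≫ f = φ.app b g
    have h₁ := ConcreteCategory.congr_hom (φ.naturality (ι.preimage (g ≫ r.i)).unop) r.r
    have h₂ : φ.app b (ι.map (ι.preimage (g ≫ r.i)) ≫ r.r) =
      ι.map (ι.preimage (g ≫ r.i)) ≫ f := h₁
    rw [ι.map_preimage, Category.assoc, r.retract, Category.comp_id] at h₂
    rw [h₂, Category.assoc]

lemma IsRetractDense.conerve_faithful (h : IsRetractDense ι) : (conerve ι).Faithful where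
  map_injective {X Y} f g e := by
    obtain ⟨a, ⟨r⟩⟩ := h.exists_retract X
    have h₁ : r.r ≫ f = r.r ≫ g :=
      congrArg (fun k : (conerve ι).obj X ⟶ (conerve ι).obj Y => k.app a r.r) e
    rw [← cancel_epi r.r, h₁]

/-- The restriction of `ι a` to a presheaf is representable. -/
noncomputable def nerveObjIso [ι.Full] [ι.Faithful] (a : A) :
    yoneda.obj a ≅ ((nerve ι).obj (ι.obj (op a))).unop :=
  NatIso.ofComponents
    (fun b => Equiv.toIso
      { toFun := fun g : b.unop ⟶ a => (ι.map g.op : ι.obj (op a) ⟶ ι.obj b)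
        invFun := fun g : ι.obj (op a) ⟶ ι.obj b => (ι.preimage g).unop
        left_inv := fun g => congrArg Quiver.Hom.unop (ι.preimage_map g.op)
        right_inv := fun g => ι.map_preimage g })
    (fun f => by
      ext (g : _ ⟶ a)
      exact ι.map_comp g.op f)

/-- The restriction of `ι a` to a copresheaf is corepresentable. -/
noncomputable def conerveObjIso [ι.Full] [ι.Faithful] (a : A) :
    coyoneda.obj (op a) ≅ (conerve ι).obj (ι.obj (op a)) :=
  NatIso.ofComponents
    (fun b => Equiv.toIso
      { toFun := fun g : a ⟶ b => (ι.map g.op : ι.obj (op b) ⟶ ι.obj (op a))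
        invFun := fun g : ι.obj (op b) ⟶ ι.obj (op a) => (ι.preimage g).unop
        left_inv := fun g => congrArg Quiver.Hom.unop (ι.preimage_map g.op)
        right_inv := fun g => ι.map_preimage g })
    (fun f => by
      ext (g : a ⟶ _)
      exact ι.map_comp f.op g.op)

variable [IsIdempotentComplete C]

/-- A presheaf that is a retract of a representable one is represented by an object of `C`. -/
lemma IsRetractDense.nerve_essImage (h : IsRetractDense ι) {M : Psh A}
    {a : A} (r : Retract M (yoneda.obj a)) : (nerve ι).essImage (op M) := by
  have := h.full
  have := h.faithful
  have := h.nerve_full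
  have := h.nerve_faithful
  exact (nerve ι).essImage_of_retract (r.trans (Retract.ofIso (nerveObjIso a))).op

/-- A copresheaf that is a retract of a corepresentable one is represented by an object of `C`. -/
lemma IsRetractDense.conerve_essImage (h : IsRetractDense ι) {M : (A : Type u) ⥤ Type u}
    {a : A} (r : Retract M (coyoneda.obj (op a))) : (conerve ι).essImage M := by
  have := h.full
  have := h.faithful
  have := h.conerve_full
  have := h.conerve_faithful
  exact (conerve ι).essImage_of_retract (r.trans (Retract.ofIso (conerveObjIso a)))

end Prof

/-! ### Left adjoint 1-cells and the monoidal structure on `C`. -/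

namespace Prof

open Bicategory

section Tiny

variable {A B X : Prof.{u}}

/-- The values of a left adjoint 1-cell are retracts of representable presheaves. -/
lemma exists_retract_of_isLeftAdjoint {P : X ⟶ A} (h : IsLeftAdjoint P) (x : X) :
    ∃ a : A, Nonempty (Retract (Functor.obj (C := X) (D := Psh A) P x) (yoneda.obj a)) := by
  obtain ⟨R, adj⟩ := h.nonempty
  -- Any element of a coend is the class of a single pair; this pair supplies the representing
  -- object and both maps of the retract.
  obtain ⟨a₀, p₀, r₀, hu⟩ : ∃ (a₀ : A) (p₀ : El P x a₀) (r₀ : El R a₀ x),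
      evEl adj.unit (homEl (𝟙 x)) = compEl a₀ p₀ r₀ := by
    generalize evEl adj.unit (homEl (𝟙 x)) = t
    induction t using cind with | h b y z => exact ⟨b, y, z, rfl⟩
  -- The left triangle identity on `p`: contracting `r₀` with `p` by the counit and then acting on
  -- `p₀` returns `p`.
  have key {a : A} (p : El P x a) :
      ract P (evEl adj.counit (compEl x r₀ p) : a ⟶ a₀) p₀ = p := by
    have h := congrArg (fun k => evEl (k ≫ (Bicategory.rightUnitor P).hom)
        (compEl (P := 𝟙 X) x (homEl (𝟙 x)) p))
      adj.left_triangle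
    simp only [leftZigzag, bicategoricalComp, BicategoricalCoherence.iso, Iso.trans_hom,
      Iso.refl_hom, Bicategory.whiskerRightIso_hom, evEl_comp, evEl_whiskerRight,
      evEl_id, hu, evEl_associator_hom, evEl_whiskerLeft, evEl_leftUnitor_hom, lact_one,
      Bicategory.id_whiskerRight, evEl_rightUnitor_inv] at h
    exact h.trans (ract_one P p)
  refine ⟨a₀, ⟨
    { i :=
        { app := fun a => ↾(fun p => (evEl adj.counit (compEl x r₀ p) : a.unop ⟶ a₀))
          naturality := ?_ }
      r := yonedaEquiv.symm p₀
      retract := ?_ }⟩⟩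
  · intro a b f
    ext p
    exact ev_ract adj.counit f.unop (compEl x r₀ p)
  · ext a p
    exact key p

end Tiny

section Conv

variable {A B : Prof.{u}} (Q : tensorObj A A ⟶ B)

/-- The convolution of two representable presheaves. -/
def convYoneda (y z : A) :
    conv Q (yoneda.obj y) (yoneda.obj z) ≅
      Functor.obj (C := tensorObj A A) (D := Psh B) Q (y, z) :=
  NatIso.ofComponents
    (fun x => Equiv.toIso
      { toFun := clift (P := ofPsh (yoneda.obj y) ⊠ₚ ofPsh (yoneda.obj z)) (Q := Q)
          (a := (pt, pt)) (c := x.unop)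
          (fun b f q => lact Q (a := b) (a' := (y, z)) f q)
          (fun {b b'} g f q => lact_comp Q (a := b) (a' := b') (a'' := (y, z)) g f q)
        invFun := fun q => cv (𝟙 y) (𝟙 z) q
        left_inv := fun t => by
          induction t using cv_ind (x := x.unop) with
          | h y' z' f g q =>
            exact (cv_sound (Q := Q) (M := yoneda.obj y) (N := yoneda.obj z) (y' := y) (z' := z)
              f g (𝟙 y) (𝟙 z) q).symm.trans (congrArg₂ (fun k l => cv (Q := Q) (M := yoneda.obj y)
                (N := yoneda.obj z) k l q) (Category.comp_id f) (Category.comp_id g))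
        right_inv := fun q => lact_id Q q })
    (fun {x x'} f => by
      ext t
      induction t using cv_ind (x := x.unop) with
      | h y' z' g h q => exact lact_ract Q (a := (y', z')) (a' := (y, z)) (g, h) f.unop q)

/-- The convolution of isomorphic presheaves. -/
def convMapIso {M M' N N' : Psh A} (φ : M ≅ M') (ψ : N ≅ N') : conv Q M N ≅ conv Q M' N' where
  hom := convMap Q φ.hom ψ.hom
  inv := convMap Q φ.inv ψ.inv
  hom_inv_id := by rw [← convMap_comp, φ.hom_inv_id, ψ.hom_inv_id, convMap_id]
  inv_hom_id := by rw [← convMap_comp, φ.inv_hom_id, ψ.inv_hom_id, convMap_id]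

variable {Q} in
/-- The convolution of retracts is a retract of the convolution. -/
def convRetract {M M' N N' : Psh A} (r : Retract M M') (s : Retract N N') :
    Retract (conv Q M N) (conv Q M' N') where
  i := convMap Q r.i s.i
  r := convMap Q r.r s.r
  retract := by rw [← convMap_comp, r.retract, s.retract, convMap_id]

end Conv

section Monoidal

open MonoidalCategory

variable {A : Prof.{u}} {C : Type u} [SmallCategory C] {ι : (A : Type u)ᵒᵖ ⥤ C}

lemma IsRetractDense.exists_retract_nerve (h : IsRetractDense ι) (X : C) :
    ∃ a : A, Nonempty (Retract ((nerve ι).obj X).unop (yoneda.obj a)) := by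
  obtain ⟨a, ⟨r⟩⟩ := h.exists_retract X
  have := h.full
  have := h.faithful
  refine ⟨a, ⟨Retract.trans ?_ (Retract.ofIso (nerveObjIso (ι := ι) a).symm)⟩⟩
  exact
    { i := ((nerve ι).map r.r).unop
      r := ((nerve ι).map r.i).unop
      retract := by rw [← unop_comp, ← Functor.map_comp, r.retract, CategoryTheory.Functor.map_id,
          unop_id] }

/-- The restricted Yoneda embedding into presheaves with the convolution product. -/
def convNerve (F : Pseudomonoid A) (ι : (A : Type u)ᵒᵖ ⥤ C) : C ⥤ (Conv F)ᵒᵖ := nerve ι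

variable [IsIdempotentComplete C]

/-- Both factors are retracts of representables, the convolution of representables is a value of
`μ`, and values of a left adjoint are again retracts of representables. -/
lemma IsRetractDense.essImage_conv (h : IsRetractDense ι) (μ : tensorObj A A ⟶ A)
    (hμ : IsLeftAdjoint μ) (X Y : C) :
    (nerve ι).essImage (op (conv μ ((nerve ι).obj X).unop ((nerve ι).obj Y).unop)) := by
  obtain ⟨a, ⟨r⟩⟩ := h.exists_retract_nerve X
  obtain ⟨b, ⟨s⟩⟩ := h.exists_retract_nerve Y
  obtain ⟨c, ⟨t⟩⟩ := exists_retract_of_isLeftAdjoint hμ (a, b)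
  exact h.nerve_essImage (((convRetract r s).trans (Retract.ofIso (convYoneda μ a b))).trans t)

/-- The convolution product of presheaves induces a monoidal structure on `C`. -/
lemma IsRetractDense.exists_monoidal (h : IsRetractDense ι) (F : Pseudomonoid A)
    (hμ : IsLeftAdjoint F.mul) (hη : IsLeftAdjoint F.one) :
    ∃ _ : MonoidalCategory C, Nonempty (convNerve F ι).Monoidal := by
  have : (convNerve F ι).Full := h.nerve_full
  have : (convNerve F ι).Faithful := h.nerve_faithful
  choose T hT using h.essImage_conv F.mul hμ
  obtain ⟨a, ⟨r⟩⟩ := exists_retract_of_isLeftAdjoint hη pt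
  obtain ⟨I, ⟨e⟩⟩ := h.nerve_essImage r
  let := Monoidal.fullyFaithfulStruct (convNerve F ι) T I (fun X Y => (hT X Y).some.symm) e.symm
  exact ⟨Monoidal.induced (convNerve F ι) (Monoidal.fullyFaithfulData (convNerve F ι) T I
    (fun X Y => (hT X Y).some.symm) e.symm), ⟨Monoidal.fromInducedMonoidal _ _⟩⟩

end Monoidal

end Prof

/-! ### The tensor product and unit of `C` represent `μ` and `η`. -/

namespace Prof

open Bicategory

section UnitNaturality

variable {A : Prof.{u}} {η : unitObj ⟶ A} {μ : tensorObj A A ⟶ A}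

/-- Naturality of `l` in its second variable. The unit law of convolution produces `h` composed
outside, while the required compatibility has it inside the element. -/
lemma leftUnitElHom_comp (l : (η ⊠ₚ 𝟙 A) ≫ μ ≅ leftUnitHom A) {x y b a : A} (e : El η pt x)
    (h : y ⟶ b) (p : El μ (x, y) a) :
    leftUnitElHom (evEl l.hom (compEl (x, y) (pairEl e (homEl (𝟙 y))) p)) ≫ h =
      leftUnitElHom (evEl l.hom (compEl (x, y) (pairEl e (homEl h)) p)) := by
  refine (congrArg leftUnitElHom (ev_lact l.hom (a := (pt, y)) (a' := (pt, b)) (𝟙 pt, h)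
    (compEl (x, y) (pairEl e (homEl (𝟙 y))) p))).symm.trans ?_
  exact congrArg₂ (fun e' k => leftUnitElHom (evEl l.hom (compEl (x, y) (pairEl e' (homEl k)) p)))
    (lact_one η e) (Category.id_comp h)

lemma rightUnitElHom_comp (r : (𝟙 A ⊠ₚ η) ≫ μ ≅ rightUnitHom A) {x y b a : A} (e : El η pt y)
    (h : x ⟶ b) (p : El μ (x, y) a) :
    rightUnitElHom (evEl r.hom (compEl (x, y) (pairEl (homEl (𝟙 x)) e) p)) ≫ h =
      rightUnitElHom (evEl r.hom (compEl (x, y) (pairEl (homEl h) e) p)) := by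
  refine (congrArg rightUnitElHom (ev_lact r.hom (a := (x, pt)) (a' := (b, pt)) (h, 𝟙 pt)
    (compEl (x, y) (pairEl (homEl (𝟙 x)) e) p))).symm.trans ?_
  exact congrArg₂ (fun e' k => rightUnitElHom (evEl r.hom (compEl (x, y) (pairEl (homEl k) e') p)))
    (lact_one η e) (Category.id_comp h)

end UnitNaturality

section Represent

open MonoidalCategory

variable {A : Prof.{u}} {C : Type u} [SmallCategory C] (ι : (A : Type u)ᵒᵖ ⥤ C)

/-- The presheaf `a ↦ Hom(X, ι a)`. -/
abbrev nervePsh (X : C) : Psh A := ((nerve ι).obj X).unop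

/-- The map of presheaves given by precomposition. -/
abbrev nervePshMap {X Y : C} (f : X ⟶ Y) : nervePsh ι Y ⟶ nervePsh ι X := ((nerve ι).map f).unop

variable {ι}

/-- A morphism `X ⟶ ι a`, as an element of `nervePsh ι X`. -/
def nerveEl {X : C} {a : A} (f : X ⟶ ι.obj (op a)) : (nervePsh ι X).obj (op a) := f

/-- An element of `nervePsh ι X`, as a morphism. -/
def nerveElHom {X : C} {a : A} (f : (nervePsh ι X).obj (op a)) : X ⟶ ι.obj (op a) := f

variable (ι) (F : Pseudomonoid A) [MonoidalCategory C] [(convNerve F ι).Monoidal]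

/-- The comparison of the convolution product with the tensor product of `C`. -/
def tensorIso (X Y : C) : conv F.mul (nervePsh ι X) (nervePsh ι Y) ≅ nervePsh ι (X ⊗ Y) :=
  (Functor.Monoidal.μIso (convNerve F ι) X Y).unop.symm

/-- The comparison of the unit for convolution with the unit of `C`. -/
def unitIso : unitPsh F.one ≅ nervePsh ι (𝟙_ C) :=
  (Functor.Monoidal.εIso (convNerve F ι)).unop.symm

lemma tensorIso_naturality {X X' Y Y' : C} (f : X ⟶ X') (g : Y ⟶ Y') :
    convMap F.mul (nervePshMap ι f) (nervePshMap ι g) ≫ (tensorIso ι F X Y).hom =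
      (tensorIso ι F X' Y').hom ≫ nervePshMap ι (f ⊗ₘ g) :=
  congrArg Quiver.Hom.unop (Functor.OplaxMonoidal.δ_natural (convNerve F ι) f g)

/-- The associativity axiom of the monoidal functor `convNerve F ι`, read in presheaves rather than
in the opposite category. The two unit lemmas below arise in the same way. -/
lemma tensorIso_assoc (X Y Z : C) :
    (convAssoc F.mul F.mul F.assoc (nervePsh ι X) (nervePsh ι Y) (nervePsh ι Z)).hom ≫
      convMap F.mul (𝟙 _) (tensorIso ι F Y Z).hom ≫ (tensorIso ι F X (Y ⊗ Z)).hom ≫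
        nervePshMap ι (α_ X Y Z).hom =
    convMap F.mul (tensorIso ι F X Y).hom (𝟙 _) ≫ (tensorIso ι F (X ⊗ Y) Z).hom := by
  rw [← Iso.eq_inv_comp]
  exact (congrArg Quiver.Hom.unop
    (Functor.OplaxMonoidal.oplax_associativity (convNerve F ι) X Y Z)).symm

lemma tensorIso_leftUnit (X : C) :
    convMap F.mul (unitIso ι F).hom (𝟙 _) ≫ (tensorIso ι F (𝟙_ C) X).hom =
      (convLeftUnit F.leftUnit (nervePsh ι X)).hom ≫ nervePshMap ι (λ_ X).hom := by
  rw [← Iso.inv_comp_eq]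
  exact congrArg Quiver.Hom.unop
    ((Category.assoc _ _ _).trans (Functor.OplaxMonoidal.left_unitality_hom (convNerve F ι) X))

lemma tensorIso_rightUnit (X : C) :
    convMap F.mul (𝟙 _) (unitIso ι F).hom ≫ (tensorIso ι F X (𝟙_ C)).hom =
      (convRightUnit F.rightUnit (nervePsh ι X)).hom ≫ nervePshMap ι (ρ_ X).hom := by
  rw [← Iso.inv_comp_eq]
  exact congrArg Quiver.Hom.unop
    (Functor.OplaxMonoidal.right_unitality_hom (convNerve F ι) X)

variable {F}

/-- The morphism `X ⊗ Y ⟶ ι a` represented by an element of a convolution. -/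
def tensorMk {X Y : C} {a : A} (t : (conv F.mul (nervePsh ι X) (nervePsh ι Y)).obj (op a)) :
    X ⊗ Y ⟶ ι.obj (op a) := (tensorIso ι F X Y).hom.app (op a) t

variable {ι}

lemma tensorMk_comp {X Y : C} {a b : A} (f : b ⟶ a)
    (t : (conv F.mul (nervePsh ι X) (nervePsh ι Y)).obj (op a)) :
    tensorMk ι t ≫ ι.map f.op = tensorMk ι ((conv F.mul _ _).map f.op t) :=
  (ConcreteCategory.congr_hom ((tensorIso ι F X Y).hom.naturality f.op) t).symm

lemma tensorHom_tensorMk {X X' Y Y' : C} {a : A} (f : X ⟶ X') (g : Y ⟶ Y')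
    (t : (conv F.mul (nervePsh ι X') (nervePsh ι Y')).obj (op a)) :
    (f ⊗ₘ g) ≫ tensorMk ι t =
      tensorMk ι ((convMap F.mul (nervePshMap ι f) (nervePshMap ι g)).app (op a) t) :=
  (congrArg (fun k => k.app (op a) t) (tensorIso_naturality ι F f g)).symm

/-- The morphism `ι y ⊗ ι z ⟶ ι x` represented by an element of the multiplication. -/
def mulMk {x y z : A} (m : El F.mul (y, z) x) :
    ι.obj (op y) ⊗ ι.obj (op z) ⟶ ι.obj (op x) :=
  tensorMk ι (cv (nerveEl (𝟙 _)) (nerveEl (𝟙 _)) m)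

/-- The class is the image of the universal one, with identities as presheaf elements, under
precomposition with `f` and `g`; the comparison is natural. -/
lemma tensorMk_cv {X Y : C} {x y z : A} (f : X ⟶ ι.obj (op y)) (g : Y ⟶ ι.obj (op z))
    (m : El F.mul (y, z) x) :
    tensorMk ι (cv (nerveEl f) (nerveEl g) m) = (f ⊗ₘ g) ≫ mulMk m := by
  rw [mulMk, tensorHom_tensorMk, convMap_cv]
  exact congrArg₂ (fun k l => tensorMk ι (cv (nerveEl k) (nerveEl l) m)) (Category.comp_id f).symm
    (Category.comp_id g).symm

lemma mulMk_ract {x x' y z : A} (f : x' ⟶ x) (m : El F.mul (y, z) x) :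
    mulMk (ι := ι) (ract F.mul f m) = mulMk m ≫ ι.map f.op :=
  (tensorMk_comp (ι := ι) f (cv (nerveEl (𝟙 _)) (nerveEl (𝟙 _)) m)).symm

lemma mulMk_lact {x y y' z z' : A} (f : y ⟶ y') (g : z ⟶ z') (m : El F.mul (y, z) x) :
    mulMk (ι := ι) (lact F.mul (a := (y, z)) (a' := (y', z')) (f, g) m) =
      (ι.map f.op ⊗ₘ ι.map g.op) ≫ mulMk m := by
  rw [← tensorMk_cv, mulMk, ← cv_sound]
  exact congrArg₂ (fun k l => tensorMk ι (cv (nerveEl k) (nerveEl l) m)) (Category.id_comp _)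
    (Category.id_comp _)

/-- The map is a composite of bijections: `μ` as a convolution of representables, full faithfulness
of `ι`, and the comparison with the tensor product. -/
lemma mulMk_bijective [ι.Full] [ι.Faithful] (x y z : A) :
    Function.Bijective (fun m : El F.mul (y, z) x => mulMk (ι := ι) m) := by
  have h := (((convYoneda F.mul y z).symm ≪≫ convMapIso F.mul (nerveObjIso y) (nerveObjIso z) ≪≫
      tensorIso ι F _ _).app (op x)).toEquiv.bijective
  have key (m : El F.mul (y, z) x) : mulMk (ι := ι) m =
      (((convYoneda F.mul y z).symm ≪≫ convMapIso F.mul (nerveObjIso y) (nerveObjIso z) ≪≫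
          tensorIso ι F _ _).app (op x)).toEquiv m :=
    congrArg₂ (fun k l => tensorMk ι (cv (nerveEl k) (nerveEl l) m)) (ι.map_id _).symm
      (ι.map_id _).symm
  refine ⟨fun m m' H => h.1 ((key m).symm.trans (H.trans (key m'))), fun f => ?_⟩
  obtain ⟨m, hm⟩ := h.2 f
  exact ⟨m, (key m).trans hm⟩

/-- The morphism `𝟙_ C ⟶ ι x` represented by an element of the unit. -/
def oneMk {x : A} (e : El F.one pt x) : 𝟙_ C ⟶ ι.obj (op x) :=
  (unitIso ι F).hom.app (op x) (unitEl e)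

lemma oneMk_ract {x x' : A} (f : x' ⟶ x) (e : El F.one pt x) :
    oneMk (ι := ι) (ract F.one f e) = oneMk e ≫ ι.map f.op :=
  ConcreteCategory.congr_hom ((unitIso ι F).hom.naturality f.op) e

lemma oneMk_bijective (x : A) : Function.Bijective (fun e : El F.one pt x => oneMk (ι := ι) e) :=
  ((unitIso ι F).app (op x)).toEquiv.bijective

/-- `tensorIso_assoc` evaluated at the universal class for `m` and `n`, with `h` acting on the third
identity. The value of the convolution associator there is what `H` records. -/
lemma mulMk_assoc {b c d a x y x' y' : A} {m : El F.mul (b, c) x} {h : y ⟶ d}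
    {n : El F.mul (x, y) a} {h' : x' ⟶ b} {m' : El F.mul (c, d) y'} {n' : El F.mul (x', y') a}
    (H : AssocRel F.assoc m h n h' m' n') :
    (mulMk m ⊗ₘ ι.map h.op) ≫ mulMk n =
      (α_ (ι.obj (op b)) (ι.obj (op c)) (ι.obj (op d))).hom ≫
        (ι.map h'.op ⊗ₘ mulMk m') ≫ mulMk n' := by
  have h₁ := congrArg (fun k => k.app (op a) (cv (cv (nerveEl (𝟙 _)) (nerveEl (𝟙 _)) m)
    ((nervePsh ι (ι.obj (op d))).map h.op (nerveEl (𝟙 _))) n))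
      (tensorIso_assoc ι F (ι.obj (op b)) (ι.obj (op c)) (ι.obj (op d)))
  have h₂ := convAssoc_hom_cv H (nerveEl (𝟙 (ι.obj (op b)))) (nerveEl (𝟙 (ι.obj (op c))))
    (nerveEl (𝟙 (ι.obj (op d))))
  rw [← tensorMk_cv, ← tensorMk_cv]
  refine Eq.trans ?_ (h₁.symm.trans ?_)
  · exact congrArg (fun k => tensorMk ι (cv (nerveEl (mulMk m)) (nerveEl k) n))
      (Category.id_comp _).symm
  · refine (congrArg (fun k => (α_ (ι.obj (op b)) (ι.obj (op c)) (ι.obj (op d))).hom ≫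
      tensorMk ι ((convMap F.mul (𝟙 _) (tensorIso ι F _ _).hom).app (op a) k)) h₂).trans ?_
    exact congrArg (fun k => (α_ (ι.obj (op b)) (ι.obj (op c)) (ι.obj (op d))).hom ≫
      tensorMk ι (cv (nerveEl k) (nerveEl (mulMk m')) n')) (Category.id_comp _)

lemma mulMk_leftUnit {b a x y : A} (e : El F.one pt x) (h : y ⟶ b) (n : El F.mul (x, y) a) :
    (oneMk e ⊗ₘ ι.map h.op) ≫ mulMk n = (λ_ (ι.obj (op b))).hom ≫
      ι.map (leftUnitElHom (evEl F.leftUnit.hom (compEl (x, y) (pairEl e (homEl h)) n))).op := by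
  rw [← tensorMk_cv]
  have h₁ := congrArg (fun k => k.app (op a) (cv (unitEl e) (nerveEl (ι.map h.op)) n))
    (tensorIso_leftUnit ι F (ι.obj (op b)))
  refine h₁.trans ?_
  refine (congrArg (fun k => (λ_ (ι.obj (op b))).hom ≫ nerveElHom k)
    (convLeftUnit_hom_cv F.leftUnit e (nerveEl (ι.map h.op)) n)).trans ?_
  refine congrArg (fun k => (λ_ (ι.obj (op b))).hom ≫ k) ?_
  refine (ι.map_comp _ _).symm.trans (congrArg ι.map (congrArg Quiver.Hom.op ?_))
  exact leftUnitElHom_comp F.leftUnit e h n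

lemma mulMk_rightUnit {b a x y : A} (h : x ⟶ b) (e : El F.one pt y) (n : El F.mul (x, y) a) :
    (ι.map h.op ⊗ₘ oneMk e) ≫ mulMk n = (ρ_ (ι.obj (op b))).hom ≫
      ι.map (rightUnitElHom (evEl F.rightUnit.hom (compEl (x, y) (pairEl (homEl h) e) n))).op := by
  rw [← tensorMk_cv]
  have h₁ := congrArg (fun k => k.app (op a) (cv (nerveEl (ι.map h.op)) (unitEl e) n))
    (tensorIso_rightUnit ι F (ι.obj (op b)))
  refine h₁.trans ?_
  refine (congrArg (fun k => (ρ_ (ι.obj (op b))).hom ≫ nerveElHom k)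
    (convRightUnit_hom_cv F.rightUnit e (nerveEl (ι.map h.op)) n)).trans ?_
  refine congrArg (fun k => (ρ_ (ι.obj (op b))).hom ≫ k) ?_
  refine (ι.map_comp _ _).symm.trans (congrArg ι.map (congrArg Quiver.Hom.op ?_))
  exact rightUnitElHom_comp F.rightUnit e h n

/-- A 2-cell whose components are bijective is invertible. -/
noncomputable def isoOfBijective {X Y : Prof.{u}} {P Q : X ⟶ Y} (φ : P ⟶ Q)
    (h : ∀ (a : X) (b : Y), Function.Bijective (fun x : El P a b => evEl φ x)) : P ≅ Q :=
  isoMk φ (fun a b => (Equiv.ofBijective _ (h a b)).symm)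
    (fun a b => (Equiv.ofBijective _ (h a b)).symm_apply_apply)
    (fun a b => (Equiv.ofBijective _ (h a b)).apply_symm_apply)

variable (ι F)

/-- The tensor product represents the multiplication. -/
noncomputable def mulIso [ι.Full] [ι.Faithful] : F.mul ≅ tensorRep ι :=
  isoOfBijective
    (homMk (P := F.mul) (Q := tensorRep ι) (fun _ _ m => mulMk m)
      (fun {_ _} f {_} m => mulMk_lact f.1 f.2 m) (fun f m => mulMk_ract f m))
    (fun a b => mulMk_bijective b a.1 a.2)

/-- The unit object represents the unit. -/
noncomputable def oneIso : F.one ≅ unitRep ι :=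
  isoOfBijective
    (homMk (P := F.one) (Q := unitRep ι) (fun _ _ e => oneMk e)
      (fun {a a'} f {b} e => by
        obtain rfl : a = a' := Subsingleton.elim _ _
        obtain rfl : f = 𝟙 _ := Subsingleton.elim _ _
        exact (congrArg oneMk (lact_one F.one e)).trans
          (lact_id (unitRep ι) (oneMk e)).symm)
      (fun f e => oneMk_ract f e))
    (fun _ b => oneMk_bijective b)

end Represent

end Prof

/-- A retract, from maps whose composite is invertible. -/
noncomputable def CategoryTheory.Retract.ofIsIso {D : Type*} [Category D] {X Y : D}
    (i : X ⟶ Y) (r : Y ⟶ X) (h : IsIso (i ≫ r)) : Retract X Y where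
  i := i
  r := r ≫ inv (i ≫ r)
  retract := by rw [← Category.assoc, IsIso.hom_inv_id]

/-! ### Contractions, and the equivalence of presheaves with copresheaves. -/

namespace Prof

section Tens

variable {A B : Type u} [SmallCategory A] [SmallCategory B]

/-- The coend `∫ᵇ M b × G b`, as a bifunctor. -/
def tens : (Bᵒᵖ ⥤ Type u) ⥤ (B ⥤ Type u) ⥤ Type u where
  obj M :=
    { obj := fun G => Tens M G
      map := fun ψ => ↾(Tens.lift (fun b x y => Tens.mk b x (ψ.app b y))
        (fun f x y => (Tens.sound f x _).trans
          (congrArg (Tens.mk _ x) (ConcreteCategory.congr_hom (ψ.naturality f) y).symm)))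
      map_id := fun G => by
        ext t; induction t using Tens.ind; rfl
      map_comp := fun φ ψ => by
        ext t; induction t using Tens.ind; rfl }
  map φ :=
    { app := fun G => ↾(Tens.lift (fun b x y => Tens.mk b (φ.app (op b) x) y)
        (fun f x y => (congrArg (fun k => Tens.mk _ k y)
          (ConcreteCategory.congr_hom (φ.naturality f.op) x)).trans (Tens.sound f _ y)))
      naturality := fun G G' ψ => by
        ext t; induction t using Tens.ind; rfl }
  map_id M := by
    ext G t; induction t using Tens.ind; rfl
  map_comp φ ψ := by
    ext G t; induction t using Tens.ind; rfl

/-- The functor `M ↦ ∫ᵇ M b × S(-, b)`. -/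
def tensRight (S : A ⥤ B ⥤ Type u) : (Bᵒᵖ ⥤ Type u) ⥤ (A ⥤ Type u) :=
  tens ⋙ (Functor.whiskeringLeft A (B ⥤ Type u) (Type u)).obj S

/-- The functor `L ↦ ∫ᵃ K(-, a) × L a`. -/
def tensLeft (K : Bᵒᵖ ⥤ Aᵒᵖ ⥤ Type u) : (A ⥤ Type u) ⥤ (Bᵒᵖ ⥤ Type u) :=
  tens.flip ⋙ (Functor.whiskeringLeft Bᵒᵖ (Aᵒᵖ ⥤ Type u) (Type u)).obj K

/-- An element of `tensRight S`. -/
def rmk {S : A ⥤ B ⥤ Type u} {M : Bᵒᵖ ⥤ Type u} {x : A} {y : B} (m : M.obj (op y))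
    (s : (S.obj x).obj y) : ((tensRight S).obj M).obj x := Tens.mk y m s

/-- An element of `tensLeft K`. -/
def lmk {K : Bᵒᵖ ⥤ Aᵒᵖ ⥤ Type u} {L : A ⥤ Type u} {x : A} {y : B}
    (k : (K.obj (op y)).obj (op x)) (l : L.obj x) : ((tensLeft K).obj L).obj (op y) := Tens.mk x k l

section
variable {S : A ⥤ B ⥤ Type u} {M : Bᵒᵖ ⥤ Type u} {K : Bᵒᵖ ⥤ Aᵒᵖ ⥤ Type u} {L : A ⥤ Type u}

@[elab_as_elim]
lemma rmk_ind {x : A} {motive : ((tensRight S).obj M).obj x → Prop}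
    (h : ∀ (y : B) (m : M.obj (op y)) (s : (S.obj x).obj y), motive (rmk m s)) (t) : motive t :=
  Tens.ind h t

@[elab_as_elim]
lemma lmk_ind {y : B} {motive : ((tensLeft K).obj L).obj (op y) → Prop}
    (h : ∀ (x : A) (k : (K.obj (op y)).obj (op x)) (l : L.obj x), motive (lmk k l)) (t) :
    motive t :=
  Tens.ind h t

lemma rmk_sound {x : A} {y y' : B} (g : y ⟶ y') (m : M.obj (op y')) (s : (S.obj x).obj y) :
    rmk (M.map g.op m) s = rmk m ((S.obj x).map g s) := Tens.sound g m s

lemma lmk_sound {y : B} {x x' : A} (f : x ⟶ x') (k : (K.obj (op y)).obj (op x')) (l : L.obj x) :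
    lmk ((K.obj (op y)).map f.op k) l = lmk k (L.map f l) := Tens.sound f k l

/-- Maps out of the elements of `tensRight S`. -/
def rlift {T : Sort*} {x : A} (φ : ∀ y, M.obj (op y) → (S.obj x).obj y → T)
    (h : ∀ {y y' : B} (g : y ⟶ y') (m : M.obj (op y')) (s : (S.obj x).obj y),
      φ y (M.map g.op m) s = φ y' m ((S.obj x).map g s)) : ((tensRight S).obj M).obj x → T :=
  Tens.lift φ h

/-- Maps out of the elements of `tensLeft K`. -/
def llift {T : Sort*} {y : B} (φ : ∀ x, (K.obj (op y)).obj (op x) → L.obj x → T)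
    (h : ∀ {x x' : A} (f : x ⟶ x') (k : (K.obj (op y)).obj (op x')) (l : L.obj x),
      φ x ((K.obj (op y)).map f.op k) l = φ x' k (L.map f l)) :
    ((tensLeft K).obj L).obj (op y) → T :=
  Tens.lift φ h

end

/-- A contraction of a two-variable presheaf with a two-variable copresheaf to the
hom-functor, which exhibits the latter as the coend of their product. -/
structure Contraction (K : Bᵒᵖ ⥤ Aᵒᵖ ⥤ Type u) (S : A ⥤ B ⥤ Type u) where
  /-- The contraction. -/
  hom {y y' : B} {x : A} : (K.obj (op y)).obj (op x) → (S.obj x).obj y' → (y ⟶ y')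
  map_left {z y y' : B} {x : A} (g : z ⟶ y) (k : (K.obj (op y)).obj (op x))
    (s : (S.obj x).obj y') : hom ((K.map g.op).app (op x) k) s = g ≫ hom k s
  map_right {y y' z : B} {x : A} (g : y' ⟶ z) (k : (K.obj (op y)).obj (op x))
    (s : (S.obj x).obj y') : hom k ((S.obj x).map g s) = hom k s ≫ g
  dinatural {y y' : B} {x x' : A} (f : x ⟶ x') (k : (K.obj (op y)).obj (op x'))
    (s : (S.obj x).obj y') : hom ((K.obj (op y)).map f.op k) s = hom k ((S.map f).app y' s)
  exact {y y' : B} {x x' : A} (k : (K.obj (op y)).obj (op x)) (s : (S.obj x).obj y')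
    (k' : (K.obj (op y)).obj (op x')) (s' : (S.obj x').obj y') : hom k s = hom k' s' →
      lmk (L := S.flip.obj y') k s = lmk (L := S.flip.obj y') k' s'
  exists_id (y : B) : ∃ (x : A) (k : (K.obj (op y)).obj (op x)) (s : (S.obj x).obj y), hom k s = 𝟙 y

variable {K : Bᵒᵖ ⥤ Aᵒᵖ ⥤ Type u} {S : A ⥤ B ⥤ Type u}

namespace Contraction

variable (κ : Contraction K S)

/-- The map `∫ᵃ K(y, a) × ∫ᵇ M b × S(a, b) ⟶ M y` given by contraction. -/
def collapse (M : Bᵒᵖ ⥤ Type u) (y : B) :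
    ((tensLeft K).obj ((tensRight S).obj M)).obj (op y) → M.obj (op y) :=
  llift (fun x k => rlift (fun y' m s => M.map (κ.hom k s).op m) (fun g m s => by
      rw [κ.map_right, op_comp, M.map_comp]; rfl))
    (fun f k t => by
      induction t using rmk_ind with
      | h y' m s => exact congrArg (fun g => M.map (Quiver.Hom.op g) m) (κ.dinatural f k s))

/-- A pair with `κ.hom k₀ s₀ = 𝟙 y` gives the inverse `m ↦ k₀ ⊗ m ⊗ s₀`. That this is a left inverse
is injectivity of the contraction on classes, which is the field `exact`. -/
lemma collapse_bijective (M : Bᵒᵖ ⥤ Type u) (y : B) : Function.Bijective (κ.collapse M y) := by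
  obtain ⟨x₀, k₀, s₀, h₀⟩ := κ.exists_id y
  refine Function.bijective_iff_has_inverse.2 ⟨fun m => lmk k₀ (rmk m s₀), fun t => ?_, fun m => ?_⟩
  · induction t using lmk_ind with
    | h x k t =>
      induction t using rmk_ind with
      | h y' m s =>
        -- Both pairs contract to `κ.hom k s`. Inserting `m` into the resulting equality of classes
        -- gives an equality in the double coend.
        have h := κ.exact k₀ ((S.obj x₀).map (κ.hom k s) s₀) k s
          ((κ.map_right _ _ _).trans (by rw [h₀, Category.id_comp]))
        have h' := congrArg (llift (K := K) (L := S.flip.obj y') (y := y)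
          (fun x k s => lmk (L := (tensRight S).obj M) k (rmk m s))
          (fun f k s => lmk_sound (L := (tensRight S).obj M) f k (rmk m s))) h
        exact (congrArg (lmk k₀) (rmk_sound (S := S) (κ.hom k s) m s₀)).trans h'
  · change M.map (κ.hom k₀ s₀).op m = m
    rw [h₀]
    exact M.map_id_apply _ _

/-- The isomorphism given by contraction. -/
noncomputable def collapseIso : tensRight S ⋙ tensLeft K ≅ 𝟭 (Bᵒᵖ ⥤ Type u) :=
  NatIso.ofComponents
    (fun M => NatIso.ofComponents
      (fun y => (Equiv.ofBijective _ (κ.collapse_bijective M y.unop)).toIso)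
      (fun {y y'} g => by
        ext t
        induction t using lmk_ind (y := y.unop) with
        | h x k t =>
          induction t using rmk_ind with
          | h z m s =>
            exact (congrArg (fun k => M.map (Quiver.Hom.op k) m) (κ.map_left g.unop k s)).trans
              (by rw [op_comp, M.map_comp]; rfl)))
    (fun {M M'} φ => by
      ext y t
      induction t using lmk_ind (y := y.unop) with
      | h x k t =>
        induction t using rmk_ind with
        | h z m s => exact (ConcreteCategory.congr_hom (φ.naturality (κ.hom k s).op) m).symm)

section Duality

variable (κ : Contraction K S) (κ' : Contraction K.flip S.flip)

/-- The map `∫ᵇ (∫ᵃ K(b, a) × L a) × S(x, b) ⟶ L x` given by contraction. -/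
def cocollapse (L : A ⥤ Type u) (x : A) :
    ((tensRight S).obj ((tensLeft K).obj L)).obj x → L.obj x :=
  rlift (fun y t s => llift (fun x' k l => L.map (κ'.hom (y := x') k s) l) (fun f k l => by
      refine (congrArg (fun g => L.map g l) (κ'.map_left f k s)).trans ?_
      rw [L.map_comp]; rfl) t)
    (fun g t s => by
      induction t using lmk_ind with
      | h x' k l => exact congrArg (fun g => L.map g l) (κ'.dinatural g k s))

/-- The mirror image of `collapse_bijective`: the second contraction `κ'` collapses the coend over
the other variable. -/
lemma cocollapse_bijective (L : A ⥤ Type u) (x : A) :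
    Function.Bijective (cocollapse κ' L x) := by
  obtain ⟨y₀, k₀, s₀, h₀⟩ := κ'.exists_id x
  refine Function.bijective_iff_has_inverse.2
    ⟨fun l => rmk (lmk (y := y₀) k₀ l) s₀, fun t => ?_, fun l => ?_⟩
  · induction t using rmk_ind with
    | h y t s =>
      induction t using lmk_ind with
      | h x' k l =>
        have h := κ'.exact ((K.flip.map (κ'.hom (y := x') k s).op).app (op y₀) k₀) s₀ k s
          ((κ'.map_left _ _ _).trans (by rw [h₀, Category.comp_id]))
        have h' := congrArg (llift (K := K.flip) (L := S.flip.flip.obj x) (y := x')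
          (fun y k s => rmk (S := S) (M := (tensLeft K).obj L) (y := y)
            (lmk (y := y) (x := x') k l) s)
          (fun f k s => rmk_sound (S := S) (M := (tensLeft K).obj L) f (lmk k l) s)) h
        exact (congrArg (fun t => rmk (S := S) (M := (tensLeft K).obj L) (y := y₀) t s₀)
          (lmk_sound (K := K) (y := y₀) (κ'.hom (y := x') k s) k₀ l).symm).trans h'
  · change L.map (κ'.hom k₀ s₀) l = l
    rw [h₀]
    exact L.map_id_apply _ _

/-- The isomorphism given by contraction. -/
noncomputable def cocollapseIso : tensLeft K ⋙ tensRight S ≅ 𝟭 (A ⥤ Type u) :=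
  NatIso.ofComponents
    (fun L => NatIso.ofComponents
      (fun x => (Equiv.ofBijective _ (cocollapse_bijective κ' L x)).toIso)
      (fun {x x'} g => by
        ext t
        induction t using rmk_ind (x := x) with
        | h y t s =>
          induction t using lmk_ind with
          | h z k l =>
            exact (congrArg (fun k => L.map k l) (κ'.map_right g k s)).trans
              (by rw [L.map_comp]; rfl)))
    (fun {L L'} φ => by
      ext x t
      induction t using rmk_ind (x := x) with
      | h y t s =>
        induction t using lmk_ind with
        | h z k l => exact (ConcreteCategory.congr_hom (φ.naturality (κ'.hom (y := z) k s)) l).symm)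

/-- Two contractions make presheaves and copresheaves equivalent. -/
noncomputable def equivalence : (Bᵒᵖ ⥤ Type u) ≌ (A ⥤ Type u) :=
  CategoryTheory.Equivalence.mk (tensRight S) (tensLeft K) κ.collapseIso.symm
    (cocollapseIso κ' : tensLeft K ⋙ tensRight S ≅ 𝟭 (A ⥤ Type u))

/-- The copresheaves `S(-, y)` are retracts of corepresentable ones. -/
lemma exists_retract_coyoneda (κ : Contraction K S) (κ' : Contraction K.flip S.flip) (y : B) :
    ∃ x : A, Nonempty (Retract (S.flip.obj y) (coyoneda.obj (op x))) := by
  obtain ⟨x₀, k₀, s₀, h₀⟩ := κ.exists_id y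
  let i : S.flip.obj y ⟶ coyoneda.obj (op x₀) :=
    { app := fun x => ↾(fun s : (S.obj x).obj y => κ'.hom (y := x₀) (y' := x) (x := y) k₀ s)
      naturality := fun x x' f => by
        ext s
        exact κ'.map_right (y := x₀) f k₀ s }
  let r : coyoneda.obj (op x₀) ⟶ S.flip.obj y := coyonedaEquiv.symm s₀
  -- By `κ`, the inner coend `∫ᵃ K(z, a) × S(a, y)` is `Hom(z, y)`, with the class of `(k₀, s₀)`
  -- corresponding to `𝟙 y`. The map is therefore the co-Yoneda bijection.
  have hj (x : A) : Function.Bijective (fun s : (S.obj x).obj y =>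
      (rmk (S := S) (M := (tensLeft K).obj (S.flip.obj y)) (lmk k₀ s₀) s)) := by
    refine Function.bijective_iff_has_inverse.2
      ⟨rlift (fun z t s => llift (fun a k l => (S.obj x).map (κ.hom (x := a) k l) s)
          (fun f k l => congrArg (fun g => (S.obj x).map g s) (κ.dinatural f k l)) t)
        (fun g t s => by
          induction t using lmk_ind with
          | h a k l =>
            refine (congrArg (fun g => (S.obj x).map g s) (κ.map_left (x := a) g k l)).trans ?_
            rw [(S.obj x).map_comp]; rfl), fun s => ?_, fun t => ?_⟩
    · change (S.obj x).map (κ.hom k₀ s₀) s = s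
      rw [h₀]
      exact (S.obj x).map_id_apply _ _
    · induction t using rmk_ind with
      | h z t s =>
        induction t using lmk_ind with
        | h a k l =>
          refine (rmk_sound (S := S) (M := (tensLeft K).obj (S.flip.obj y)) (κ.hom (x := a) k l)
            (lmk k₀ s₀) s).symm.trans (congrArg (fun t => rmk t s) ?_)
          exact κ.exact ((K.map (κ.hom (x := a) k l).op).app (op x₀) k₀) s₀ k l
            ((κ.map_left _ _ _).trans (by rw [h₀, Category.comp_id]))
  -- At `s` the composite is `S(κ'(k₀, s)) s₀`, the value of `cocollapse` at the class treated in
  -- `hj`. It need not be the identity, since `κ` and `κ'` are unrelated.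
  have : ∀ x, IsIso ((i ≫ r).app x) := fun x =>
    (isIso_iff_bijective _).2 ((cocollapse_bijective κ' (S.flip.obj y) x).comp (hj x))
  exact ⟨x₀, ⟨Retract.ofIsIso i r (NatIso.isIso_of_isIso_app _)⟩⟩

/-- The presheaves `K(-, x)` are retracts of representable ones. -/
lemma exists_retract_yoneda (κ : Contraction K S) (κ' : Contraction K.flip S.flip) (x : A) :
    ∃ y : B, Nonempty (Retract (K.flip.obj (op x)) (yoneda.obj y)) := by
  obtain ⟨y₀, k₀, s₀, h₀⟩ := κ'.exists_id x
  let i : K.flip.obj (op x) ⟶ yoneda.obj y₀ :=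
    { app := fun y => ↾(fun k : (K.obj y).obj (op x) => κ.hom (y := y.unop) (y' := y₀) (x := x) k
        s₀)
      naturality := fun y y' f => by
        ext k
        exact κ.map_left (y := y.unop) f.unop k s₀ }
  let r : yoneda.obj y₀ ⟶ K.flip.obj (op x) := yonedaEquiv.symm k₀
  -- Dually, `κ'` identifies `∫ᵇ K(b, x) × S(a, b)` with `Hom(x, a)`, the class of `(k₀, s₀)`
  -- corresponding to `𝟙 x`.
  have hj (y : B) : Function.Bijective (fun k : (K.obj (op y)).obj (op x) =>
      (lmk (K := K) (L := (tensRight S).obj (K.flip.obj (op x))) k (rmk k₀ s₀))) := by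
    refine Function.bijective_iff_has_inverse.2
      ⟨llift (fun a k t => rlift
          (fun z m s => (K.obj (op y)).map (κ'.hom (y := x) (y' := a) (x := z) m s).op k)
          (fun g m s => congrArg (fun g => (K.obj (op y)).map (Quiver.Hom.op g) k)
            (κ'.dinatural g m s)) t)
        (fun f k t => by
          induction t using rmk_ind with
          | h z m s =>
            refine Eq.trans ?_ (congrArg (fun g => (K.obj (op y)).map (Quiver.Hom.op g) k)
              (κ'.map_right f m s)).symm
            rw [op_comp, (K.obj (op y)).map_comp]; rfl), fun k => ?_, fun t => ?_⟩
    · change (K.obj (op y)).map (κ'.hom k₀ s₀).op k = k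
      rw [h₀]
      exact (K.obj (op y)).map_id_apply _ _
    · induction t using lmk_ind with
      | h a k t =>
        induction t using rmk_ind with
        | h z m s =>
          refine (lmk_sound (K := K) (L := (tensRight S).obj (K.flip.obj (op x)))
            (κ'.hom (y := x) (y' := a) (x := z) m s) k (rmk k₀ s₀)).trans
              (congrArg (fun t => lmk k t) ?_)
          have h := κ'.exact k₀ ((S.map (κ'.hom (y := x) (y' := a) (x := z) m s)).app y₀ s₀) m s
            ((κ'.map_right _ _ _).trans (by rw [h₀, Category.id_comp]))
          exact h
  -- The composite sends `k` to `K(κ(k, s₀)) k₀`, which is `collapse` after the bijection `hj`.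
  have : ∀ y, IsIso ((i ≫ r).app y) := fun y =>
    (isIso_iff_bijective _).2 ((κ.collapse_bijective (K.flip.obj (op x)) y.unop).comp (hj y.unop))
  exact ⟨y₀, ⟨Retract.ofIsIso i r (NatIso.isIso_of_isIso_app _)⟩⟩

end Duality

end Contraction

end Tens

end Prof

/-! ### The contractions given by a biexact pairing. -/

namespace Prof

open Bicategory

section Pairing

variable {A : Prof.{u}} (σ : tensorObj A A ⟶ unitObj) (c : unitObj ⟶ tensorObj A A)

/-- A form, as a functor of two variables. -/
def formCurry : (A : Type u) ⥤ (A : Type u) ⥤ Type u :=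
  Functor.curry.obj ((Functor.flip (C := tensorObj A A)
    (D := (unitObj.{u} : Type u)ᵒᵖ) (E := Type u) σ).obj (op pt))

/-- A coevaluation, as a presheaf of two variables. -/
def coevalCurry : (A : Type u)ᵒᵖ ⥤ (A : Type u)ᵒᵖ ⥤ Type u :=
  Functor.curry.obj ((prodOpEquiv (A : Type u)).inverse ⋙ Functor.obj
    (C := (unitObj.{u} : Type u)) (D := Psh (tensorObj A A)) c pt)

/-- The profunctor `(((y, x), y'), z) ↦ Hom(z, y) × σ(x, y')`. -/
def zigRight : tensorObj (tensorObj A A) A ⟶ A :=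
  assocRestr (Profunctor.whiskerLeft₂ (𝟙 A ⊠ₚ σ) (𝟭 _) (CategoryTheory.Prod.sectL (A : Type u) pt))

/-- The right zig-zag composite, with its constraint 1-cells removed. -/
def zigzagRightIso :
    leftUnitInv A ≫ (c ⊠ₚ 𝟙 A) ≫ assocHom A A A ≫ (𝟙 A ⊠ₚ σ) ≫ rightUnitHom A ≅
      CategoryTheory.Prod.sectR pt (A : Type u) ⋙ ((c ⊠ₚ 𝟙 A) ≫ zigRight σ) :=
  Bicategory.whiskerLeftIso _ (Bicategory.whiskerLeftIso _
    (Bicategory.whiskerLeftIso _ (companionRightIso (𝟙 A ⊠ₚ σ) (sectLAdj A)) ≪≫ assocRestrIso _)) ≪≫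
  companionLeftIso (CategoryTheory.Prod.sectR pt (A : Type u)) ((c ⊠ₚ 𝟙 A) ≫ zigRight σ)

/-- The profunctor `((x, (y, x')), z) ↦ σ(x, y) × Hom(z, x')`. -/
def zigLeft : tensorObj A (tensorObj A A) ⟶ A :=
  prod.inverseAssociator A A A ⋙
    Profunctor.whiskerLeft₂ (σ ⊠ₚ 𝟙 A) (𝟭 _) (CategoryTheory.Prod.sectR pt (A : Type u))

/-- The left zig-zag composite, with its constraint 1-cells removed. -/
def zigzagLeftIso :
    rightUnitInv A ≫ (𝟙 A ⊠ₚ c) ≫ assocInv A A A ≫ (σ ⊠ₚ 𝟙 A) ≫ leftUnitHom A ≅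
      CategoryTheory.Prod.sectL (A : Type u) pt ⋙ ((𝟙 A ⊠ₚ c) ≫ zigLeft σ) :=
  Bicategory.whiskerLeftIso _ (Bicategory.whiskerLeftIso _
    (Bicategory.whiskerLeftIso _ (companionRightIso (σ ⊠ₚ 𝟙 A) (sectRAdj A)) ≪≫
      companionLeftIso (prod.inverseAssociator A A A) _)) ≪≫
  companionLeftIso (CategoryTheory.Prod.sectL (A : Type u) pt) ((𝟙 A ⊠ₚ c) ≫ zigLeft σ)

variable {σ c}

lemma lact_lact_form {x x' x'' y y' y'' : A} (f : x ⟶ x') (f' : x' ⟶ x'') (g : y ⟶ y')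
    (g' : y' ⟶ y'') (s : El σ (x, y) pt) :
    lact σ (a := (x', y')) (a' := (x'', y'')) (f', g')
      (lact σ (a := (x, y)) (a' := (x', y')) (f, g) s) =
    lact σ (a := (x, y)) (a' := (x'', y'')) (f ≫ f', g ≫ g') s :=
  (lact_comp σ (a := (x, y)) (a' := (x', y')) (a'' := (x'', y'')) (f, g) (f', g') s).symm

lemma ract_ract_coeval {x x' x'' y y' y'' : A} (f : x' ⟶ x) (f' : x'' ⟶ x') (g : y' ⟶ y)
    (g' : y'' ⟶ y') (k : El c pt (x, y)) :
    ract c (b := (x', y')) (b' := (x'', y'')) (f', g')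
      (ract c (b := (x, y)) (b' := (x', y')) (f, g) k) =
    ract c (b := (x, y)) (b' := (x'', y'')) (f' ≫ f, g' ≫ g) k :=
  (ract_comp c (b := (x, y)) (b' := (x', y')) (b'' := (x'', y'')) (f, g) (f', g') k).symm

lemma lact_form_id {x y : A} (s : El σ (x, y) pt) :
    lact σ (a := (x, y)) (a' := (x, y)) (𝟙 x, 𝟙 y) s = s := lact_id σ s

lemma ract_coeval_id {x y : A} (k : El c pt (x, y)) :
    ract c (b := (x, y)) (b' := (x, y)) (𝟙 x, 𝟙 y) k = k := ract_id c k

/-- An element of the right zig-zag composite. -/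
def zigEl {x y w y' z : A} (k : El c pt (y, x)) (f : w ⟶ y') (h : z ⟶ y) (s : El σ (x, w) pt) :
    El (CategoryTheory.Prod.sectR pt (A : Type u) ⋙ ((c ⊠ₚ 𝟙 A) ≫ zigRight σ) : A ⟶ A) y' z :=
  cmk (P := c ⊠ₚ 𝟙 A) (Q := zigRight σ) (a := (pt, y')) ((y, x), w) (k, f) (h, s)

/-- The coend relation in all three bound variables at once; the next three lemmas move a single
morphism. -/
lemma zigEl_sound {x x' y₁ y₂ w w' y' z : A} (a : y₁ ⟶ y₂) (b : x ⟶ x') (d : w ⟶ w')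
    (k : El c pt (y₂, x')) (f : w' ⟶ y') (h : z ⟶ y₁) (s : El σ (x, w) pt) :
    zigEl (ract c (b := (y₂, x')) (b' := (y₁, x)) (a, b) k) (d ≫ f) h s =
      zigEl k f (h ≫ a) (lact σ (a := (x, w)) (a' := (x', w')) (b, d) s) :=
  csound (P := c ⊠ₚ 𝟙 A) (Q := zigRight σ) (a := (pt, y')) (b := ((y₁, x), w))
    (b' := ((y₂, x'), w')) ((a, b), d) (k, f) (h, s)

lemma zigEl_ract_left {x y₁ y₂ w y' z : A} (a : y₁ ⟶ y₂) (k : El c pt (y₂, x)) (f : w ⟶ y')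
    (h : z ⟶ y₁) (s : El σ (x, w) pt) :
    zigEl (ract c (b := (y₂, x)) (b' := (y₁, x)) (a, 𝟙 x) k) f h s = zigEl k f (h ≫ a) s := by
  have h := zigEl_sound a (𝟙 x) (𝟙 w) k f h s
  rwa [Category.id_comp, lact_form_id] at h

lemma zigEl_ract_right {x x' y w y' z : A} (b : x ⟶ x') (k : El c pt (y, x')) (f : w ⟶ y')
    (h : z ⟶ y) (s : El σ (x, w) pt) :
    zigEl (ract c (b := (y, x')) (b' := (y, x)) (𝟙 y, b) k) f h s =
      zigEl k f h (lact σ (a := (x, w)) (a' := (x', w)) (b, 𝟙 w) s) := by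
  have h := zigEl_sound (𝟙 y) b (𝟙 w) k f h s
  rwa [Category.id_comp, Category.comp_id] at h

lemma zigEl_lact {x y w w' y' z : A} (d : w ⟶ w') (k : El c pt (y, x)) (f : w' ⟶ y')
    (h : z ⟶ y) (s : El σ (x, w) pt) :
    zigEl k f h (lact σ (a := (x, w)) (a' := (x, w')) (𝟙 x, d) s) = zigEl k (d ≫ f) h s := by
  have h := zigEl_sound (𝟙 y) (𝟙 x) d k f h s
  rw [ract_coeval_id, Category.comp_id] at h
  exact h.symm

lemma ract_zigEl {x y w y' z z' : A} (g : z' ⟶ z) (k : El c pt (y, x)) (f : w ⟶ y') (h : z ⟶ y)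
    (s : El σ (x, w) pt) :
    ract (CategoryTheory.Prod.sectR pt (A : Type u) ⋙ ((c ⊠ₚ 𝟙 A) ≫ zigRight σ) : A ⟶ A)
      (a := y') g (zigEl k f h s) = zigEl k f (g ≫ h) s :=
  congrArg (fun s => zigEl k f (g ≫ h) s) (ract_id σ s)

lemma lact_zigEl {x y w y' y'' z : A} (g : y' ⟶ y'') (k : El c pt (y, x)) (f : w ⟶ y')
    (h : z ⟶ y) (s : El σ (x, w) pt) :
    lact (CategoryTheory.Prod.sectR pt (A : Type u) ⋙ ((c ⊠ₚ 𝟙 A) ≫ zigRight σ) : A ⟶ A)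
      g (b := z) (zigEl k f h s) = zigEl k (f ≫ g) h s :=
  congrArg (fun k => zigEl k (f ≫ g) h s) (lact_id c k)

/-- The right zig-zag composite as a coend in one variable. -/
def zigTens {y' z : A} :
    El (CategoryTheory.Prod.sectR pt (A : Type u) ⋙ ((c ⊠ₚ 𝟙 A) ≫ zigRight σ) : A ⟶ A) y' z →
      ((tensLeft (coevalCurry c)).obj ((formCurry σ).flip.obj y')).obj (op z) :=
  clift (P := c ⊠ₚ 𝟙 A) (Q := zigRight σ) (a := (pt, y'))
    (fun b p q => lmk (K := coevalCurry c) (L := (formCurry σ).flip.obj y') (x := b.1.2)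
      (ract c (b := b.1) (b' := (z, b.1.2)) (q.1, 𝟙 b.1.2) p.1)
      (lact σ (a := (b.1.2, b.2)) (a' := (b.1.2, y')) (𝟙 b.1.2, p.2) q.2))
    (fun {b b'} g p q => by
      -- Only the variable shared by the coevaluation and the form remains bound, so the relation
      -- along `g` becomes the relation along `g.1.2`; `g.1.1` and `g.2` are absorbed into the two
      -- factors.
      have h := lmk_sound (K := coevalCurry c) (L := (formCurry σ).flip.obj y') g.1.2
        (ract c (b := b'.1) (b' := (z, b'.1.2)) (q.1 ≫ g.1.1, 𝟙 b'.1.2) p.1)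
        (lact σ (a := (b.1.2, b.2)) (a' := (b.1.2, y')) (𝟙 b.1.2, g.2 ≫ p.2) q.2)
      refine Eq.trans ?_ (h.trans ?_)
      · refine congrArg (fun k => lmk (K := coevalCurry c) (L := (formCurry σ).flip.obj y')
          (x := b.1.2) k _) ?_
        refine (ract_ract_coeval g.1.1 q.1 g.1.2 (𝟙 _) p.1).trans (Eq.trans ?_
          (ract_ract_coeval (q.1 ≫ g.1.1) (𝟙 z) (𝟙 _) g.1.2 p.1).symm)
        rw [Category.id_comp]
        exact congrArg₂ (fun k l => ract c (b := b'.1) (b' := (z, b.1.2)) (k, l) p.1)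
          (Category.id_comp _).symm (Category.comp_id _).symm
      · refine congrArg (fun k => lmk (K := coevalCurry c) (L := (formCurry σ).flip.obj y')
          (x := b'.1.2) _ k) ?_
        refine (lact_lact_form (𝟙 _) g.1.2 (g.2 ≫ p.2) (𝟙 _) q.2).trans (Eq.trans ?_
          (lact_lact_form g.1.2 (𝟙 _) g.2 p.2 q.2).symm)
        rw [Category.id_comp, Category.comp_id, Category.comp_id])

lemma zigTens_zigEl {x y z : A} (k : El c pt (z, x)) (s : El σ (x, y) pt) :
    zigTens (zigEl k (𝟙 y) (𝟙 z) s) =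
      lmk (K := coevalCurry c) (L := (formCurry σ).flip.obj y) k s :=
  congrArg₂ (fun k s => lmk (K := coevalCurry c) (L := (formCurry σ).flip.obj y) k s)
    (ract_coeval_id k) (lact_form_id s)

/-- The two hom-components are absorbed into the coevaluation and the form by the coend relation. -/
lemma exists_zigEl {y z : A} (t : El (CategoryTheory.Prod.sectR pt (A : Type u) ⋙
    ((c ⊠ₚ 𝟙 A) ≫ zigRight σ) : A ⟶ A) y z) :
    ∃ (x : A) (k : El c pt (z, x)) (s : El σ (x, y) pt), zigEl k (𝟙 y) (𝟙 z) s = t := by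
  induction t using cind (P := c ⊠ₚ 𝟙 A) (Q := zigRight σ) with
  | h b p q =>
    refine ⟨b.1.2, ract c (b := b.1) (b' := (z, b.1.2)) (q.1, 𝟙 b.1.2) p.1,
      lact σ (a := (b.1.2, b.2)) (a' := (b.1.2, y)) (𝟙 b.1.2, p.2) q.2, ?_⟩
    refine (zigEl_ract_left q.1 p.1 (𝟙 y) (𝟙 z) _).trans ((zigEl_lact p.2 p.1 (𝟙 y) _ q.2).trans ?_)
    exact congrArg₂ (fun k l => zigEl (y' := y) (z := z) p.1 k l q.2) (Category.comp_id _)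
      (Category.id_comp _)

/-- The contraction given by the right zig-zag 2-cell. -/
def contractionRight (e : 𝟙 A ≅ leftUnitInv A ≫ (c ⊠ₚ 𝟙 A) ≫ assocHom A A A ≫ (𝟙 A ⊠ₚ σ) ≫
    rightUnitHom A) : Contraction (coevalCurry c) (formCurry σ) where
  hom {y y' x} k s := ev (e ≪≫ zigzagRightIso σ c).inv (a := y') (b := y) (zigEl k (𝟙 y') (𝟙 y) s)
  map_left {z y y' x} g k s := by
    refine Eq.trans (congrArg (ev (e ≪≫ zigzagRightIso σ c).inv (a := y') (b := z)) ?_)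
      (ev_ract (e ≪≫ zigzagRightIso σ c).inv (a := y') g (zigEl k (𝟙 y') (𝟙 y) s))
    refine (zigEl_ract_left g k (𝟙 y') (𝟙 z) s).trans ?_
    exact (congrArg (fun l => zigEl k (𝟙 y') l s)
      ((Category.id_comp g).trans (Category.comp_id g).symm)).trans
        (ract_zigEl g k (𝟙 y') (𝟙 y) s).symm
  map_right {y y' z x} g k s := by
    refine Eq.trans (congrArg (ev (e ≪≫ zigzagRightIso σ c).inv (a := z) (b := y)) ?_)
      (ev_lact (e ≪≫ zigzagRightIso σ c).inv g (b := y) (zigEl k (𝟙 y') (𝟙 y) s))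
    refine (zigEl_lact g k (𝟙 z) (𝟙 y) s).trans ?_
    exact (congrArg (fun l => zigEl k l (𝟙 y) s)
      ((Category.comp_id g).trans (Category.id_comp g).symm)).trans
        (lact_zigEl g k (𝟙 y') (𝟙 y) s).symm
  dinatural {y y' x x'} f k s := congrArg (ev (e ≪≫ zigzagRightIso σ c).inv (a := y') (b := y))
    (zigEl_ract_right f k (𝟙 y') (𝟙 y) s)
  exact {y y' x x'} k s k' s' h := by
    -- Injectivity: the invertible 2-cell carries the equation of morphisms back to the zig-zag
    -- composite, and `zigTens` carries it on to the coend in one variable.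
    have h' := congrArg (ev (e ≪≫ zigzagRightIso σ c).hom (a := y') (b := y)) h
    have key (t) : ev (e ≪≫ zigzagRightIso σ c).hom (a := y') (b := y)
        (ev (e ≪≫ zigzagRightIso σ c).inv t) = t :=
      evEl_hom_inv (e ≪≫ zigzagRightIso σ c) t
    rw [key, key] at h'
    exact (zigTens_zigEl k s).symm.trans ((congrArg zigTens h').trans (zigTens_zigEl k' s'))
  exists_id y := by
    -- The preimage of the identity, in normal form, is the required pair.
    obtain ⟨x, k, s, h⟩ := exists_zigEl
      (ev (e ≪≫ zigzagRightIso σ c).hom (a := y) (b := y) (homEl (𝟙 y)))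
    exact ⟨x, k, s, (congrArg (ev (e ≪≫ zigzagRightIso σ c).inv) h).trans
      (evEl_inv_hom (e ≪≫ zigzagRightIso σ c) (homEl (𝟙 y)))⟩

/-- An element of the left zig-zag composite. -/
def zagEl {x w y v z : A} (f : w ⟶ x) (k : El c pt (y, v)) (s : El σ (w, y) pt) (h : z ⟶ v) :
    El (CategoryTheory.Prod.sectL (A : Type u) pt ⋙ ((𝟙 A ⊠ₚ c) ≫ zigLeft σ) : A ⟶ A) x z :=
  cmk (P := 𝟙 A ⊠ₚ c) (Q := zigLeft σ) (a := (x, pt)) (w, (y, v)) (f, k) (s, h)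

lemma zagEl_sound {x w w' y y' v v' z : A} (a : w ⟶ w') (b : y ⟶ y') (d : v ⟶ v') (f : w' ⟶ x)
    (k : El c pt (y', v')) (s : El σ (w, y) pt) (h : z ⟶ v) :
    zagEl (a ≫ f) (ract c (b := (y', v')) (b' := (y, v)) (b, d) k) s h =
      zagEl f k (lact σ (a := (w, y)) (a' := (w', y')) (a, b) s) (h ≫ d) :=
  csound (P := 𝟙 A ⊠ₚ c) (Q := zigLeft σ) (a := (x, pt)) (b := (w, (y, v)))
    (b' := (w', (y', v'))) (a, (b, d)) (f, k) (s, h)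

lemma zagEl_ract_right {x w y v v' z : A} (d : v ⟶ v') (f : w ⟶ x) (k : El c pt (y, v'))
    (s : El σ (w, y) pt) (h : z ⟶ v) :
    zagEl f (ract c (b := (y, v')) (b' := (y, v)) (𝟙 y, d) k) s h = zagEl f k s (h ≫ d) := by
  have h := zagEl_sound (𝟙 w) (𝟙 y) d f k s h
  rwa [Category.id_comp, lact_form_id] at h

lemma zagEl_ract_left {x w y y' v z : A} (b : y ⟶ y') (f : w ⟶ x) (k : El c pt (y', v))
    (s : El σ (w, y) pt) (h : z ⟶ v) :
    zagEl f (ract c (b := (y', v)) (b' := (y, v)) (b, 𝟙 v) k) s h =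
      zagEl f k (lact σ (a := (w, y)) (a' := (w, y')) (𝟙 w, b) s) h := by
  have h := zagEl_sound (𝟙 w) b (𝟙 v) f k s h
  rwa [Category.id_comp, Category.comp_id] at h

lemma zagEl_lact {x w w' y v z : A} (a : w ⟶ w') (f : w' ⟶ x) (k : El c pt (y, v))
    (s : El σ (w, y) pt) (h : z ⟶ v) :
    zagEl f k (lact σ (a := (w, y)) (a' := (w', y)) (a, 𝟙 y) s) h = zagEl (a ≫ f) k s h := by
  have h := zagEl_sound a (𝟙 y) (𝟙 v) f k s h
  rw [ract_coeval_id, Category.comp_id] at h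
  exact h.symm

lemma ract_zagEl {x w y v z z' : A} (g : z' ⟶ z) (f : w ⟶ x) (k : El c pt (y, v))
    (s : El σ (w, y) pt) (h : z ⟶ v) :
    ract (CategoryTheory.Prod.sectL (A : Type u) pt ⋙ ((𝟙 A ⊠ₚ c) ≫ zigLeft σ) : A ⟶ A)
      (a := x) g (zagEl f k s h) = zagEl f k s (g ≫ h) :=
  congrArg (fun s => zagEl f k s (g ≫ h)) (ract_id σ s)

lemma lact_zagEl {x x' w y v z : A} (g : x ⟶ x') (f : w ⟶ x) (k : El c pt (y, v))
    (s : El σ (w, y) pt) (h : z ⟶ v) :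
    lact (CategoryTheory.Prod.sectL (A : Type u) pt ⋙ ((𝟙 A ⊠ₚ c) ≫ zigLeft σ) : A ⟶ A)
      g (b := z) (zagEl f k s h) = zagEl (f ≫ g) k s h :=
  congrArg (fun k => zagEl (f ≫ g) k s h) (lact_id c k)

/-- The left zig-zag composite as a coend in one variable. -/
def zagTens {x z : A} :
    El (CategoryTheory.Prod.sectL (A : Type u) pt ⋙ ((𝟙 A ⊠ₚ c) ≫ zigLeft σ) : A ⟶ A) x z →
      ((tensLeft (coevalCurry c).flip).obj ((formCurry σ).flip.flip.obj x)).obj (op z) :=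
  clift (P := 𝟙 A ⊠ₚ c) (Q := zigLeft σ) (a := (x, pt))
    (fun b p q => lmk (K := (coevalCurry c).flip) (L := (formCurry σ).flip.flip.obj x) (x := b.2.1)
      (ract c (b := b.2) (b' := (b.2.1, z)) (𝟙 b.2.1, q.2) p.2)
      (lact σ (a := (b.1, b.2.1)) (a' := (x, b.2.1)) (p.1, 𝟙 b.2.1) q.1))
    (fun {b b'} g p q => by
      have h := lmk_sound (K := (coevalCurry c).flip) (L := (formCurry σ).flip.flip.obj x) g.2.1
        (ract c (b := b'.2) (b' := (b'.2.1, z)) (𝟙 b'.2.1, q.2 ≫ g.2.2) p.2)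
        (lact σ (a := (b.1, b.2.1)) (a' := (x, b.2.1)) (g.1 ≫ p.1, 𝟙 b.2.1) q.1)
      refine Eq.trans ?_ (h.trans ?_)
      · refine congrArg (fun k => lmk (K := (coevalCurry c).flip)
          (L := (formCurry σ).flip.flip.obj x) (x := b.2.1) k _) ?_
        refine (ract_ract_coeval g.2.1 (𝟙 _) g.2.2 q.2 p.2).trans (Eq.trans ?_
          (ract_ract_coeval (𝟙 _) g.2.1 (q.2 ≫ g.2.2) (𝟙 z) p.2).symm)
        rw [Category.id_comp]
        exact congrArg₂ (fun k l => ract c (b := b'.2) (b' := (b.2.1, z)) (k, l) p.2)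
          (Category.comp_id _).symm (Category.id_comp _).symm
      · refine congrArg (fun k => lmk (K := (coevalCurry c).flip)
          (L := (formCurry σ).flip.flip.obj x) (x := b'.2.1) _ k) ?_
        refine (lact_lact_form (g.1 ≫ p.1) (𝟙 _) (𝟙 _) g.2.1 q.1).trans (Eq.trans ?_
          (lact_lact_form g.1 p.1 g.2.1 (𝟙 _) q.1).symm)
        rw [Category.id_comp, Category.comp_id, Category.comp_id])

lemma zagTens_zagEl {x y z : A} (k : El c pt (y, z)) (s : El σ (x, y) pt) :
    zagTens (zagEl (𝟙 x) k s (𝟙 z)) =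
      lmk (K := (coevalCurry c).flip) (L := (formCurry σ).flip.flip.obj x) k s :=
  congrArg₂ (fun k s => lmk (K := (coevalCurry c).flip) (L := (formCurry σ).flip.flip.obj x) k s)
    (ract_coeval_id k) (lact_form_id s)

lemma exists_zagEl {x z : A} (t : El (CategoryTheory.Prod.sectL (A : Type u) pt ⋙
    ((𝟙 A ⊠ₚ c) ≫ zigLeft σ) : A ⟶ A) x z) :
    ∃ (y : A) (k : El c pt (y, z)) (s : El σ (x, y) pt), zagEl (𝟙 x) k s (𝟙 z) = t := by
  induction t using cind (P := 𝟙 A ⊠ₚ c) (Q := zigLeft σ) with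
  | h b p q =>
    refine ⟨b.2.1, ract c (b := b.2) (b' := (b.2.1, z)) (𝟙 b.2.1, q.2) p.2,
      lact σ (a := (b.1, b.2.1)) (a' := (x, b.2.1)) (p.1, 𝟙 b.2.1) q.1, ?_⟩
    refine (zagEl_ract_right q.2 (𝟙 x) p.2 _ (𝟙 z)).trans
      ((zagEl_lact p.1 (𝟙 x) p.2 q.1 _).trans ?_)
    exact congrArg₂ (fun k l => zagEl (x := x) (z := z) k p.2 q.1 l) (Category.comp_id _)
      (Category.id_comp _)

/-- The contraction given by the left zig-zag 2-cell. -/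
def contractionLeft (e : rightUnitInv A ≫ (𝟙 A ⊠ₚ c) ≫ assocInv A A A ≫ (σ ⊠ₚ 𝟙 A) ≫
    leftUnitHom A ≅ 𝟙 A) : Contraction (coevalCurry c).flip (formCurry σ).flip where
  -- `e.symm` appears because the left zig-zag 2-cell of a pairing ends at the identity, whereas the
  -- right one starts there.
  hom {z x y} k s := ev (e.symm ≪≫ zigzagLeftIso σ c).inv (a := x) (b := z)
    (zagEl (𝟙 x) k s (𝟙 z))
  map_left {z' z x y} g k s := by
    refine Eq.trans (congrArg (ev (e.symm ≪≫ zigzagLeftIso σ c).inv (a := x) (b := z')) ?_)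
      (ev_ract (e.symm ≪≫ zigzagLeftIso σ c).inv (a := x) g (zagEl (𝟙 x) k s (𝟙 z)))
    refine (zagEl_ract_right g (𝟙 x) k s (𝟙 z')).trans ?_
    exact (congrArg (fun l => zagEl (𝟙 x) k s l)
      ((Category.id_comp g).trans (Category.comp_id g).symm)).trans
        (ract_zagEl g (𝟙 x) k s (𝟙 z)).symm
  map_right {z x x' y} g k s := by
    refine Eq.trans (congrArg (ev (e.symm ≪≫ zigzagLeftIso σ c).inv (a := x') (b := z)) ?_)
      (ev_lact (e.symm ≪≫ zigzagLeftIso σ c).inv g (b := z) (zagEl (𝟙 x) k s (𝟙 z)))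
    refine (zagEl_lact g (𝟙 x') k s (𝟙 z)).trans ?_
    exact (congrArg (fun l => zagEl l k s (𝟙 z))
      ((Category.comp_id g).trans (Category.id_comp g).symm)).trans
        (lact_zagEl g (𝟙 x) k s (𝟙 z)).symm
  dinatural {z x y y'} f k s := congrArg (ev (e.symm ≪≫ zigzagLeftIso σ c).inv (a := x) (b := z))
    (zagEl_ract_left f (𝟙 x) k s (𝟙 z))
  exact {z x y y'} k s k' s' h := by
    have h' := congrArg (ev (e.symm ≪≫ zigzagLeftIso σ c).hom (a := x) (b := z)) h
    have key (t) : ev (e.symm ≪≫ zigzagLeftIso σ c).hom (a := x) (b := z)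
        (ev (e.symm ≪≫ zigzagLeftIso σ c).inv t) = t :=
      evEl_hom_inv (e.symm ≪≫ zigzagLeftIso σ c) t
    rw [key, key] at h'
    exact (zagTens_zagEl k s).symm.trans ((congrArg zagTens h').trans (zagTens_zagEl k' s'))
  exists_id x := by
    obtain ⟨y, k, s, h⟩ := exists_zagEl
      (ev (e.symm ≪≫ zigzagLeftIso σ c).hom (a := x) (b := x) (homEl (𝟙 x)))
    exact ⟨y, k, s, (congrArg (ev (e.symm ≪≫ zigzagLeftIso σ c).inv) h).trans
      (evEl_inv_hom (e.symm ≪≫ zigzagLeftIso σ c) (homEl (𝟙 x)))⟩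

end Pairing

end Prof

/-! ### The duality of `C`. -/

namespace Prof

section Yoneda

variable {A B : Type u} [SmallCategory A] [SmallCategory B]

/-- `∫ᵇ Hom(b, y) × S(-, b) ≅ S(-, y)`. -/
def tensRightYoneda (S : A ⥤ B ⥤ Type u) (y : B) :
    (tensRight S).obj (yoneda.obj y) ≅ S.flip.obj y :=
  NatIso.ofComponents
    (fun x => Equiv.toIso
      { toFun := rlift (S := S) (M := yoneda.obj y) (fun z (f : z ⟶ y) s => (S.obj x).map f s)
          (fun g f s => (S.obj x).map_comp_apply g f s)
        invFun := fun s => rmk (S := S) (M := yoneda.obj y) (𝟙 y) s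
        left_inv := fun t => by
          induction t using rmk_ind (S := S) (M := yoneda.obj y) with
          | h z f s =>
            exact (rmk_sound (S := S) (M := yoneda.obj y) f (𝟙 y) s).symm.trans
              (congrArg (fun k => rmk (S := S) (M := yoneda.obj y) k s) (Category.comp_id f))
        right_inv := fun s => (S.obj x).map_id_apply _ s })
    (fun {x x'} f => by
      ext t
      induction t using rmk_ind (S := S) (M := yoneda.obj y) (x := x) with
      | h z g s => exact (ConcreteCategory.congr_hom ((S.map f).naturality g) s).symm)

/-- `∫ᵃ K(-, a) × Hom(x, a) ≅ K(-, x)`. -/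
def tensLeftCoyoneda (K : Bᵒᵖ ⥤ Aᵒᵖ ⥤ Type u) (x : A) :
    (tensLeft K).obj (coyoneda.obj (op x)) ≅ K.flip.obj (op x) :=
  NatIso.ofComponents
    (fun y => Equiv.toIso
      { toFun := llift (K := K) (L := coyoneda.obj (op x)) (y := y.unop)
          (fun z k (f : x ⟶ z) => (K.obj y).map f.op k)
          (fun {z z'} g k f => ((K.obj y).map_comp_apply g.op (Quiver.Hom.op (show x ⟶ z from f))
              k).symm)
        invFun := fun k => lmk (K := K) (L := coyoneda.obj (op x)) k (𝟙 x)
        left_inv := fun t => by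
          induction t using lmk_ind (K := K) (L := coyoneda.obj (op x)) (y := y.unop) with
          | h z k f =>
            exact (lmk_sound (K := K) (L := coyoneda.obj (op x)) (y := y.unop) f k (𝟙 x)).trans
              (congrArg (fun l => lmk (K := K) (L := coyoneda.obj (op x)) (y := y.unop) k l)
                (Category.id_comp f))
        right_inv := fun k => (K.obj y).map_id_apply _ k })
    (fun {y y'} g => by
      ext t
      induction t using lmk_ind (K := K) (L := coyoneda.obj (op x)) (y := y.unop) with
      | h z k f =>
        exact (ConcreteCategory.congr_hom ((K.map g).naturality
            (Quiver.Hom.op (show x ⟶ z from f))) k).symm)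

end Yoneda

section Duality

variable {A : Prof.{u}} {C : Type u} [SmallCategory C] {ι : (A : Type u)ᵒᵖ ⥤ C}

lemma IsRetractDense.exists_retract_conerve (h : IsRetractDense ι) (X : C) :
    ∃ a : A, Nonempty (Retract ((conerve ι).obj X) (coyoneda.obj (op a))) := by
  obtain ⟨a, ⟨r⟩⟩ := h.exists_retract X
  have := h.full
  have := h.faithful
  exact ⟨a, ⟨(r.map (conerve ι)).trans (Retract.ofIso (conerveObjIso (ι := ι) a).symm)⟩⟩

variable [IsIdempotentComplete C] {K : (A : Type u)ᵒᵖ ⥤ (A : Type u)ᵒᵖ ⥤ Type u}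
  {S : (A : Type u) ⥤ (A : Type u) ⥤ Type u}

/-- The transform preserves retracts and sends the representable at `a` to `S(-, a)`, which is a
retract of a corepresentable. -/
lemma IsRetractDense.essImage_tensRight (h : IsRetractDense ι) (κ : Contraction K S)
    (κ' : Contraction K.flip S.flip) (Y : C) :
    (conerve ι).essImage ((tensRight S).obj ((nerve ι).obj Y).unop) := by
  obtain ⟨a, ⟨r⟩⟩ := h.exists_retract_nerve Y
  obtain ⟨b, ⟨s⟩⟩ := Contraction.exists_retract_coyoneda κ κ' a
  exact h.conerve_essImage
    (((r.map (tensRight S)).trans (Retract.ofIso (tensRightYoneda S a))).trans s)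

lemma IsRetractDense.essImage_tensLeft (h : IsRetractDense ι) (κ : Contraction K S)
    (κ' : Contraction K.flip S.flip) (X : C) :
    (nerve ι).essImage (op ((tensLeft K).obj ((conerve ι).obj X))) := by
  obtain ⟨a, ⟨r⟩⟩ := h.exists_retract_conerve X
  obtain ⟨b, ⟨s⟩⟩ := Contraction.exists_retract_yoneda κ κ' a
  exact h.nerve_essImage
    (((r.map (tensLeft K)).trans (Retract.ofIso (tensLeftCoyoneda K a))).trans s)

/-- A pair of contractions induces a duality of `C`. -/
lemma IsRetractDense.exists_duality (h : IsRetractDense ι) (κ : Contraction K S)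
    (κ' : Contraction K.flip S.flip) : ∃ D : C ≌ Cᵒᵖ,
      Nonempty (D.functor ⋙ (conerve ι).op ≅ nerve ι ⋙ (tensRight S).op) := by
  have := h.nerve_full
  have := h.nerve_faithful
  have := h.conerve_full
  have := h.conerve_faithful
  let e := Contraction.equivalence κ κ'
  have : (tensRight S).Full := inferInstanceAs e.functor.Full
  have : (tensRight S).Faithful := inferInstanceAs e.functor.Faithful
  have hD (Y : C) : (conerve ι).op.essImage ((nerve ι ⋙ (tensRight S).op).obj Y) := by
    obtain ⟨Z, ⟨i⟩⟩ := h.essImage_tensRight κ κ' Y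
    exact ⟨op Z, ⟨i.op.symm⟩⟩
  -- The transform of the presheaf of `Y` is, up to isomorphism, the copresheaf of an object of `C`;
  -- that object is the dual of `Y`. Full faithfulness of `D` is inherited from the transform and
  -- the two embeddings.
  let D := Functor.essImage.liftFunctor (nerve ι ⋙ (tensRight S).op) (conerve ι).op hD
  let i : D ⋙ (conerve ι).op ≅ nerve ι ⋙ (tensRight S).op :=
    Functor.essImage.liftFunctorCompIso _ _ hD
  have : D.Full := Functor.Full.of_comp_faithful_iso i
  have : D.Faithful := Functor.Faithful.of_comp_iso i
  -- The inverse transform of the copresheaf of `X` is the presheaf of some `Y`, and the counit of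
  -- the equivalence identifies the dual of `Y` with `X`.
  have : D.EssSurj := ⟨fun X => by
    obtain ⟨Y, ⟨j⟩⟩ := h.essImage_tensLeft κ κ' X.unop
    refine ⟨Y, ⟨(conerve ι).op.preimageIso (i.app Y ≪≫ (tensRight S).op.mapIso j ≪≫ ?_)⟩⟩
    exact (e.counitIso.app ((conerve ι).obj X.unop)).op.symm⟩
  have : D.IsEquivalence := { }
  exact ⟨D.asEquivalence, ⟨i⟩⟩

end Duality

end Prof

/-! ### Convolution along the form computes morphisms into a dual. -/

namespace Prof

open Bicategory

section Fubini

variable {A : Prof.{u}} (σ : tensorObj A A ⟶ unitObj) (M N : Psh A)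

/-- The convolution along a form, as an iterated coend. -/
def convFormEquiv : (conv σ M N).obj (op pt) ≃
    (tens.obj M).obj ((tensRight (formCurry σ)).obj N) where
  toFun := clift (P := ofPsh M ⊠ₚ ofPsh N) (Q := σ) (a := (pt, pt)) (c := pt)
    (fun b p s => Tens.mk b.1 p.1 (rmk (S := formCurry σ) (x := b.1) (y := b.2) p.2 s))
    (fun {b b'} g p s => by
      refine (Tens.sound g.1 p.1 _).trans (congrArg (Tens.mk b'.1 p.1) ?_)
      refine (rmk_sound (S := formCurry σ) (x := b'.1) g.2 p.2
        (lact σ (a := b) (a' := (b'.1, b.2)) (g.1, 𝟙 b.2) s)).trans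
          (congrArg (rmk (S := formCurry σ) (x := b'.1) p.2) ?_)
      refine (lact_lact_form g.1 (𝟙 _) (𝟙 _) g.2 s).trans ?_
      exact congrArg₂ (fun k l => lact σ (a := b) (a' := b') (k, l) s) (Category.comp_id _)
        (Category.id_comp _))
  invFun := Tens.lift
    (fun x m => rlift (fun y n s => cv (Q := σ) (x := pt) (y := x) (z := y) m n s)
      (fun {y y'} g n s => (congrArg (fun k => cv (Q := σ) (M := M) (N := N) k (N.map g.op n) s)
        (M.map_id_apply (op x) m).symm).trans (cv_sound (𝟙 x) g m n s)))
    (fun {x x'} f m t => by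
      induction t using rmk_ind with
      | h y n s =>
        exact (congrArg (fun k => cv (Q := σ) (M := M) (N := N) (M.map f.op m) k s)
          (N.map_id_apply (op y) n).symm).trans (cv_sound f (𝟙 y) m n s))
  left_inv t := by
    induction t using cv_ind with
    | h y z m n q => rfl
  right_inv t := by
    induction t using Tens.ind with
    | h x m t =>
      induction t using rmk_ind with
      | h y n s => rfl

end Fubini

section Represent

open MonoidalCategory

variable {A : Prof.{u}} {C : Type u} [SmallCategory C] {ι : (A : Type u)ᵒᵖ ⥤ C}

/-- Composition `∫ˣ Hom(X, ι x) × Hom(ι x, Z) ⟶ Hom(X, Z)`. -/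
def tensHom (X Z : C) : (tens.obj (nervePsh ι X)).obj ((conerve ι).obj Z) → (X ⟶ Z) :=
  Tens.lift (F := nervePsh ι X) (G := (conerve ι).obj Z)
    (fun x (f : X ⟶ ι.obj (op x)) (g : ι.obj (op x) ⟶ Z) => f ≫ g)
    (fun _ _ _ => Category.assoc _ _ _)

/-- The co-Yoneda lemma for retract-dense `ι`: a morphism `f` out of `X` is the class of `(r.i, r.r
≫ f)`, and any factorization through some `ι x` is related to this one by the morphism `r.r ≫ f'`
between objects of `A`. -/
lemma IsRetractDense.tensHom_bijective (h : IsRetractDense ι) (X Z : C) :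
    Function.Bijective (tensHom (ι := ι) X Z) := by
  obtain ⟨a, ⟨r⟩⟩ := h.exists_retract X
  have := h.full
  refine Function.bijective_iff_has_inverse.2
    ⟨fun f => Tens.mk (F := nervePsh ι X) (G := (conerve ι).obj Z) a r.i (r.r ≫ f),
      fun t => ?_, fun f => ?_⟩
  · induction t using Tens.ind with
    | h x f g =>
      let f' : X ⟶ ι.obj (op x) := f
      let g' : ι.obj (op x) ⟶ Z := g
      have h₁ := Tens.sound (F := nervePsh ι X) (G := (conerve ι).obj Z)
        (ι.preimage (r.r ≫ f')).unop r.i g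
      have h₂ : r.i ≫ ι.map (ι.preimage (r.r ≫ f')) = f' := by
        rw [ι.map_preimage, r.retract_assoc]
      have h₃ : ι.map (ι.preimage (r.r ≫ f')) ≫ g' = r.r ≫ f' ≫ g' := by
        rw [ι.map_preimage, Category.assoc]
      exact (congrArg (Tens.mk (F := nervePsh ι X) (G := (conerve ι).obj Z) a r.i) h₃).symm.trans
        (h₁.symm.trans (congrArg (fun k => Tens.mk (F := nervePsh ι X) (G := (conerve ι).obj Z) x k
            g)
          h₂))
  · change r.i ≫ r.r ≫ f = f
    rw [r.retract_assoc]

variable {σ : tensorObj A A ⟶ unitObj} (h : IsRetractDense ι) {D : C ≌ Cᵒᵖ}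
  (δ : D.functor ⋙ (conerve ι).op ≅ nerve ι ⋙ (tensRight (formCurry σ)).op)

/-- The comparison of the transform of `Hom(Y, ι -)` with the dual of `Y`. -/
def dualIso (Y : C) : (tensRight (formCurry σ)).obj (nervePsh ι Y) ≅
    (conerve ι).obj (D.functor.obj Y).unop :=
  (δ.app Y).unop

/-- The morphism `ι x ⟶ D Y` represented by an element of the transform of `Hom(Y, ι -)`. -/
def dualHom {Y : C} {x : A} (t : ((tensRight (formCurry σ)).obj (nervePsh ι Y)).obj x) :
    ι.obj (op x) ⟶ (D.functor.obj Y).unop :=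
  (dualIso δ Y).hom.app x t

lemma dualHom_comp {Y Y' : C} (g : Y' ⟶ Y) {x : A}
    (t : ((tensRight (formCurry σ)).obj (nervePsh ι Y)).obj x) :
    dualHom δ t ≫ (D.functor.map g).unop =
      dualHom δ (((tensRight (formCurry σ)).map (nervePshMap ι g)).app x t) :=
  congrArg (fun k => k.unop.app x t) (δ.hom.naturality g)

/-- Morphisms `X ⟶ D Y` as elements of a convolution along the form. -/
noncomputable def convHomEquiv (X Y : C) :
    (conv σ (nervePsh ι X) (nervePsh ι Y)).obj (op pt) ≃ (X ⟶ (D.functor.obj Y).unop) :=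
  ((convFormEquiv σ _ _).trans ((tens.obj (nervePsh ι X)).mapIso (dualIso δ Y)).toEquiv).trans
    (Equiv.ofBijective _ (h.tensHom_bijective X _))

lemma convHomEquiv_naturality {X X' Y Y' : C} (f : X' ⟶ X) (g : Y' ⟶ Y)
    (t : (conv σ (nervePsh ι X) (nervePsh ι Y)).obj (op pt)) :
    convHomEquiv h δ X' Y' ((convMap σ (nervePshMap ι f) (nervePshMap ι g)).app (op pt) t) =
      f ≫ convHomEquiv h δ X Y t ≫ (D.functor.map g).unop := by
  induction t using cv_ind with
  | h x y p q s =>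
    refine Eq.trans ?_ (congrArg (fun k => f ≫ k)
      ((congrArg (fun k => nerveElHom p ≫ k) (dualHom_comp δ g
        (rmk (S := formCurry σ) q s))).symm.trans (Category.assoc _ _ _).symm))
    exact Category.assoc f (nerveElHom p) _

/-- The morphism `ι x ⟶ D (ι y)` represented by an element of the form. -/
noncomputable def formMk {x y : A} (s : El σ (x, y) pt) :
    ι.obj (op x) ⟶ (D.functor.obj (ι.obj (op y))).unop :=
  convHomEquiv h δ _ _ (cv (nerveEl (𝟙 _)) (nerveEl (𝟙 _)) s)

/-- Every class is a pullback of the universal class with identities, so naturality reduces the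
bijection to `formMk`. -/
lemma convHomEquiv_cv_eq {X Y : C} {x y : A} (f : X ⟶ ι.obj (op x)) (g : Y ⟶ ι.obj (op y))
    (s : El σ (x, y) pt) :
    convHomEquiv h δ X Y (cv (nerveEl f) (nerveEl g) s) =
      f ≫ formMk h δ s ≫ (D.functor.map g).unop := by
  rw [formMk, ← convHomEquiv_naturality, convMap_cv]
  exact congrArg₂ (fun k l => convHomEquiv h δ X Y (cv (nerveEl k) (nerveEl l) s))
    (Category.comp_id f).symm (Category.comp_id g).symm

lemma formMk_lact {x x' y y' : A} (f : x ⟶ x') (g : y ⟶ y') (s : El σ (x, y) pt) :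
    formMk h δ (lact σ (a := (x, y)) (a' := (x', y')) (f, g) s) =
      ι.map f.op ≫ formMk h δ s ≫ (D.functor.map (ι.map g.op)).unop := by
  rw [← convHomEquiv_cv_eq, formMk, ← cv_sound]
  exact congrArg₂ (fun k l => convHomEquiv h δ _ _ (cv (nerveEl k) (nerveEl l) s))
    (Category.id_comp _) (Category.id_comp _)

/-- As for the multiplication: evaluate on representables, replace them by the presheaves of `ι x`
and `ι y`, and apply `convHomEquiv`. -/
lemma formMk_bijective (x y : A) :
    Function.Bijective (fun s : El σ (x, y) pt => formMk h δ s) := by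
  have := h.full
  have := h.faithful
  have hb := (((convYoneda σ x y).symm ≪≫
    convMapIso σ (nerveObjIso (ι := ι) x) (nerveObjIso (ι := ι) y)).app (op pt)).toEquiv.trans
      (convHomEquiv h δ _ _) |>.bijective
  have key (s : El σ (x, y) pt) : formMk h δ s = ((((convYoneda σ x y).symm ≪≫
      convMapIso σ (nerveObjIso (ι := ι) x) (nerveObjIso (ι := ι) y)).app (op pt)).toEquiv.trans
        (convHomEquiv h δ _ _)) s :=
    congrArg₂ (fun k l => convHomEquiv h δ _ _ (cv (nerveEl k) (nerveEl l) s)) (ι.map_id _).symm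
      (ι.map_id _).symm
  refine ⟨fun s s' H => hb.1 ((key s).symm.trans (H.trans (key s'))), fun f => ?_⟩
  obtain ⟨s, hs⟩ := hb.2 f
  exact ⟨s, (key s).trans hs⟩

/-- The duality represents the form. -/
noncomputable def formIso : σ ≅ formRep ι D :=
  isoOfBijective
    (homMk (P := σ) (Q := formRep ι D) (fun _ _ s => formMk h δ s)
      (fun {_ _} f {_} s => formMk_lact h δ f.1 f.2 s)
      (fun {a b b'} g s => by
        obtain rfl : b' = b := Subsingleton.elim _ _
        obtain rfl : g = 𝟙 _ := Subsingleton.elim _ _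
        exact (congrArg (formMk h δ) (ract_id σ s)).trans
          (ract_id (formRep ι D) (formMk h δ s)).symm))
    (fun a _ => formMk_bijective h δ a.1 a.2)

end Represent

/-! ### Invariance of the form as the star-autonomous bijection. -/

section Invariance

open MonoidalCategory

variable {A : Prof.{u}} {C : Type u} [SmallCategory C] {ι : (A : Type u)ᵒᵖ ⥤ C}
  (F : Pseudomonoid A) [MonoidalCategory C] [(convNerve F ι).Monoidal]
  {σ : tensorObj A A ⟶ unitObj}
  (θ : (F.mul ⊠ₚ 𝟙 A) ≫ σ ≅ assocHom A A A ≫ (𝟙 A ⊠ₚ F.mul) ≫ σ)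

/-- Invariance of the form, on restricted representables. -/
def invarianceIso (X Y Z : C) : conv σ (nervePsh ι (X ⊗ Y)) (nervePsh ι Z) ≅
    conv σ (nervePsh ι X) (nervePsh ι (Y ⊗ Z)) :=
  convMapIso σ (tensorIso ι F X Y).symm (Iso.refl _) ≪≫ convAssoc F.mul σ θ _ _ _ ≪≫
    convMapIso σ (Iso.refl _) (tensorIso ι F Y Z)

/-- The squares for the two tensor comparisons are `h₂` and `h₃`; the middle square is naturality of
the convolution associator for `θ`. -/
lemma invarianceIso_naturality {X X' Y Y' Z Z' : C} (f : X' ⟶ X) (g : Y' ⟶ Y) (k : Z' ⟶ Z) :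
    convMap σ (nervePshMap ι (f ⊗ₘ g)) (nervePshMap ι k) ≫ (invarianceIso F θ X' Y' Z').hom =
      (invarianceIso F θ X Y Z).hom ≫ convMap σ (nervePshMap ι f) (nervePshMap ι (g ⊗ₘ k)) := by
  have h₁ : nervePshMap ι (f ⊗ₘ g) ≫ (tensorIso ι F X' Y').inv =
      (tensorIso ι F X Y).inv ≫ convMap F.mul (nervePshMap ι f) (nervePshMap ι g) := by
    rw [Iso.comp_inv_eq, Category.assoc, tensorIso_naturality, Iso.inv_hom_id_assoc]
  have h₂ : convMap σ (nervePshMap ι (f ⊗ₘ g)) (nervePshMap ι k) ≫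
      convMap σ (tensorIso ι F X' Y').inv (𝟙 _) =
      convMap σ (tensorIso ι F X Y).inv (𝟙 _) ≫
        convMap σ (convMap F.mul (nervePshMap ι f) (nervePshMap ι g)) (nervePshMap ι k) := by
    rw [← convMap_comp, ← convMap_comp, h₁, Category.comp_id, Category.id_comp]
  have h₃ : convMap σ (nervePshMap ι f) (convMap F.mul (nervePshMap ι g) (nervePshMap ι k)) ≫
      convMap σ (𝟙 _) (tensorIso ι F Y' Z').hom =
      convMap σ (𝟙 _) (tensorIso ι F Y Z).hom ≫
        convMap σ (nervePshMap ι f) (nervePshMap ι (g ⊗ₘ k)) := by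
    rw [← convMap_comp, ← convMap_comp, tensorIso_naturality, Category.comp_id, Category.id_comp]
  have h₄ := convAssoc_naturality θ (nervePshMap ι f) (nervePshMap ι g) (nervePshMap ι k)
  change _ ≫ convMap σ (tensorIso ι F X' Y').inv (𝟙 _) ≫ (convAssoc F.mul σ θ _ _ _).hom ≫
      convMap σ (𝟙 _) (tensorIso ι F Y' Z').hom =
    (convMap σ (tensorIso ι F X Y).inv (𝟙 _) ≫ (convAssoc F.mul σ θ _ _ _).hom ≫
      convMap σ (𝟙 _) (tensorIso ι F Y Z).hom) ≫ _
  rw [reassoc_of% h₂, reassoc_of% h₄, h₃]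
  simp only [Category.assoc]

variable (h : IsRetractDense ι) {D : C ≌ Cᵒᵖ}
  (δ : D.functor ⋙ (conerve ι).op ≅ nerve ι ⋙ (tensRight (formCurry σ)).op)

/-- The bijections `Hom(X ⊗ Y, D Z) ≃ Hom(X, D (Y ⊗ Z))`. -/
noncomputable def dualTensorEquiv (X Y Z : C) :
    (X ⊗ Y ⟶ (D.functor.obj Z).unop) ≃ (X ⟶ (D.functor.obj (Y ⊗ Z)).unop) :=
  ((convHomEquiv h δ (X ⊗ Y) Z).symm.trans ((invarianceIso F θ X Y Z).app (op pt)).toEquiv).trans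
    (convHomEquiv h δ X (Y ⊗ Z))

lemma dualTensorEquiv_convHomEquiv {X Y Z : C}
    (t : (conv σ (nervePsh ι (X ⊗ Y)) (nervePsh ι Z)).obj (op pt)) :
    dualTensorEquiv F θ h δ X Y Z (convHomEquiv h δ (X ⊗ Y) Z t) =
      convHomEquiv h δ X (Y ⊗ Z) ((invarianceIso F θ X Y Z).hom.app (op pt) t) :=
  congrArg (fun t => convHomEquiv h δ X (Y ⊗ Z) ((invarianceIso F θ X Y Z).hom.app (op pt) t))
    ((convHomEquiv h δ (X ⊗ Y) Z).symm_apply_apply t)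

lemma dualTensorEquiv_naturality {X X' Y Y' Z Z' : C} (f : X' ⟶ X) (g : Y' ⟶ Y) (k : Z' ⟶ Z)
    (t : X ⊗ Y ⟶ (D.functor.obj Z).unop) :
    dualTensorEquiv F θ h δ X' Y' Z' ((f ⊗ₘ g) ≫ t ≫ (D.functor.map k).unop) =
      f ≫ dualTensorEquiv F θ h δ X Y Z t ≫ (D.functor.map (g ⊗ₘ k)).unop := by
  obtain ⟨t, rfl⟩ := (convHomEquiv h δ (X ⊗ Y) Z).surjective t
  rw [← convHomEquiv_naturality, dualTensorEquiv_convHomEquiv, dualTensorEquiv_convHomEquiv,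
    ← convHomEquiv_naturality]
  exact congrArg (fun φ => convHomEquiv h δ X' (Y' ⊗ Z') (φ.app (op pt) t))
    (invarianceIso_naturality F θ f g k)

/-- Under `convHomEquiv` both sides are classes in convolutions along `σ`, so the claim is the value
of the convolution associator recorded by `H`. -/
lemma dualTensorEquiv_mulMk {a b c x y x' y' : A} {m : El F.mul (a, b) x} {k : y ⟶ c}
    {s : El σ (x, y) pt} {k' : x' ⟶ a} {m' : El F.mul (b, c) y'} {s' : El σ (x', y') pt}
    (H : AssocRel θ m k s k' m' s') :
    dualTensorEquiv F θ h δ (ι.obj (op a)) (ι.obj (op b)) (ι.obj (op c))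
        (mulMk m ≫ formMk h δ s ≫ (D.functor.map (ι.map k.op)).unop) =
      ι.map k'.op ≫ formMk h δ s' ≫ (D.functor.map (mulMk m')).unop := by
  rw [← convHomEquiv_cv_eq, ← convHomEquiv_cv_eq, dualTensorEquiv_convHomEquiv]
  refine congrArg (convHomEquiv h δ _ _) ?_
  -- `mulMk m` is by definition the comparison applied to the universal class of `m`, so the inverse
  -- comparison recovers that class.
  have h₁ : (tensorIso ι F (ι.obj (op a)) (ι.obj (op b))).inv.app (op x) (nerveEl (mulMk m)) =
      cv (nerveEl (𝟙 _)) (nerveEl (𝟙 _)) m :=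
    congrArg (fun φ => φ.app (op x) (cv (nerveEl (𝟙 _)) (nerveEl (𝟙 _)) m))
      (tensorIso ι F (ι.obj (op a)) (ι.obj (op b))).hom_inv_id
  have h₂ : nerveEl (ι.map k.op) = (nervePsh ι (ι.obj (op c))).map k.op (nerveEl (𝟙 _)) :=
    (Category.id_comp _).symm
  refine (congrArg₂ (fun p q => (convAssoc F.mul σ θ _ _ _ ≪≫ convMapIso σ (Iso.refl _)
    (tensorIso ι F (ι.obj (op b)) (ι.obj (op c)))).hom.app (op pt) (cv p q s)) h₁ h₂).trans ?_
  refine (congrArg ((convMapIso σ (Iso.refl _)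
    (tensorIso ι F (ι.obj (op b)) (ι.obj (op c)))).hom.app (op pt))
      (convAssoc_hom_cv H (nerveEl (𝟙 _)) (nerveEl (𝟙 _)) (nerveEl (𝟙 _)))).trans ?_
  exact congrArg (fun k => cv (nerveEl k) (nerveEl (mulMk m')) s') (Category.id_comp (ι.map k'.op))

end Invariance

/-! ### Assembly, and the two retract-dense embeddings. -/

section Main

variable {A : Prof.{u}} {C : Type u} [SmallCategory C] {ι : (A : Type u)ᵒᵖ ⥤ C}
  [IsIdempotentComplete C]

/-- A †-Frobenius pseudomonoid induces a ⋆-autonomous structure on an idempotent complete category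
in which `Aᵒᵖ` is retract dense. -/
theorem IsRetractDense.nonempty_induced (h : IsRetractDense ι)
    (F : DaggerFrobeniusPseudomonoid A) : Nonempty (InducedStarAutonomous F ι) := by
  obtain ⟨_, ⟨_⟩⟩ :=
    h.exists_monoidal F.toPseudomonoid F.mul_isLeftAdjoint F.one_isLeftAdjoint
  obtain ⟨D, ⟨δ⟩⟩ := h.exists_duality (contractionRight F.pairing.zigzagRight)
    (contractionLeft F.pairing.zigzagLeft)
  have := h.full
  have := h.faithful
  exact ⟨{
    monoidal := inferInstance
    star :=
      { D := D
        formEquiv := dualTensorEquiv F.toPseudomonoid F.invariance h δ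
        formEquiv_naturality := dualTensorEquiv_naturality F.toPseudomonoid F.invariance h δ }
    mulIso := mulIso ι F.toPseudomonoid
    oneIso := oneIso ι F.toPseudomonoid
    formIso := formIso h δ
    assoc_compat := fun _ _ _ _ _ _ H => mulMk_assoc H
    leftUnit_compat := fun e k n => mulMk_leftUnit e k n
    rightUnit_compat := fun k e n => mulMk_rightUnit k e n
    form_compat := fun _ _ _ _ _ _ H =>
      dualTensorEquiv_mulMk F.toPseudomonoid F.invariance h δ H }⟩

/-- An object of the Karoubi envelope is an idempotent on some object of `Aᵒᵖ`, and that idempotent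
exhibits it as a retract of this object. -/
lemma isRetractDense_toKaroubi (A : Prof.{u}) :
    IsRetractDense (Idempotents.toKaroubi (A : Type u)ᵒᵖ) where
  full := inferInstance
  faithful := inferInstance
  exists_retract X := ⟨X.X.unop, ⟨
    { i := Idempotents.Karoubi.decompId_i X
      r := Idempotents.Karoubi.decompId_p X
      retract := (Idempotents.Karoubi.decompId X).symm }⟩⟩

lemma isRetractDense_id (A : Prof.{u}) : IsRetractDense (𝟭 (A : Type u)ᵒᵖ) where
  full := inferInstance
  faithful := inferInstance
  exists_retract X := ⟨X.unop, ⟨Retract.refl X⟩⟩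

end Main

end Prof

theorem mainTheorem3 (A : Prof.{u}) (F : Prof.DaggerFrobeniusPseudomonoid A) :
    Nonempty (Prof.InducedStarAutonomous F (Idempotents.toKaroubi (A : Type u)ᵒᵖ)) ∧
      (IsIdempotentComplete A →
        Nonempty (Prof.InducedStarAutonomous F (𝟭 (A : Type u)ᵒᵖ))) :=
  ⟨(Prof.isRetractDense_toKaroubi A).nonempty_induced F, fun _ =>
    have : IsIdempotentComplete (A : Type u)ᵒᵖ := inferInstance
    (Prof.isRetractDense_id A).nonempty_induced F⟩
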